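/- **Setting.** A network consists of a finite digraph $G$ (parallel arcs allowed, every arc of capacity $1$) embedded on the sphere, a demand digraph $H$ on the vertices of $G$ and a request $r(h)\in\mathbb N$ for every $h\in E(H)$. Assume that $G$ is acyclic; that $G+H$ is Eulerian, i.e. at every vertex $\deg^+_G(v)+\sum_{h\in\delta^+_H(v)}r(h)=\deg^-_G(v)+\sum_{h\in\delta^-_H(v)}r(h)$; and (normalization) that $H$ is a matching, the head $s_h$ of every demand arc $h=t_hs_h$ is a source of $G$ and its tail $t_h$ is a sink of $G$. Let $k=|E(H)|$ and $R=1+\max_{h\in E(H)}r(h)$ (with $\max\emptyset=0$). A *solution* is a set of pairwise arc-disjoint directed paths of $G$, each leading from $s_h$ to $t_h$ for some $h$, with exactly $r(h)$ of them for each $h$. For $v$ an inner vertex of the paths $P$ and $Q$, let $P_v^-,P_v^+$ be the arcs by which $P$ enters and leaves $v$. In the anticlockwise order around $v$, the arcs $Q_v^-,Q_v^+$ are the extremities of two intervals. $P$ *crosses* $Q$ at $v$ if $P_v^-,P_v^+$ are not in the same one of them; otherwise $P$ *goes to the right* of $Q$ at $v$ if $P_v^-$ is before $P_v^+$ in their interval,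 and *to the left* if $P_v^+$ is before $P_v^-$. This is the behaviour of $P$ relative to $Q$ at $v$. The first common vertex of $P$ and $Q$ is the smallest vertex of $V(P)\cap V(Q)$ in an acyclic order of $G$. A solution is *uncrossed* if two of its paths with a common endpoint never cross, and any two of its paths that cross do so only at their first common vertex. The paths of a solution are indexed by their first arcs, which are the arcs leaving the vertices $s_h$. A *routing scheme* is a function that assigns to each ordered pair of indices one of the values *cross*, *left*, *right*, *undefined*. A solution respects it if its value at every pair $(P,Q)$ is the behaviour of $P$ relative to $Q$ at their first common vertex, and *undefined* if there is no common vertex or the first one is not an inner vertex of both. A routing scheme is *feasible* if some uncrossed solution respects it. **Lemma.** For every such network there is a set $\mathcal F$ of at most $R^{4k^2}$ routing schemes that contains all the feasible routing schemes. Moreover, $\mathcal F$ can be polynomially enumerated: there are one algorithm (a program for a random access machine with addition and truncated subtraction at unit cost) and one polynomial $T$ such that, for every network, $\mathcal F$ can be taken of the form $\{\rho_i : 0\le i<R^{4k^2}\}$ (repetitions allowed) where the algorithm, given the network and $i$, computes $\rho_i$ in at most $T(|V(G)|+|E(G)|+|E(H)|)$ steps. -/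

import Mathlib

/-- A network with unit capacities, given together with a rotation system.
The supply digraph `G` has vertices `Fin n` and arcs `Fin m` (parallel arcs are allowed).
The demand digraph `H` has the arcs `Fin k`; the demand arc `h` goes from `snk h` to `org h` and has
request `req h`, so it asks for `req h` paths of `G` from `org h` to `snk h`.
A dart is an end of a supply arc: `(a, false)` is the end of `a` at its tail and `(a, true)` the end
of `a` at its head. `rot d` is the dart that follows `d` in anticlockwise order around its vertex. -/
structure Network where
  n : ℕ
  m : ℕ
  k : ℕ
  src : Fin m → Fin n
  tgt : Fin m → Fin n
  rot : Equiv.Perm (Fin m × Bool)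
  org : Fin k → Fin n
  snk : Fin k → Fin n
  req : Fin k → ℕ

/-- The relative behaviour of a path with respect to another one at a common inner vertex. -/
inductive Behaviour where
  | cross
  | left
  | right

/-- `b` occurs in the sequence `a, σ a, σ² a, …` stopped at the first occurrence of `c`. -/
def Between {D : Type} (σ : Equiv.Perm D) (a b c : D) : Prop :=
  ∃ i j : ℕ, i ≤ j ∧ (σ ^ i) a = b ∧ (σ ^ j) a = c ∧ ∀ l < j, (σ ^ l) a ≠ c

/-- `b` is before `c` in the interval of extremities `a` and `d`. -/
def BeforeIn {D : Type} (σ : Equiv.Perm D) (a b c d : D) : Prop :=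
  Between σ a b d ∧ Between σ a c d ∧ Between σ a b c

/-- The number of cycles of a permutation, fixed points included. -/
noncomputable def cycleCount {D : Type} (σ : Equiv.Perm D) : ℕ :=
  Nat.card (Quotient (Equiv.Perm.SameCycle.setoid σ))

namespace Network

variable (N : Network)

/-- The vertex at which a dart is attached. -/
def vert (d : Fin N.m × Bool) : Fin N.n := if d.2 then N.tgt d.1 else N.src d.1

/-- The involution that exchanges the two ends of every arc. -/
def flip : Equiv.Perm (Fin N.m × Bool) := Equiv.prodCongr (Equiv.refl _) Equiv.boolNot

/-- The number of connected components of `G` that contain an arc. -/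
noncomputable def componentCount : ℕ :=
  Nat.card (MulAction.orbitRel.Quotient
    (Subgroup.closure ({N.rot, N.flip} : Set (Equiv.Perm (Fin N.m × Bool)))) (Fin N.m × Bool))

/-- The permutation `rot` is the rotation system of an embedding of `G` on the sphere: its cycles
are the sets of darts at the vertices, and Euler's formula holds (the cycles of `rot` are the
non-isolated vertices, those of `rot * flip` are the faces; both sides are summed over the
components, none of which has negative Euler genus). -/
def SphereEmbedding : Prop :=
  (∀ d d', N.rot.SameCycle d d' ↔ N.vert d = N.vert d') ∧
    cycleCount N.rot + cycleCount (N.rot * N.flip) = N.m + 2 * N.componentCount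

/-- There is an arc of `G` from `u` to `v`. -/
def Adj (u v : Fin N.n) : Prop := ∃ a, N.src a = u ∧ N.tgt a = v

/-- `G` has no directed cycle. -/
def Acyclic : Prop := ∀ v, ¬ Relation.TransGen N.Adj v v

/-- `G + H` is Eulerian, where each demand arc `h` counts `req h` times. -/
def Eulerian : Prop :=
  ∀ v, (Finset.univ.filter fun a => N.src a = v).card
        + ∑ h ∈ Finset.univ.filter (fun h => N.snk h = v), N.req h
      = (Finset.univ.filter fun a => N.tgt a = v).card
        + ∑ h ∈ Finset.univ.filter (fun h => N.org h = v), N.req h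

/-- `H` is a matching, the head of each demand arc is a source of `G` and its tail a sink of `G`. -/
def Normalized : Prop :=
  Function.Injective N.org ∧ Function.Injective N.snk ∧ (∀ h h', N.org h ≠ N.snk h') ∧
    (∀ h a, N.tgt a ≠ N.org h) ∧ (∀ h a, N.src a ≠ N.snk h)

/-- The maximum request plus one. -/
def R : ℕ := Finset.univ.sup N.req + 1

/-- A path of `G`: a nonempty sequence of distinct arcs, the head of each being the tail of the
next. -/
def IsPath (P : List (Fin N.m)) : Prop :=
  P ≠ [] ∧ P.Nodup ∧ P.IsChain fun a b => N.tgt a = N.src b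

/-- `u` is the origin of `P`. -/
def IsOrigin (P : List (Fin N.m)) (u : Fin N.n) : Prop := ∃ a ∈ P.head?, N.src a = u

/-- `u` is the destination of `P`. -/
def IsDestination (P : List (Fin N.m)) (u : Fin N.n) : Prop := ∃ a ∈ P.getLast?, N.tgt a = u

def IsEndpoint (P : List (Fin N.m)) (u : Fin N.n) : Prop := N.IsOrigin P u ∨ N.IsDestination P u

/-- `P` is a path for the demand `h`. -/
def Satisfies (P : List (Fin N.m)) (h : Fin N.k) : Prop :=
  N.IsPath P ∧ N.IsOrigin P (N.org h) ∧ N.IsDestination P (N.snk h)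

/-- `v` is incident to an arc of `P`. -/
def OnPath (P : List (Fin N.m)) (v : Fin N.n) : Prop := ∃ a ∈ P, N.src a = v ∨ N.tgt a = v

/-- A solution: pairwise arc-disjoint paths, each for some demand, exactly `req h` of them for each
demand `h`. -/
def IsSolution (S : Finset (List (Fin N.m))) : Prop :=
  (∀ P ∈ S, ∃ h, N.Satisfies P h) ∧
    (∀ P ∈ S, ∀ Q ∈ S, P ≠ Q → P.Disjoint Q) ∧
    ∀ h, {P | P ∈ S ∧ N.Satisfies P h}.ncard = N.req h

/-- `v` is an inner vertex of `P`, which enters it by `a` and leaves it by `b`. -/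
def Passes (P : List (Fin N.m)) (v : Fin N.n) (a b : Fin N.m) : Prop :=
  a ∈ P ∧ b ∈ P ∧ N.tgt a = v ∧ N.src b = v

/-- `v` is an inner vertex of `P` and of `Q`, and `β` is the behaviour of `P` relative to `Q` at
`v`. Below, `p` and `p'` are the darts at `v` of the arcs by which `P` enters and leaves `v`, and
`q`, `q'` those of `Q`. -/
def HasBehaviour (P Q : List (Fin N.m)) (v : Fin N.n) (β : Behaviour) : Prop :=
  ∃ a b c d, N.Passes P v a b ∧ N.Passes Q v c d ∧
    let p : Fin N.m × Bool := (a, true)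
    let p' : Fin N.m × Bool := (b, false)
    let q : Fin N.m × Bool := (c, true)
    let q' : Fin N.m × Bool := (d, false)
    match β with
    | .cross => ¬ ((Between N.rot q p q' ∧ Between N.rot q p' q') ∨
                    (Between N.rot q' p q ∧ Between N.rot q' p' q))
    | .right => BeforeIn N.rot q p p' q' ∨ BeforeIn N.rot q' p p' q
    | .left => BeforeIn N.rot q p' p q' ∨ BeforeIn N.rot q' p' p q

/-- `v` is the first common vertex of `P` and `Q`: every common vertex is reachable from it. As the
common vertices all lie on one path, for acyclic `G` this is the smallest common vertex in any
acyclic order of the vertices of `G`. -/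
def IsFirstCommon (P Q : List (Fin N.m)) (v : Fin N.n) : Prop :=
  N.OnPath P v ∧ N.OnPath Q v ∧
    ∀ w, N.OnPath P w → N.OnPath Q w → Relation.ReflTransGen N.Adj v w

/-- Two paths with a common endpoint do not cross, and two paths that cross do so only at their
first common vertex. -/
def Uncrossed (S : Finset (List (Fin N.m))) : Prop :=
  ∀ P ∈ S, ∀ Q ∈ S, P ≠ Q →
    ((∃ u, N.IsEndpoint P u ∧ N.IsEndpoint Q u) → ∀ v, ¬ N.HasBehaviour P Q v .cross) ∧
    ∀ v, N.HasBehaviour P Q v .cross → N.IsFirstCommon P Q v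

/-- The supply arcs that leave the origins of the demands. For normalized `H` and Eulerian `G + H`
they are the first arcs of the paths of any solution, one for each path, and they index these
paths. -/
def StartArc : Type := {a : Fin N.m // ∃ h, N.src a = N.org h}

/-- A routing scheme gives the relative behaviour of each (ordered) pair of paths at their first
common vertex; the value `none` means that they have no common vertex, or that the first one is not
an inner vertex of both (two paths for the same demand: it is their common origin). -/
abbrev RoutingScheme : Type := N.StartArc → N.StartArc → Option Behaviour

/-- The set of paths `S` respects the routing scheme `ρ`. -/
def Respects (S : Finset (List (Fin N.m))) (ρ : N.RoutingScheme) : Prop :=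
  ∀ P ∈ S, ∀ Q ∈ S, ∀ a b : N.StartArc, P.head? = some a.1 → Q.head? = some b.1 →
    ∀ β, ρ a b = some β ↔ ∃ v, N.IsFirstCommon P Q v ∧ N.HasBehaviour P Q v β

/-- There is an uncrossed solution that respects `ρ`. -/
def Feasible (ρ : N.RoutingScheme) : Prop :=
  ∃ S, N.IsSolution S ∧ N.Uncrossed S ∧ N.Respects S ρ

/-- The size of the network. -/
def size : ℕ := N.n + N.m + N.k

end Network

/-! Structured programs for a random access machine: the memory cells hold natural numbers, the
arithmetic is addition and truncated subtraction, and each operation and each test costs one step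
(without multiplication this is polynomially equivalent to Turing machines). -/

inductive RAMProgram where
  | const (x c : ℕ)
  | add (x y z : ℕ)
  | sub (x y z : ℕ)
  | load (x y : ℕ)
  | store (x y : ℕ)
  | seq (p q : RAMProgram)
  | branch (x : ℕ) (p q : RAMProgram)
  | loop (x : ℕ) (p : RAMProgram)

/-- `RAMRun p μ μ' t`: started on the memory `μ`, the program `p` halts after exactly `t` steps
with the memory `μ'`. -/
inductive RAMRun : RAMProgram → (ℕ → ℕ) → (ℕ → ℕ) → ℕ → Prop
  | const (x c : ℕ) (μ : ℕ → ℕ) : RAMRun (.const x c) μ (Function.update μ x c) 1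
  | add (x y z : ℕ) (μ : ℕ → ℕ) : RAMRun (.add x y z) μ (Function.update μ x (μ y + μ z)) 1
  | sub (x y z : ℕ) (μ : ℕ → ℕ) : RAMRun (.sub x y z) μ (Function.update μ x (μ y - μ z)) 1
  | load (x y : ℕ) (μ : ℕ → ℕ) : RAMRun (.load x y) μ (Function.update μ x (μ (μ y))) 1
  | store (x y : ℕ) (μ : ℕ → ℕ) : RAMRun (.store x y) μ (Function.update μ (μ x) (μ y)) 1
  | seq {p q : RAMProgram} {μ μ' μ'' : ℕ → ℕ} {t t' : ℕ} :
      RAMRun p μ μ' t → RAMRun q μ' μ'' t' → RAMRun (.seq p q) μ μ'' (t + t')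
  | branch_pos {x : ℕ} {p q : RAMProgram} {μ μ' : ℕ → ℕ} {t : ℕ} :
      μ x ≠ 0 → RAMRun p μ μ' t → RAMRun (.branch x p q) μ μ' (t + 1)
  | branch_zero {x : ℕ} {p q : RAMProgram} {μ μ' : ℕ → ℕ} {t : ℕ} :
      μ x = 0 → RAMRun q μ μ' t → RAMRun (.branch x p q) μ μ' (t + 1)
  | loop_zero {x : ℕ} {p : RAMProgram} {μ : ℕ → ℕ} :
      μ x = 0 → RAMRun (.loop x p) μ μ 1
  | loop_step {x : ℕ} {p : RAMProgram} {μ μ' μ'' : ℕ → ℕ} {t t' : ℕ} :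
      μ x ≠ 0 → RAMRun p μ μ' t → RAMRun (.loop x p) μ' μ'' t' →
        RAMRun (.loop x p) μ μ'' (t + t' + 1)

namespace Network

variable (N : Network)

/-- The number of a dart: `2 a` for `(a, false)` and `2 a + 1` for `(a, true)`. -/
def dartCode (d : Fin N.m × Bool) : ℕ := 2 * d.1 + d.2.toNat

/-- The memory that holds the network and the index `i`: the numbers `n, m, k, i`, then the tables
of `src`, `tgt`, `org`, `snk`, `req` and `rot`, one after the other from cell `0` on, and zeros
behind them. -/
def input (i : ℕ) : ℕ → ℕ := fun x =>
  ([N.n, N.m, N.k, i] ++ List.ofFn (fun a => (N.src a : ℕ)) ++ List.ofFn (fun a => (N.tgt a : ℕ))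
    ++ List.ofFn (fun h => (N.org h : ℕ)) ++ List.ofFn (fun h => (N.snk h : ℕ))
    ++ List.ofFn N.req
    ++ (List.finRange N.m).flatMap (fun a =>
        [N.dartCode (N.rot (a, false)), N.dartCode (N.rot (a, true))])).getD x 0

/-- The number of a value of a routing scheme. -/
def valueCode : Option Behaviour → ℕ
  | none => 0
  | some .cross => 1
  | some .left => 2
  | some .right => 3

/-- The memory `μ` holds the table of the routing scheme `ρ`: the value at `(a, b)` is in the cell
`a m + b`. -/
def Holds (μ : ℕ → ℕ) (ρ : N.RoutingScheme) : Prop :=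
  ∀ a b : N.StartArc, μ ((a.1 : ℕ) * N.m + (b.1 : ℕ)) = valueCode (ρ a b)

end Network

/-!
An uncrossed solution is determined by few numbers, and a program can recover its routing scheme from
these numbers by following all its paths simultaneously through the acyclic network.

*Routings.* As `G` is acyclic and `G + H` is Eulerian, the paths of a solution cover every arc of
`G`. A solution is therefore the same as a `Network.Routing`: every arc `x` carries the first arc
`lab x` of its path and is followed by the arc `nxt x`. At an inner vertex, the place of `nxt x` in
the anticlockwise order, counted from `x`, is `1 + 2 l + c`, where `l` and `c` are the numbers of
arcs `y` into the vertex such that the path of `x` goes to the left of, or crosses, the path of `y`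
(`Routing.cdist_nxt`). So the paths can be continued through a vertex as soon as the behaviours
there are known.

*Crossings.* Two paths of an uncrossed solution cross at an inner vertex exactly if this is their
first common vertex, their demands differ, and they cross at all (`Routing.cross_iff`). Embeddings on
the sphere enter through potentials: for every circulation modulo 2 on the arcs there is a
2-colouring of the faces that changes exactly across the arcs of odd value (`exists_potential`, by
Euler's formula in the form of a dimension count). For the circulation given by two paths `p`, `p'`
of one demand, the colour along a path `q` of another demand changes at each crossing, and its
values at both ends of `q` are the same for all paths of this demand; so the parity of the number of
crossings of `q` with `p` and `p'` does not depend on `q` (`Routing.crosses_add`). The same colouring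
excludes the cyclic pattern crossing, not crossing, crossing, not crossing of a path with the paths
of another demand (`Routing.not_alternating`). Hence whether `p` crosses `q` is
the exclusive disjunction of a condition on `p` and one on `q`, and each condition describes an
interval of the cyclic order at the origin of the demand: two numbers at most `r(h)` for
each ordered pair of demands (`Routing.exists_intervals`).

*Sides.* Suppose that the paths of `x` and `y` meet at a vertex. If the arcs out of the vertex that
lead to the sink of the path of `x` are all on one side of `y`, the path of `x` has to leave on this
side. Otherwise there are arcs on both sides, and the planar separation shows that the origins of the
two demands are not connected before the vertex, so that it is the only such vertex for this pair of
demands; there the side depends only on the rank of `x` among the arcs of its own demand, counted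
from `y`, and is decided by a threshold at most `r(h)` (`Routing.exists_threshold`).

*Program.* The three numbers for each of the `k²` ordered pairs of demands are less than `R`, so that
they can be read off as digits of an index below `R ^ (4 k²)`. `algorithm` decodes them and treats
the vertices in a topological order: at each vertex it computes the behaviours, continues the paths,
and records the behaviours of those that meet for the first time (`Network.Simulates`). It is written in
a small language of tables indexed by numbers below a power of a parameter that is linear in the
size of the network (`TCmd`); as the language has only bounded iteration, its programs compile to
polynomial-time programs of the random access machine (`TCmd.exists_program`).
-/

/-! ### Hoare rules with time bounds for the random access machine -/

/-- Started on `μ`, the program halts within `T` steps on a memory that satisfies `Q`. -/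
def Runs (p : RAMProgram) (μ : ℕ → ℕ) (T : ℕ) (Q : (ℕ → ℕ) → Prop) : Prop :=
  ∃ μ' t, RAMRun p μ μ' t ∧ t ≤ T ∧ Q μ'

namespace Runs

variable {p q : RAMProgram} {μ : ℕ → ℕ} {T T' : ℕ} {P Q : (ℕ → ℕ) → Prop}

theorem weaken (h : Runs p μ T P) (hT : T ≤ T') (hQ : ∀ ν, P ν → Q ν) : Runs p μ T' Q := by
  obtain ⟨ν, t, hr, ht, hP⟩ := h
  exact ⟨ν, t, hr, ht.trans hT, hQ ν hP⟩

theorem const {x c : ℕ} (h : Q (Function.update μ x c)) : Runs (.const x c) μ 1 Q :=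
  ⟨_, _, .const x c μ, le_rfl, h⟩

theorem add {x y z : ℕ} (h : Q (Function.update μ x (μ y + μ z))) : Runs (.add x y z) μ 1 Q :=
  ⟨_, _, .add x y z μ, le_rfl, h⟩

theorem sub {x y z : ℕ} (h : Q (Function.update μ x (μ y - μ z))) : Runs (.sub x y z) μ 1 Q :=
  ⟨_, _, .sub x y z μ, le_rfl, h⟩

theorem load {x y : ℕ} (h : Q (Function.update μ x (μ (μ y)))) : Runs (.load x y) μ 1 Q :=
  ⟨_, _, .load x y μ, le_rfl, h⟩

theorem store {x y : ℕ} (h : Q (Function.update μ (μ x) (μ y))) : Runs (.store x y) μ 1 Q :=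
  ⟨_, _, .store x y μ, le_rfl, h⟩

theorem seq (hp : Runs p μ T P) (hq : ∀ ν, P ν → Runs q ν T' Q) :
    Runs (.seq p q) μ (T + T') Q := by
  obtain ⟨ν, t, hr, ht, hP⟩ := hp
  obtain ⟨ν', t', hr', ht', hQ⟩ := hq ν hP
  exact ⟨ν', t + t', .seq hr hr', by omega, hQ⟩

theorem branch {x : ℕ} (h1 : μ x ≠ 0 → Runs p μ T Q) (h2 : μ x = 0 → Runs q μ T' Q) :
    Runs (.branch x p q) μ (T + T' + 1) Q := by
  by_cases hx : μ x = 0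
  · obtain ⟨ν, t, hr, ht, hQ⟩ := h2 hx
    exact ⟨ν, t + 1, .branch_zero hx hr, by omega, hQ⟩
  · obtain ⟨ν, t, hr, ht, hQ⟩ := h1 hx
    exact ⟨ν, t + 1, .branch_pos hx hr, by omega, hQ⟩

/-- A loop that is entered `n` times, by an invariant indexed by the number of rounds already made. -/
theorem loop {x n : ℕ} (I : ℕ → (ℕ → ℕ) → Prop) (hx : ∀ i ν, I i ν → ν x = n - i)
    (hp : ∀ i < n, ∀ ν, I i ν → Runs p ν T (I (i + 1))) (h0 : I 0 μ) :
    Runs (.loop x p) μ (n * (T + 1) + 1) (I n) := by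
  suffices H : ∀ j, j ≤ n → ∀ ν, I (n - j) ν → Runs (.loop x p) ν (j * (T + 1) + 1) (I n) by
    exact H n le_rfl μ (by simpa using h0)
  intro j
  induction j with
  | zero =>
    intro _ ν hν
    refine ⟨ν, 1, .loop_zero ?_, by omega, by simpa using hν⟩
    rw [hx _ _ hν]; omega
  | succ j ih =>
    intro hj ν hν
    obtain ⟨ν', t, hr, ht, hI⟩ := hp (n - (j + 1)) (by omega) ν hν
    obtain ⟨ν'', t', hr', ht', hI'⟩ :=
      ih (by omega) ν' (by rwa [show n - (j + 1) + 1 = n - j by omega] at hI)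
    refine ⟨ν'', t + t' + 1, .loop_step ?_ hr hr', ?_, hI'⟩
    · rw [hx _ _ hν]; omega
    · have : (j + 1) * (T + 1) = j * (T + 1) + (T + 1) := by ring
      omega

end Runs

namespace RAMProgram

/-- `x := c + n * y` by repeated addition. -/
def mulAdd (x y c : ℕ) : ℕ → RAMProgram
  | 0 => .const x c
  | n + 1 => .seq (mulAdd x y c n) (.add x x y)

theorem runs_mulAdd {x y c : ℕ} (hxy : x ≠ y) (n : ℕ) (μ : ℕ → ℕ) {Q : (ℕ → ℕ) → Prop}
    (h : Q (Function.update μ x (c + n * μ y))) : Runs (mulAdd x y c n) μ (n + 1) Q := by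
  induction n generalizing Q with
  | zero => exact Runs.const (by simpa using h)
  | succ n ih =>
    refine Runs.seq (ih (Q := fun ν => ν = Function.update μ x (c + n * μ y)) rfl) ?_
    rintro ν rfl
    refine Runs.add ?_
    rw [Function.update_idem, Function.update_self, Function.update_of_ne hxy.symm]
    convert h using 2
    ring

/-- `x := y`. -/
def copy (x y : ℕ) : RAMProgram := mulAdd x y 0 1

theorem runs_copy {x y : ℕ} (hxy : x ≠ y) (μ : ℕ → ℕ) {Q : (ℕ → ℕ) → Prop}
    (h : Q (Function.update μ x (μ y))) : Runs (copy x y) μ 2 Q :=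
  runs_mulAdd hxy 1 μ (by simpa using h)

end RAMProgram

/-! ### A language of tables -/

/-- Arithmetic expressions over named variables and named tables of natural numbers. In
`sum d x e`, the variable `x` runs over the numbers below the `d`-th power of a global parameter. -/
inductive TExpr where
  | lit (c : ℕ)
  | var (j : ℕ)
  | rd (A : ℕ) (e : TExpr)
  | add (a b : TExpr)
  | sub (a b : TExpr)
  | ite (c a b : TExpr)
  | sum (d : Fin 4) (x : ℕ) (e : TExpr)

/-- Commands: `tab A d x e` redefines the entries of the table `A` at all the indices `x` below the
`d`-th power of the global parameter, simultaneously; `rep d x c` repeats `c`. All loops are bounded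
by powers of the global parameter, so that every command takes polynomial time. -/
inductive TCmd where
  | tab (A : ℕ) (d : Fin 4) (x : ℕ) (e : TExpr)
  | seq (c c' : TCmd)
  | rep (d : Fin 4) (x : ℕ) (c : TCmd)

namespace TExpr

/-- The value of an expression for the global parameter `W`, the tables `s` and the variables `v`. -/
def eval (W : ℕ) (s : ℕ → ℕ → ℕ) : TExpr → (ℕ → ℕ) → ℕ
  | lit c, _ => c
  | var j, v => v j
  | rd A e, v => s A (e.eval W s v)
  | add a b, v => a.eval W s v + b.eval W s v
  | sub a b, v => a.eval W s v - b.eval W s v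
  | ite c a b, v => if c.eval W s v ≠ 0 then a.eval W s v else b.eval W s v
  | sum d x e, v => ∑ i ∈ Finset.range (W ^ (d : ℕ)), e.eval W s (Function.update v x i)

/-- A bound for the names of the variables and tables of an expression and for the number of
registers that its evaluation needs. -/
def bound : TExpr → ℕ
  | lit _ => 1
  | var j => j + 1
  | rd A e => A + e.bound + 3
  | add a b => a.bound + b.bound + 2
  | sub a b => a.bound + b.bound + 2
  | ite c a b => c.bound + a.bound + b.bound
  | sum _ x e => x + e.bound + 4

end TExpr

namespace TCmd

/-- The tables after the execution of a command. -/
def exec (W : ℕ) : TCmd → (ℕ → ℕ) → (ℕ → ℕ → ℕ) → ℕ → ℕ → ℕ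
  | tab A d x e, v, s => Function.update s A fun i =>
      if i < W ^ (d : ℕ) then e.eval W s (Function.update v x i) else s A i
  | seq c c', v, s => c'.exec W v (c.exec W v s)
  | rep d x c, v, s =>
      Nat.rec s (fun i s' => c.exec W (Function.update v x i) s') (W ^ (d : ℕ))

/-- A bound for the numbers of the tables and variables of a command and for the number of registers
that its compilation needs. -/
def bound : TCmd → ℕ
  | tab A _ x e => A + x + e.bound + 6
  | seq c c' => c.bound + c'.bound
  | rep _ x c => x + c.bound + 3

end TCmd

/-! ### Compilation of the language of tables

The cell `d ≤ 3` holds the `d`-th power of the global parameter `W`, the cell `4 + j` holds the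
variable `j`, and the entry `i` of the table `A` is in the cell `K + (B + 1) i + A`. There are `B`
variables and `B` tables, and a further table, number `B`, serves as a buffer. The cells between
`4 + B` and `K` are a stack of registers. -/

/-- The memory `μ` represents the tables `s` and the variables `v`. -/
def Represents (B K W : ℕ) (s : ℕ → ℕ → ℕ) (v : ℕ → ℕ) (μ : ℕ → ℕ) : Prop :=
  (∀ d : Fin 4, μ d = W ^ (d : ℕ)) ∧ (∀ j < B, μ (4 + j) = v j) ∧
    ∀ A < B, ∀ i, μ (K + (B + 1) * i + A) = s A i

theorem Represents.congr {B K W : ℕ} {s : ℕ → ℕ → ℕ} {v μ ν : ℕ → ℕ}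
    (h : Represents B K W s v μ) (h1 : ∀ r < 4 + B, ν r = μ r) (h2 : ∀ r, K ≤ r → ν r = μ r) :
    Represents B K W s v ν := by
  obtain ⟨ha, hb, hc⟩ := h
  refine ⟨fun d => ?_, fun j hj => ?_, fun A hA i => ?_⟩
  · rw [h1 _ (by omega), ha]
  · rw [h1 _ (by omega), hb j hj]
  · rw [h2 _ (by omega), hc A hA]

/-- Changing the cell of a variable changes the value of the variable. -/
theorem Represents.update_var {B K W : ℕ} {s : ℕ → ℕ → ℕ} {v μ ν : ℕ → ℕ} {x i : ℕ}
    (h : Represents B K W s v μ)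
    (h1 : ∀ r < 4 + B, r ≠ 4 + x → ν r = μ r)
    (h2 : ∀ r, K ≤ r → ν r = μ r) (hi : ν (4 + x) = i) :
    Represents B K W s (Function.update v x i) ν := by
  obtain ⟨ha, hb, hc⟩ := h
  refine ⟨fun d => ?_, fun j hj => ?_, fun A hA i => ?_⟩
  · rw [h1 _ (by omega) (by omega), ha]
  · by_cases hjx : j = x
    · subst hjx; simpa using hi
    · rw [h1 _ (by omega) (by omega), hb j hj, Function.update_of_ne hjx]
  · rw [h2 _ (by omega), hc A hA]

/-- The skeleton of a loop in which the variable `x` runs over the numbers below the `d`-th power of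
the parameter; the stack register `k` is the counter, and `k + 1` keeps the former value of `x`. -/
def RAMProgram.forLoop (d : Fin 4) (x k : ℕ) (p : RAMProgram) : RAMProgram :=
  .seq (.copy k d) <| .seq (.copy (k + 1) (4 + x)) <| .seq (.const (4 + x) 0) <|
    .seq (.loop k (.seq p (.seq (.add (4 + x) (4 + x) 0) (.sub k k 0)))) (.copy (4 + x) (k + 1))

/-- The rule for `forLoop`: the loop body has to leave alone the cells of the loop and preserve an
invariant that does not depend on them. -/
theorem RAMProgram.runs_forLoop {B W : ℕ} {d : Fin 4} {x k T : ℕ} {p : RAMProgram}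
    {μ : ℕ → ℕ} {Q : (ℕ → ℕ) → Prop} (hx : x < B) (hk : 4 + B ≤ k)
    (hμ0 : μ 0 = 1) (hμd : μ d = W ^ (d : ℕ))
    (I : ℕ → (ℕ → ℕ) → Prop)
    (hI : ∀ i ν ν', I i ν → (∀ r, r ≠ 4 + x → r ≠ k → r ≠ k + 1 → ν' r = ν r) → I i ν')
    (h0 : I 0 μ)
    (hp : ∀ i < W ^ (d : ℕ), ∀ ν, I i ν → ν 0 = 1 → ν (4 + x) = i →
      Runs p ν T fun ν' => I (i + 1) ν' ∧ ν' 0 = 1 ∧ ν' (4 + x) = i ∧ ν' k = ν k ∧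
        ν' (k + 1) = ν (k + 1))
    (hQ : ∀ ν, I (W ^ (d : ℕ)) ν → ν (4 + x) = μ (4 + x) → Q ν) :
    Runs (.forLoop d x k p) μ (W ^ (d : ℕ) * (T + 3) + 8) Q := by
  set n := W ^ (d : ℕ) with hn
  have e1 : (d : ℕ) ≠ k := by omega
  refine Runs.weaken (Q := Q) (T := 2 + (2 + (1 + ((n * ((T + (1 + 1)) + 1) + 1) + 2)))) ?_
    (by ring_nf; omega) (fun _ h => h)
  refine Runs.seq (P := fun ν => ν = Function.update μ k n) (runs_copy (by omega) _ ?_) ?_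
  · rw [hμd]
  rintro _ rfl
  refine Runs.seq (P := fun ν => ν = Function.update (Function.update μ k n) (k + 1) (μ (4 + x)))
    (runs_copy (by omega) _ ?_) ?_
  · rw [Function.update_of_ne (by omega)]
  rintro _ rfl
  refine Runs.seq (P := fun ν => ν = Function.update (Function.update (Function.update μ k n)
    (k + 1) (μ (4 + x))) (4 + x) 0) (Runs.const rfl) ?_
  rintro _ rfl
  refine Runs.seq (P := fun ν => I n ν ∧ ν 0 = 1 ∧ ν (4 + x) = n ∧ ν k = n - n ∧
    ν (k + 1) = μ (4 + x)) ?_ ?_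
  · refine Runs.loop (fun i ν => I i ν ∧ ν 0 = 1 ∧ ν (4 + x) = i ∧ ν k = n - i ∧
      ν (k + 1) = μ (4 + x)) (fun i ν h => h.2.2.2.1) ?_ ?_
    · rintro i hi ν ⟨h1, h2, h3, h4, h5⟩
      refine Runs.seq (hp i hi ν h1 h2 h3) ?_
      rintro ν' ⟨g1, g2, g3, g4, g5⟩
      refine Runs.seq (T := 1) (T' := 1) (Runs.add (Q := fun ν => ν = _) rfl) ?_
      rintro _ rfl
      refine Runs.sub ⟨hI _ ν' _ g1 ?_, ?_, ?_, ?_, ?_⟩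
      · intro r r1 r2 r3
        simp [Function.update_apply, r1, r2]
      · simp [Function.update_apply, g2, show (0 : ℕ) ≠ k by omega, show (0 : ℕ) ≠ 4 + x by omega]
      · simp [Function.update_apply, g2, g3, show 4 + x ≠ k by omega]
      · simp [g2, g4, h4, show (0 : ℕ) ≠ 4 + x by omega,
          show k ≠ 4 + x by omega]
        omega
      · simp [Function.update_apply, g5, h5, show k + 1 ≠ 4 + x by omega]
    · refine ⟨hI _ μ _ h0 ?_, ?_, ?_, ?_, ?_⟩
      · intro r r1 r2 r3
        simp [r1, r2, r3]
      · simp [hμ0, show (0 : ℕ) ≠ k by omega, show (0 : ℕ) ≠ 4 + x by omega]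
      · simp
      · simp [show k ≠ 4 + x by omega]
      · simp [show k + 1 ≠ 4 + x by omega]
  · rintro ν ⟨h1, h2, h3, h4, h5⟩
    refine runs_copy (by omega) _ (hQ _ (hI _ ν _ h1 ?_) ?_)
    · intro r r1 r2 r3
      simp [r1]
    · simp [h5]

/-- The code that computes the value of an expression in the stack register `k`. -/
def TExpr.comp (B K : ℕ) : TExpr → ℕ → RAMProgram
  | lit c, k => .const k c
  | var j, k => .copy k (4 + j)
  | rd A e, k => .seq (e.comp B K k) (.seq (.mulAdd (k + 1) k (K + A) (B + 1)) (.load k (k + 1)))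
  | add a b, k => .seq (a.comp B K k) (.seq (b.comp B K (k + 1)) (.add k k (k + 1)))
  | sub a b, k => .seq (a.comp B K k) (.seq (b.comp B K (k + 1)) (.sub k k (k + 1)))
  | ite c a b, k => .seq (c.comp B K k) (.branch k (a.comp B K k) (b.comp B K k))
  | sum d x e, k => .seq (.const k 0)
      (.forLoop d x (k + 1) (.seq (e.comp B K (k + 3)) (.add k k (k + 3))))

theorem TExpr.runs_comp {B K : ℕ} (hBK : 4 + B ≤ K) (e : TExpr) :
    ∀ k, 4 + B ≤ k → k + e.bound ≤ K → e.bound ≤ B →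
    ∃ T : Polynomial ℕ, ∀ W s v μ, Represents B K W s v μ →
      Runs (e.comp B K k) μ (T.eval W) fun ν =>
        ν k = e.eval W s v ∧ ∀ r, r < k ∨ K ≤ r → ν r = μ r := by
  induction e with
  | lit c =>
    intro k hk hK hB
    simp only [bound] at hK hB
    refine ⟨1, fun W s v μ h => ?_⟩
    simp only [Polynomial.eval_one]
    refine Runs.const ⟨by simp [eval], fun r hr => Function.update_of_ne (by omega) _ _⟩
  | var j =>
    intro k hk hK hB
    simp only [bound] at hK hB
    refine ⟨2, fun W s v μ h => ?_⟩
    simp only [Polynomial.eval_ofNat]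
    refine RAMProgram.runs_copy (by omega) _ ⟨?_, fun r hr => Function.update_of_ne (by omega) _ _⟩
    simp [eval, h.2.1 j (by omega)]
  | rd A e ih =>
    intro k hk hK hB
    simp only [bound] at hK hB
    obtain ⟨T, hT⟩ := ih k hk (by omega) (by omega)
    refine ⟨T + Polynomial.C (B + 3), fun W s v μ h => ?_⟩
    simp only [Polynomial.eval_add, Polynomial.eval_C]
    refine Runs.weaken (T := T.eval W + ((B + 1 + 1) + 1)) ?_ (by omega) (fun _ h => h)
    refine Runs.seq (hT W s v μ h) ?_
    rintro ν ⟨h1, h2⟩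
    refine Runs.seq (RAMProgram.runs_mulAdd (by omega) _ _ (Q := fun ν => ν = _) rfl) ?_
    rintro _ rfl
    refine Runs.load ⟨?_, fun r hr => ?_⟩
    · have hc := h.2.2 A (by omega) (e.eval W s v)
      rw [Function.update_self, Function.update_self, h1, Function.update_of_ne (by omega),
        show K + A + (B + 1) * e.eval W s v = K + (B + 1) * e.eval W s v + A by ring,
        h2 _ (by right; rw [add_assoc]; exact Nat.le_add_right _ _), hc]
      rfl
    · rw [Function.update_of_ne (by omega), Function.update_of_ne (by omega), h2 r hr]
  | add a b iha ihb =>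
    intro k hk hK hB
    simp only [bound] at hK hB
    obtain ⟨Ta, ha⟩ := iha k hk (by omega) (by omega)
    obtain ⟨Tb, hb⟩ := ihb (k + 1) (by omega) (by omega) (by omega)
    refine ⟨Ta + (Tb + 1), fun W s v μ h => ?_⟩
    simp only [Polynomial.eval_add, Polynomial.eval_one]
    refine Runs.seq (ha W s v μ h) ?_
    rintro ν ⟨h1, h2⟩
    refine Runs.seq (hb W s v ν (h.congr (fun r hr => h2 r (by omega))
      (fun r hr => h2 r (by omega)))) ?_
    rintro ν' ⟨g1, g2⟩
    refine Runs.add ⟨?_, fun r hr => ?_⟩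
    · simp [g1, g2 k (by omega), h1, eval]
    · rw [Function.update_of_ne (by omega), g2 r (by omega), h2 r hr]
  | sub a b iha ihb =>
    intro k hk hK hB
    simp only [bound] at hK hB
    obtain ⟨Ta, ha⟩ := iha k hk (by omega) (by omega)
    obtain ⟨Tb, hb⟩ := ihb (k + 1) (by omega) (by omega) (by omega)
    refine ⟨Ta + (Tb + 1), fun W s v μ h => ?_⟩
    simp only [Polynomial.eval_add, Polynomial.eval_one]
    refine Runs.seq (ha W s v μ h) ?_
    rintro ν ⟨h1, h2⟩
    refine Runs.seq (hb W s v ν (h.congr (fun r hr => h2 r (by omega))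
      (fun r hr => h2 r (by omega)))) ?_
    rintro ν' ⟨g1, g2⟩
    refine Runs.sub ⟨?_, fun r hr => ?_⟩
    · simp [g1, g2 k (by omega), h1, eval]
    · rw [Function.update_of_ne (by omega), g2 r (by omega), h2 r hr]
  | ite c a b ihc iha ihb =>
    intro k hk hK hB
    simp only [bound] at hK hB
    obtain ⟨Tc, hc⟩ := ihc k hk (by omega) (by omega)
    obtain ⟨Ta, ha⟩ := iha k hk (by omega) (by omega)
    obtain ⟨Tb, hb⟩ := ihb k (by omega) (by omega) (by omega)
    refine ⟨Tc + (Ta + Tb + 1), fun W s v μ h => ?_⟩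
    simp only [Polynomial.eval_add, Polynomial.eval_one]
    refine Runs.seq (hc W s v μ h) ?_
    rintro ν ⟨h1, h2⟩
    have hν := h.congr (fun r hr => h2 r (by omega)) (fun r hr => h2 r (by omega))
    refine Runs.branch (fun hx => ?_) (fun hx => ?_)
    · refine (ha W s v ν hν).weaken le_rfl ?_
      rintro ν' ⟨g1, g2⟩
      refine ⟨?_, fun r hr => (g2 r hr).trans (h2 r hr)⟩
      rw [g1]; simp only [eval]; rw [if_pos (h1 ▸ hx)]
    · refine (hb W s v ν hν).weaken le_rfl ?_
      rintro ν' ⟨g1, g2⟩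
      refine ⟨?_, fun r hr => (g2 r hr).trans (h2 r hr)⟩
      rw [g1]; simp only [eval]; rw [if_neg (not_not.2 (h1 ▸ hx))]
  | sum d x e ih =>
    intro k hk hK hB
    simp only [bound] at hK hB
    obtain ⟨T, hT⟩ := ih (k + 3) (by omega) (by omega) (by omega)
    refine ⟨1 + (Polynomial.X ^ (d : ℕ) * ((T + 1) + 3) + 8), fun W s v μ h => ?_⟩
    simp only [Polynomial.eval_add, Polynomial.eval_one, Polynomial.eval_mul, Polynomial.eval_pow,
      Polynomial.eval_X, Polynomial.eval_ofNat]
    refine Runs.seq (Runs.const (Q := fun ν => ν = _) rfl) ?_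
    rintro _ rfl
    refine RAMProgram.runs_forLoop (B := B) (by omega) (by omega) ?_ ?_
      (fun i ν => ν k = ∑ j ∈ Finset.range i, e.eval W s (Function.update v x j) ∧
        ∀ r, (r < k ∧ r ≠ 4 + x) ∨ K ≤ r → ν r = μ r) ?_ ?_ ?_ ?_
    · simpa [Function.update_apply, show (0 : ℕ) ≠ k by omega] using h.1 0
    · simpa [Function.update_apply, show (d : ℕ) ≠ k by omega] using h.1 d
    · rintro i ν ν' ⟨h1, h2⟩ h3
      refine ⟨by rw [h3 k (by omega) (by omega) (by omega), h1], fun r hr => ?_⟩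
      rw [h3 r (by omega) (by omega) (by omega), h2 r hr]
    · refine ⟨by simp, fun r hr => Function.update_of_ne (by omega) _ _⟩
    · rintro i hi ν ⟨h1, h2⟩ h3 h4
      refine Runs.seq (hT W s (Function.update v x i) ν (h.update_var
        (fun r hr hr' => h2 r (by omega)) (fun r hr => h2 r (by omega)) h4)) ?_
      rintro ν' ⟨g1, g2⟩
      refine Runs.add ⟨⟨?_, fun r hr => ?_⟩, ?_, ?_, ?_, ?_⟩
      · simp [Finset.sum_range_succ, g1, g2 k (by omega), h1]
      · rw [Function.update_of_ne (by omega), g2 r (by omega), h2 r hr]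
      · rw [Function.update_of_ne (by omega), g2 _ (by omega), h3]
      · rw [Function.update_of_ne (by omega), g2 _ (by omega), h4]
      · rw [Function.update_of_ne (by omega), g2 _ (by omega)]
      · rw [Function.update_of_ne (by omega), g2 _ (by omega)]
    · rintro ν ⟨h1, h2⟩ h3
      refine ⟨h1, fun r hr => ?_⟩
      by_cases hrx : r = 4 + x
      · subst hrx
        rw [h3, Function.update_of_ne (by omega)]
      · exact h2 r (by omega)

/-- The code of a command; the stack registers from `k` on are free. -/
def TCmd.comp (B K : ℕ) : TCmd → ℕ → RAMProgram
  | tab A d x e, k => .seq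
      (.forLoop d x k (.seq (e.comp B K (k + 3)) (.seq (.mulAdd (k + 2) (4 + x) (K + B) (B + 1))
        (.store (k + 2) (k + 3)))))
      (.forLoop d x k (.seq (.mulAdd (k + 2) (4 + x) (K + B) (B + 1)) (.seq (.load (k + 3) (k + 2))
        (.seq (.mulAdd (k + 2) (4 + x) (K + A) (B + 1)) (.store (k + 2) (k + 3))))))
  | seq c c', k => .seq (c.comp B K k) (c'.comp B K k)
  | rep d x c, k => .forLoop d x k (c.comp B K (k + 2))

theorem cell_inj {K Z i i' A A' : ℕ} (hA : A < Z) (hA' : A' < Z)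
    (h : K + Z * i + A = K + Z * i' + A') : i = i' ∧ A = A' := by
  have h1 : Z * i + A = Z * i' + A' := by omega
  have h2 : (Z * i + A) % Z = (Z * i' + A') % Z := by rw [h1]
  rw [Nat.mul_add_mod, Nat.mul_add_mod, Nat.mod_eq_of_lt hA, Nat.mod_eq_of_lt hA'] at h2
  subst h2
  exact ⟨Nat.eq_of_mul_eq_mul_left (by omega) (by omega : Z * i = Z * i'), rfl⟩

theorem TCmd.runs_comp {B K : ℕ} (hBK : 4 + B ≤ K) (c : TCmd) :
    ∀ k, 4 + B ≤ k → k + c.bound ≤ K → c.bound ≤ B →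
    ∃ T : Polynomial ℕ, ∀ W s v μ, Represents B K W s v μ →
      Runs (c.comp B K k) μ (T.eval W) fun ν =>
        Represents B K W (c.exec W v s) v ν ∧ ∀ r < k, ν r = μ r := by
  induction c with
  | tab A d x e =>
    intro k hk hK hB
    simp only [bound] at hK hB
    obtain ⟨T, hT⟩ := e.runs_comp hBK (k + 3) (by omega) (by omega) (by omega)
    refine ⟨(Polynomial.X ^ (d : ℕ) * (T + (Polynomial.C (B + 1 + 1) + 1) + 3) + 8) +
      (Polynomial.X ^ (d : ℕ) * (Polynomial.C (B + 1 + 1) +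
        (1 + (Polynomial.C (B + 1 + 1) + 1)) + 3) + 8),
      fun W s v μ h => ?_⟩
    simp only [Polynomial.eval_add, Polynomial.eval_one, Polynomial.eval_mul, Polynomial.eval_pow,
      Polynomial.eval_X, Polynomial.eval_ofNat, Polynomial.eval_C]
    -- the invariant of the first loop, which fills the buffer
    have key : ∀ i A', A' < B → ∀ i', K + (B + 1) * i + A' ≠ K + (B + 1) * i' + B := by
      intro i A' hA' i' he
      have := cell_inj (by omega) (by omega) he
      omega
    refine Runs.seq (P := fun ν => Represents B K W s v ν ∧ (∀ r < k, ν r = μ r) ∧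
      ∀ i < W ^ (d : ℕ), ν (K + (B + 1) * i + B) = e.eval W s (Function.update v x i)) ?_ ?_
    · refine RAMProgram.runs_forLoop (B := B) (by omega) (by omega) (by simpa using h.1 0) (h.1 d)
        (fun j ν => (∀ r, (r < k ∧ r ≠ 4 + x) → ν r = μ r) ∧
          (∀ A' < B, ∀ i, ν (K + (B + 1) * i + A') = s A' i) ∧
          ∀ i < j, ν (K + (B + 1) * i + B) = e.eval W s (Function.update v x i)) ?_ ?_ ?_ ?_
      · rintro i ν ν' ⟨h1, h2, h3⟩ h4
        refine ⟨fun r hr => ?_, fun A' hA' i => ?_, fun i hi => ?_⟩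
        · rw [h4 r (by omega) (by omega) (by omega), h1 r hr]
        · rw [h4 _ (by omega) (by omega) (by omega), h2 A' hA']
        · rw [h4 _ (by omega) (by omega) (by omega), h3 i hi]
      · exact ⟨fun _ _ => rfl, h.2.2, fun i hi => by omega⟩
      · rintro i hi ν ⟨h1, h2, h3⟩ h4 h5
        have hrep : Represents B K W s (Function.update v x i) ν := by
          refine ⟨fun d => ?_, fun j hj => ?_, h2⟩
          · rw [h1 _ (by omega), h.1]
          · by_cases hjx : j = x
            · subst hjx; simpa using h5
            · rw [h1 _ (by omega), h.2.1 j hj, Function.update_of_ne hjx]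
        refine Runs.seq (hT W s _ ν hrep) ?_
        rintro ν' ⟨g1, g2⟩
        refine Runs.seq (RAMProgram.runs_mulAdd (by omega) _ _ (Q := fun ν => ν = _) rfl) ?_
        rintro _ rfl
        have hx' : ν' (4 + x) = i := by rw [g2 _ (by omega), h5]
        have hadr : K + B + (B + 1) * i = K + (B + 1) * i + B := by ring
        refine Runs.store ⟨⟨fun r hr => ?_, fun A' hA' i' => ?_, fun i' hi' => ?_⟩, ?_, ?_, ?_, ?_⟩
        all_goals rw [Function.update_self, hx', hadr]
        · rw [Function.update_of_ne (by omega), Function.update_of_ne (by omega),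
            g2 _ (by omega), h1 r hr]
        · rw [Function.update_of_ne (key _ _ hA' _), Function.update_of_ne (by omega),
            g2 _ (by omega), h2 A' hA']
        · by_cases hii : i' = i
          · subst hii
            rw [Function.update_self, Function.update_of_ne (by omega), g1]
          · rw [Function.update_of_ne, Function.update_of_ne (by omega), g2 _ (by omega),
              h3 i' (by omega)]
            intro he
            exact hii (cell_inj (by omega) (by omega) he).1
        · rw [Function.update_of_ne (by omega), Function.update_of_ne (by omega),
            g2 _ (by omega), h4]
        · rw [Function.update_of_ne (by omega), Function.update_of_ne (by omega), hx']
        · rw [Function.update_of_ne (by omega), Function.update_of_ne (by omega), g2 _ (by omega)]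
        · rw [Function.update_of_ne (by omega), Function.update_of_ne (by omega), g2 _ (by omega)]
      · rintro ν ⟨h1, h2, h3⟩ h4
        have h5 : ∀ r < k, ν r = μ r := by
          intro r hr
          by_cases hrx : r = 4 + x
          · rw [hrx, h4]
          · exact h1 r ⟨hr, hrx⟩
        refine ⟨⟨fun d => ?_, fun j hj => ?_, h2⟩, h5, h3⟩
        · rw [h5 _ (by omega), h.1]
        · rw [h5 _ (by omega), h.2.1 j hj]
    · rintro ν₀ ⟨hrep, hlow, hbuf⟩
      refine RAMProgram.runs_forLoop (B := B) (by omega) (by omega) (by simpa using hrep.1 0)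
        (hrep.1 d)
        (fun j ν => (∀ r, (r < k ∧ r ≠ 4 + x) → ν r = μ r) ∧
          (∀ A' < B, A' ≠ A → ∀ i, ν (K + (B + 1) * i + A') = s A' i) ∧
          (∀ i < W ^ (d : ℕ), ν (K + (B + 1) * i + B) = e.eval W s (Function.update v x i)) ∧
          ∀ i, ν (K + (B + 1) * i + A) =
            if i < j then e.eval W s (Function.update v x i) else s A i) ?_ ?_ ?_ ?_
      · rintro i ν ν' ⟨h1, h2, h3, h3'⟩ h4
        refine ⟨fun r hr => ?_, fun A' hA' hA'' i => ?_, fun i hi => ?_, fun i => ?_⟩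
        · rw [h4 r (by omega) (by omega) (by omega), h1 r hr]
        · rw [h4 _ (by omega) (by omega) (by omega), h2 A' hA' hA'']
        · rw [h4 _ (by omega) (by omega) (by omega), h3 i hi]
        · rw [h4 _ (by omega) (by omega) (by omega), h3']
      · exact ⟨fun r hr => hlow r hr.1, fun A' hA' _ => hrep.2.2 A' hA', hbuf,
          fun i => by simpa using hrep.2.2 A (by omega) i⟩
      · rintro i hi ν ⟨h1, h2, h3, h3'⟩ h4 h5
        refine Runs.seq (RAMProgram.runs_mulAdd (by omega) _ _ (Q := fun ν => ν = _) rfl) ?_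
        rintro _ rfl
        have hadr : K + B + (B + 1) * i = K + (B + 1) * i + B := by ring
        have hadr' : K + A + (B + 1) * i = K + (B + 1) * i + A := by ring
        refine Runs.seq (Runs.load (Q := fun ν => ν = _) rfl) ?_
        rintro _ rfl
        refine Runs.seq (RAMProgram.runs_mulAdd (by omega) _ _ (Q := fun ν => ν = _) rfl) ?_
        rintro _ rfl
        rw [Function.update_self, h5, hadr, Function.update_of_ne (by omega) _ _ (a := K + _ + B),
          h3 i hi, Function.update_of_ne (a := 4 + x) (by omega),
          Function.update_of_ne (a := 4 + x) (by omega), h5, hadr']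
        refine Runs.store ⟨⟨fun r hr => ?_, fun A' hA' hA'' i' => ?_, fun i' hi' => ?_,
          fun i' => ?_⟩, ?_, ?_, ?_, ?_⟩
        all_goals rw [Function.update_self]
        · rw [Function.update_of_ne (by omega), Function.update_of_ne (by omega),
            Function.update_of_ne (by omega), Function.update_of_ne (by omega), h1 r hr]
        · rw [Function.update_of_ne, Function.update_of_ne (by omega),
            Function.update_of_ne (by omega), Function.update_of_ne (by omega), h2 A' hA' hA'']
          intro he
          exact hA'' (cell_inj (by omega) (by omega) he).2
        · rw [Function.update_of_ne, Function.update_of_ne (by omega),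
            Function.update_of_ne (by omega), Function.update_of_ne (by omega), h3 i' hi']
          exact (key _ _ (by omega) _).symm
        · by_cases hii : i' = i
          · subst hii
            rw [Function.update_self, Function.update_of_ne (by omega), Function.update_self,
              if_pos (by omega)]
          · rw [Function.update_of_ne, Function.update_of_ne (by omega),
              Function.update_of_ne (by omega), Function.update_of_ne (by omega), h3']
            · exact if_congr (by omega) rfl rfl
            · intro he
              exact hii (cell_inj (by omega) (by omega) he).1
        · simp only [Function.update_of_ne (show (0 : ℕ) ≠ K + (B + 1) * i + A by omega),
            Function.update_of_ne (show (0 : ℕ) ≠ k + 2 by omega),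
            Function.update_of_ne (show (0 : ℕ) ≠ k + 3 by omega), h4]
        · simp only [Function.update_of_ne (show 4 + x ≠ K + (B + 1) * i + A by omega),
            Function.update_of_ne (show 4 + x ≠ k + 2 by omega),
            Function.update_of_ne (show 4 + x ≠ k + 3 by omega), h5]
        · simp only [Function.update_of_ne (show k ≠ K + (B + 1) * i + A by omega),
            Function.update_of_ne (show k ≠ k + 2 by omega),
            Function.update_of_ne (show k ≠ k + 3 by omega)]
        · simp only [Function.update_of_ne (show k + 1 ≠ K + (B + 1) * i + A by omega),
            Function.update_of_ne (show k + 1 ≠ k + 2 by omega),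
            Function.update_of_ne (show k + 1 ≠ k + 3 by omega)]
      · rintro ν ⟨h1, h2, h3, h3'⟩ h4
        have h5 : ∀ r < k, ν r = μ r := by
          intro r hr
          by_cases hrx : r = 4 + x
          · rw [hrx, h4, hlow _ (by omega)]
          · exact h1 r ⟨hr, hrx⟩
        refine ⟨⟨fun d => ?_, fun j hj => ?_, fun A' hA' i => ?_⟩, h5⟩
        · rw [h5 _ (by omega), h.1]
        · rw [h5 _ (by omega), h.2.1 j hj]
        · by_cases hAA : A' = A
          · subst hAA
            rw [h3']; simp [exec]
          · rw [h2 A' hA' hAA]; simp [exec, Function.update_of_ne hAA]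
  | seq c c' ih ih' =>
    intro k hk hK hB
    simp only [bound] at hK hB
    obtain ⟨T, hT⟩ := ih k hk (by omega) (by omega)
    obtain ⟨T', hT'⟩ := ih' k hk (by omega) (by omega)
    refine ⟨T + T', fun W s v μ h => ?_⟩
    rw [Polynomial.eval_add]
    refine Runs.seq (hT W s v μ h) ?_
    rintro ν ⟨h1, h2⟩
    refine (hT' W _ v ν h1).weaken le_rfl ?_
    rintro ν' ⟨h3, h4⟩
    exact ⟨h3, fun r hr => (h4 r hr).trans (h2 r hr)⟩
  | rep d x c ih =>
    intro k hk hK hB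
    simp only [bound] at hK hB
    obtain ⟨T, hT⟩ := ih (k + 2) (by omega) (by omega) (by omega)
    refine ⟨Polynomial.X ^ (d : ℕ) * (T + 3) + 8, fun W s v μ h => ?_⟩
    simp only [Polynomial.eval_add, Polynomial.eval_mul, Polynomial.eval_pow,
      Polynomial.eval_X, Polynomial.eval_ofNat]
    refine RAMProgram.runs_forLoop (B := B) (by omega) (by omega) (by simpa using h.1 0) (h.1 d)
      (fun j ν => (∀ r, (r < k ∧ r ≠ 4 + x) → ν r = μ r) ∧
        (∀ A' < B, ∀ i, ν (K + (B + 1) * i + A') =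
          (Nat.rec s (fun i s' => c.exec W (Function.update v x i) s') j : ℕ → ℕ → ℕ) A' i))
      ?_ ?_ ?_ ?_
    · rintro i ν ν' ⟨h1, h2⟩ h4
      refine ⟨fun r hr => ?_, fun A' hA' i => ?_⟩
      · rw [h4 r (by omega) (by omega) (by omega), h1 r hr]
      · rw [h4 _ (by omega) (by omega) (by omega), h2 A' hA']
    · exact ⟨fun _ _ => rfl, h.2.2⟩
    · rintro i hi ν ⟨h1, h2⟩ h4 h5
      refine (hT W _ (Function.update v x i) ν ⟨fun d => ?_, fun j hj => ?_, h2⟩).weaken le_rfl ?_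
      · rw [h1 _ (by omega), h.1]
      · by_cases hjx : j = x
        · subst hjx; simpa using h5
        · rw [h1 _ (by omega), h.2.1 j hj, Function.update_of_ne hjx]
      · rintro ν' ⟨g1, g2⟩
        refine ⟨⟨fun r hr => ?_, fun A' hA' i' => g1.2.2 A' hA' i'⟩, ?_, ?_, ?_, ?_⟩
        · rw [g2 r (by omega), h1 r hr]
        · rw [g2 _ (by omega), h4]
        · rw [g2 _ (by omega), h5]
        · rw [g2 _ (by omega)]
        · rw [g2 _ (by omega)]
    · rintro ν ⟨h1, h2⟩ h4
      have h5 : ∀ r < k, ν r = μ r := by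
        intro r hr
        by_cases hrx : r = 4 + x
        · rw [hrx, h4]
        · exact h1 r ⟨hr, hrx⟩
      refine ⟨⟨fun d => ?_, fun j hj => ?_, h2⟩, h5⟩
      · rw [h5 _ (by omega), h.1]
      · rw [h5 _ (by omega), h.2.1 j hj]

/-! ### Moving the input into a table and the output out of a table

The registers occupy the cells below `K`, which hold a part of the input at the beginning and have to
hold a part of the output at the end. -/

namespace RAMProgram

/-- `x := x + (n + 1) * y` by repeated addition. -/
def accum (x y : ℕ) : ℕ → RAMProgram
  | 0 => .add x x y
  | n + 1 => .seq (accum x y n) (.add x x y)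

theorem runs_accum {x y : ℕ} (hxy : x ≠ y) (n : ℕ) (μ : ℕ → ℕ) {Q : (ℕ → ℕ) → Prop}
    (h : Q (Function.update μ x (μ x + (n + 1) * μ y))) : Runs (accum x y n) μ (n + 1) Q := by
  induction n generalizing Q with
  | zero => exact Runs.add (by simpa using h)
  | succ n ih =>
    refine Runs.seq (ih (Q := fun ν => ν = Function.update μ x (μ x + (n + 1) * μ y)) rfl) ?_
    rintro ν rfl
    refine Runs.add ?_
    rw [Function.update_idem, Function.update_self, Function.update_of_ne hxy.symm]
    convert h using 2
    ring

/-- Stores the cells `4, …, 4 + c` at the addresses `p, p + N, …`, where `p` is the content of the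
cell `1` and `N` that of the cell `0`. -/
def save : ℕ → RAMProgram
  | 0 => .seq (.store 1 4) (.add 1 1 0)
  | c + 1 => .seq (save c) (.seq (.store 1 (4 + (c + 1))) (.add 1 1 0))

theorem runs_save {N p : ℕ} (hN : 0 < N) (c : ℕ) (hp : 4 + c < p) (μ : ℕ → ℕ) (h0 : μ 0 = N)
    (h1 : μ 1 = p) : Runs (save c) μ (2 * (c + 1)) fun ν =>
      ν 1 = p + (c + 1) * N ∧ (∀ r < p, r ≠ 1 → ν r = μ r) ∧
        ∀ j ≤ c, ν (p + j * N) = μ (4 + j) := by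
  induction c with
  | zero =>
    refine Runs.seq (T := 1) (T' := 1) (Runs.store (Q := fun ν => ν = _) rfl) ?_
    rintro _ rfl
    rw [h1]
    refine Runs.add ⟨?_, fun r hr hr' => ?_, fun j hj => ?_⟩
    · simp [h1, h0, show (1 : ℕ) ≠ p by omega, show (0 : ℕ) ≠ p by omega]
    · rw [Function.update_of_ne hr', Function.update_of_ne (by omega)]
    · obtain rfl : j = 0 := by omega
      rw [Function.update_of_ne (by omega)]
      simp
  | succ c ih =>
    refine Runs.weaken (T := 2 * (c + 1) + (1 + 1)) ?_ (by omega) (fun _ h => h)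
    refine Runs.seq (ih (by omega)) ?_
    rintro ν ⟨g1, g2, g3⟩
    refine Runs.seq (T := 1) (T' := 1) (Runs.store (Q := fun ν => ν = _) rfl) ?_
    rintro _ rfl
    rw [g1]
    have hpos : p ≤ p + (c + 1) * N := Nat.le_add_right _ _
    refine Runs.add ⟨?_, fun r hr hr' => ?_, fun j hj => ?_⟩
    · rw [Function.update_self, Function.update_of_ne (by omega), Function.update_of_ne (by omega),
        g1, g2 0 (by omega) (by omega), h0]
      ring
    · rw [Function.update_of_ne hr', Function.update_of_ne (by omega), g2 r hr hr']
    · rw [Function.update_of_ne (by have := Nat.le_add_right p (j * N); omega)]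
      by_cases hjc : j = c + 1
      · subst hjc
        rw [Function.update_self, g2 _ (by omega) (by omega)]
      · rw [Function.update_of_ne, g3 j (by omega)]
        intro he
        have : j * N = (c + 1) * N := by omega
        exact hjc (Nat.eq_of_mul_eq_mul_right hN this)

/-- `x := y * z`, where the cell `0` holds `1` and the cell `8` is the counter. -/
def mulLoop (x y z : ℕ) : RAMProgram :=
  .seq (.copy 8 z) (.seq (.const x 0) (.loop 8 (.seq (.add x x y) (.sub 8 8 0))))

theorem runs_mulLoop {x y z : ℕ} (hx0 : x ≠ 0) (hx : x ≠ 8) (hy : y ≠ 8) (hz : z ≠ 8) (hxy : x ≠ y)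
    (μ : ℕ → ℕ) (h0 : μ 0 = 1) : Runs (mulLoop x y z) μ (μ z * 3 + 4) fun ν =>
      ν x = μ y * μ z ∧ ∀ r, r ≠ x → r ≠ 8 → ν r = μ r := by
  refine Runs.weaken (T := 2 + (1 + (μ z * (2 + 1) + 1))) ?_ (by omega) (fun _ h => h)
  refine Runs.seq (runs_copy (by omega) _ (Q := fun ν => ν = _) rfl) ?_
  rintro _ rfl
  refine Runs.seq (Runs.const (Q := fun ν => ν = _) rfl) ?_
  rintro _ rfl
  refine (Runs.loop (n := μ z) (T := 2) (fun i ν => ν x = μ y * i ∧ ν 8 = μ z - i ∧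
    ∀ r, r ≠ x → r ≠ 8 → ν r = μ r) (fun i ν h => h.2.1) ?_ ?_).weaken le_rfl ?_
  · rintro i hi ν ⟨h1, h2, h3⟩
    refine Runs.seq (T := 1) (T' := 1) (Runs.add (Q := fun ν => ν = _) rfl) ?_
    rintro _ rfl
    refine Runs.sub ⟨?_, ?_, fun r hr hr' => ?_⟩
    · rw [Function.update_of_ne hx, Function.update_self, h1, h3 y (by omega) hy]
      ring
    · rw [Function.update_self, Function.update_of_ne (by omega), Function.update_of_ne (by omega),
        h2, h3 0 (by omega) (by omega), h0]
      omega
    · rw [Function.update_of_ne hr', Function.update_of_ne hr, h3 r hr hr']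
  · refine ⟨by simp, by simp [Ne.symm hx], fun r hr hr' => ?_⟩
    rw [Function.update_of_ne hr, Function.update_of_ne hr']
  · rintro ν ⟨h1, _, h3⟩
    exact ⟨h1, h3⟩

/-- Fetches the cells `4 + c, …, 4` from where `save` has put them and writes them to the entries
`4 + c, …, 4` of the table `0`. The cell `5` is the pointer and the cell `4` holds `N`. -/
def restore (K Z : ℕ) : ℕ → RAMProgram
  | 0 => .seq (.sub 5 5 4) (.seq (.load 9 5) (.seq (.const 10 (K + Z * 4)) (.store 10 9)))
  | c + 1 => .seq (.seq (.sub 5 5 4) (.seq (.load 9 5)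
      (.seq (.const 10 (K + Z * (4 + (c + 1)))) (.store 10 9)))) (restore K Z c)

theorem runs_restore {K Z N p : ℕ} (hK : 11 ≤ K) (hZ : 0 < Z) (f : ℕ → ℕ) (c : ℕ) :
    ∀ μ : ℕ → ℕ, μ 4 = N → μ 5 = p + (c + 1) * N → K + Z * (4 + c) < p →
    (∀ j ≤ c, μ (p + j * N) = f (4 + j)) →
    Runs (restore K Z c) μ (4 * (c + 1)) fun ν =>
      ν 5 = p ∧ (∀ j ≤ c, ν (K + Z * (4 + j)) = f (4 + j)) ∧
        ∀ r, r ≠ 5 → r ≠ 9 → r ≠ 10 → (∀ j ≤ c, r ≠ K + Z * (4 + j)) → ν r = μ r := by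
  have step : ∀ c (μ : ℕ → ℕ), μ 4 = N → μ 5 = p + (c + 1) * N → K < p →
      Runs (.seq (.sub 5 5 4) (.seq (.load 9 5)
      (.seq (.const 10 (K + Z * (4 + c))) (.store 10 9)))) μ 4 fun ν =>
      ν 5 = p + c * N ∧ ν (K + Z * (4 + c)) = μ (p + c * N) ∧
        ∀ r, r ≠ 5 → r ≠ 9 → r ≠ 10 → r ≠ K + Z * (4 + c) → ν r = μ r := by
    intro c μ h4 h5 hp
    have e : p + (c + 1) * N - N = p + c * N := by
      have : (c + 1) * N = c * N + N := by ring
      omega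
    have hpos : p ≤ p + c * N := Nat.le_add_right _ _
    refine Runs.seq (T := 1) (T' := 3) (Runs.sub (Q := fun ν => ν = _) rfl) ?_
    rintro _ rfl
    refine Runs.seq (T := 1) (T' := 2) (Runs.load (Q := fun ν => ν = _) rfl) ?_
    rintro _ rfl
    refine Runs.seq (T := 1) (T' := 1) (Runs.const (Q := fun ν => ν = _) rfl) ?_
    rintro _ rfl
    rw [h4, h5, e, Function.update_self]
    refine Runs.store ?_
    rw [Function.update_self, Function.update_of_ne (by omega) _ _ (a := 9), Function.update_self,
      Function.update_of_ne (by omega) _ _ (a := p + c * N)]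
    refine ⟨?_, ?_, fun r h1 h2 h3 h4 => ?_⟩
    · rw [Function.update_of_ne (by omega), Function.update_of_ne (by omega),
        Function.update_of_ne (by omega), Function.update_self]
    · rw [Function.update_self]
    · rw [Function.update_of_ne h4, Function.update_of_ne h3, Function.update_of_ne h2,
        Function.update_of_ne h1]
  induction c with
  | zero =>
    intro μ h4 h5 hp hf
    refine (step 0 μ h4 h5 (by omega)).weaken (by omega) ?_
    rintro ν ⟨g1, g2, g3⟩
    refine ⟨by simpa using g1, fun j hj => ?_, fun r h1 h2 h3 h4 => g3 r h1 h2 h3 (h4 0 le_rfl)⟩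
    obtain rfl : j = 0 := by omega
    rw [g2, hf 0 le_rfl]
  | succ c ih =>
    intro μ h4 h5 hp hf
    refine Runs.weaken (T := 4 + 4 * (c + 1)) ?_ (by omega) (fun _ h => h)
    refine Runs.seq (step (c + 1) μ h4 h5 (by omega)) ?_
    rintro ν ⟨g1, g2, g3⟩
    have hmono : ∀ j ≤ c, Z * (4 + j) < Z * (4 + (c + 1)) := fun j hj =>
      Nat.mul_lt_mul_of_pos_left (by omega) hZ
    have hsav : ∀ j, ν (p + j * N) = μ (p + j * N) := by
      intro j
      have : p ≤ p + j * N := Nat.le_add_right _ _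
      exact g3 _ (by omega) (by omega) (by omega) (by omega)
    refine (ih ν ?_ g1 ?_ ?_).weaken le_rfl ?_
    · rw [g3 4 (by omega) (by omega) (by omega) (by omega), h4]
    · have := hmono c le_rfl
      omega
    · intro j hj
      rw [hsav, hf j (by omega)]
    · rintro ν' ⟨k1, k2, k3⟩
      refine ⟨k1, fun j hj => ?_, fun r h1 h2 h3 h4 => ?_⟩
      · by_cases hjc : j = c + 1
        · subst hjc
          rw [k3 _ (by omega) (by omega) (by omega), g2, hf _ le_rfl]
          intro j hj he
          have := hmono j hj
          omega
        · exact k2 j (by omega)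
      · rw [k3 r h1 h2 h3 (fun j hj => h4 j (by omega)), g3 r h1 h2 h3 (h4 _ le_rfl)]

/-- Copies every cell `x` below the content of the cell `8` to the entry `x` of the table `0`, in
descending order, so that no cell is overwritten before it has been copied. -/
def spread (K Z : ℕ) : RAMProgram :=
  .loop 8 (.seq (.sub 8 8 0) (.seq (.mulAdd 9 8 K Z) (.seq (.load 10 8)
    (.store 9 10))))

theorem runs_spread {K Z W : ℕ} (hK : 11 ≤ K) (hZ : 0 < Z) (μ : ℕ → ℕ) (h0 : μ 0 = 1)
    (h8 : μ 8 = W) : Runs (spread K Z) μ (W * (Z + 6) + 1) fun ν =>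
      (∀ x, K ≤ x → x < W → ν (K + Z * x) = μ x) ∧
        ∀ r, r ≠ 8 → r ≠ 9 → r ≠ 10 → (∀ x < W, r ≠ K + Z * x) → ν r = μ r := by
  have hle : ∀ x, x ≤ Z * x := fun x => Nat.le_mul_of_pos_left x hZ
  refine (Runs.loop (n := W) (T := Z + 5) (fun i ν => ν 8 = W - i ∧ 
      (∀ x, K ≤ x → x < W → W - i ≤ x → ν (K + Z * x) = μ x) ∧
        ∀ r, r ≠ 8 → r ≠ 9 → r ≠ 10 → (∀ x < W, W - i ≤ x → r ≠ K + Z * x) → ν r = μ r)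
      (fun i ν h => h.1) ?_ ?_).weaken (by rw [show Z + 5 + 1 = Z + 6 by ring]) ?_
  · rintro i hi ν ⟨g1, g2, g3⟩
    refine Runs.weaken (T := 1 + ((Z + 1) + (1 + 1))) ?_ (by omega) (fun _ h => h)
    refine Runs.seq (Runs.sub (Q := fun ν => ν = _) rfl) ?_
    rintro _ rfl
    rw [g1, g3 0 (by omega) (by omega) (by omega) (fun x _ _ => by omega), h0,
      show W - i - 1 = W - (i + 1) by omega]
    refine Runs.seq (runs_mulAdd (by omega) _ _ (Q := fun ν => ν = _) rfl) ?_
    rintro _ rfl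
    rw [Function.update_self]
    refine Runs.seq (Runs.load (Q := fun ν => ν = _) rfl) ?_
    rintro _ rfl
    refine Runs.store ?_
    set y := W - (i + 1) with hy
    have e8 : Function.update (Function.update ν 8 y) 9 (K + Z * y) 8 = y := by
      rw [Function.update_of_ne (by omega), Function.update_self]
    rw [Function.update_self, Function.update_of_ne (by omega) _ _ (a := 9), Function.update_self,
      e8]
    refine ⟨?_, fun x hx hxW hxy => ?_, fun r h1 h2 h3 h4 => ?_⟩
    · rw [Function.update_of_ne (by omega), Function.update_of_ne (by omega),
        Function.update_of_ne (by omega), Function.update_self]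
    · by_cases hxy' : x = y
      · subst hxy'
        rw [Function.update_self, Function.update_of_ne (by omega),
          Function.update_of_ne (by omega), g3 y (by omega) (by omega) (by omega)]
        intro x hx hx'
        have := hle x
        omega
      · have hlt : Z * y < Z * x := Nat.mul_lt_mul_of_pos_left (by omega) hZ
        rw [Function.update_of_ne (by omega), Function.update_of_ne (by omega),
          Function.update_of_ne (by omega), Function.update_of_ne (by omega),
          g2 x hx hxW (by omega)]
    · rw [Function.update_of_ne (h4 y (by omega) le_rfl), Function.update_of_ne h3,
        Function.update_of_ne h2, Function.update_of_ne h1,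
        g3 r h1 h2 h3 (fun x hx hx' => h4 x hx (by omega))]
  · exact ⟨by simp [h8], fun x hx hx' hx'' => by omega, fun r _ _ _ _ => rfl⟩
  · rintro ν ⟨_, g2, g3⟩
    exact ⟨fun x hx hx' => g2 x hx hx' (by omega),
      fun r h1 h2 h3 h4 => g3 r h1 h2 h3 (fun x hx _ => h4 x hx)⟩

/-- The setting up of the memory: the numbers `n, m, k` are added up to the size of the input; the
low cells are saved beyond all the cells that are in use; the powers of the global parameter are
computed; and the input is written into the table `0`. -/
def prologue (K Z : ℕ) : RAMProgram :=
  .seq (.add 0 0 1) <| .seq (.add 0 0 2) <| .seq (.accum 1 0 (K + Z * K + 8 * Z)) <|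
  .seq (.save (K - 5)) <|
  .seq (.copy 4 0) <| .seq (.copy 5 1) <| .seq (.copy 6 2) <| .seq (.copy 7 3) <|
  .seq (.mulAdd 1 4 4 4) <| .seq (.const 0 1) <|
  .seq (.mulLoop 2 1 1) <| .seq (.mulLoop 3 2 1) <| .seq (.copy 8 1) <|
  .seq (.spread K Z) <| .seq (.restore K Z (K - 5)) <|
  .seq (.mulAdd 9 4 0 (K + Z * K + 8 * Z + 1)) <| .seq (.sub 5 5 9) <|
  .seq (.sub 4 4 5) <| .seq (.sub 4 4 6) <|
  .seq (.const 10 K) <| .seq (.store 10 4) <|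
  .seq (.const 10 (K + Z * 1)) <| .seq (.store 10 5) <|
  .seq (.const 10 (K + Z * 2)) <| .seq (.store 10 6) <|
  .seq (.const 10 (K + Z * 3)) (.store 10 7)

theorem runs_prologue {K Z n m k : ℕ} (hK : 11 ≤ K) (hZ : 0 < Z) (hN : 0 < n + m + k) (μ : ℕ → ℕ)
    (h0 : μ 0 = n) (h1 : μ 1 = m) (h2 : μ 2 = k) :
    Runs (prologue K Z) μ ((4 * (n + m + k) + 4) * (Z + 12) + 4 * K * Z + 40 * K + 40 * Z + 100)
      fun ν => (∀ d : Fin 4, ν d = (4 * (n + m + k) + 4) ^ (d : ℕ)) ∧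
        ∀ x < 4 * (n + m + k) + 4, ν (K + Z * x) = μ x := by
  set N := n + m + k with hNdef
  set W := 4 * N + 4 with hW
  set C := K + Z * K + 8 * Z with hC
  set p := m + (C + 1) * N with hp
  have hpK : K + Z * K < p ∧ K + Z * W < p := by
    have e1 : C + 1 ≤ (C + 1) * N := Nat.le_mul_of_pos_right _ hN
    have e2 : (C + 1) * N = (K + 1) * N + Z * K * N + 8 * (Z * N) := by rw [hC]; ring
    have e3 : Z * W = 4 * (Z * N) + 4 * Z := by rw [hW]; ring
    have e4 : Z ≤ Z * N := Nat.le_mul_of_pos_right _ hN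
    have e5 : K + 1 ≤ (K + 1) * N := Nat.le_mul_of_pos_right _ hN
    have e6 : (K + 1) * N = K * N + N := by ring
    omega
  have hWle : W ≤ Z * W := Nat.le_mul_of_pos_left W hZ
  refine Runs.weaken (T := 1 + (1 + ((C + 1) + (2 * (K - 5 + 1) + (2 + (2 + (2 + (2 + ((4 + 1) +
    (1 + ((W * 3 + 4) + ((W * 3 + 4) + (2 + ((W * (Z + 6) + 1) + (4 * (K - 5 + 1) + ((C + 2) +
    (1 + (1 + (1 + (1 + (1 + (1 + (1 + (1 + (1 + (1 + 1)))))))))))))))))))))))))) ?_ ?_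
    (fun _ h => h)
  · refine Runs.seq (Runs.add (Q := fun ν => ν = _) rfl) ?_
    rintro _ rfl
    refine Runs.seq (Runs.add (Q := fun ν => ν = Function.update μ 0 N) ?_) ?_
    · simp [h0, h1, h2, hNdef]
    rintro _ rfl
    refine Runs.seq (runs_accum (by omega) _ _ (Q := fun ν => ν = Function.update
      (Function.update μ 0 N) 1 p) ?_) ?_
    · simp [h1, hp, hC]
    rintro _ rfl
    refine Runs.seq (runs_save hN (K - 5) (p := p) (by omega) _ (by simp) (by simp)) ?_
    rintro ν ⟨g1, g2, g3⟩
    have s0 : ν 0 = N := by rw [g2 0 (by omega) (by omega)]; simp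
    have s2 : ν 2 = k := by rw [g2 2 (by omega) (by omega)]; simp [h2]
    have s3 : ν 3 = μ 3 := by rw [g2 3 (by omega) (by omega)]; simp
    have s4 : ∀ r, K ≤ r → r < p → ν r = μ r := fun r hr hr' => by
      rw [g2 r hr' (by omega)]
      simp [show r ≠ 0 by omega, show r ≠ 1 by omega]
    have s5 : ∀ j ≤ K - 5, ν (p + j * N) = μ (4 + j) := fun j hj => by
      rw [g3 j hj]
      simp [show 4 + j ≠ 1 by omega]
    clear g2 g3
    refine Runs.seq (runs_copy (by omega) _ (Q := fun ν => ν = _) rfl) ?_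
    rintro _ rfl
    refine Runs.seq (runs_copy (by omega) _ (Q := fun ν => ν = _) rfl) ?_
    rintro _ rfl
    refine Runs.seq (runs_copy (by omega) _ (Q := fun ν => ν = _) rfl) ?_
    rintro _ rfl
    refine Runs.seq (runs_copy (by omega) _ (Q := fun ν => ν = _) rfl) ?_
    rintro _ rfl
    refine Runs.seq (runs_mulAdd (by omega) _ _ (Q := fun ν => ν = _) rfl) ?_
    rintro _ rfl
    refine Runs.seq (Runs.const (Q := fun ν' => ν' 0 = 1 ∧ ν' 1 = W ∧ ν' 4 = N ∧
      ν' 5 = p + (K - 5 + 1) * N ∧ ν' 6 = k ∧ ν' 7 = μ 3 ∧ ∀ r, K ≤ r → ν' r = ν r) ?_) ?_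
    · simp only [Function.update_apply]
      norm_num [s0, g1, s2, s3]
      refine ⟨by omega, fun r hr => ?_⟩
      simp [show r ≠ 0 by omega, show r ≠ 1 by omega, show r ≠ 4 by omega, show r ≠ 5 by omega,
        show r ≠ 6 by omega, show r ≠ 7 by omega]
    rintro ν₁ ⟨a0, a1, a4, a5, a6, a7, aK⟩
    refine Runs.seq ((runs_mulLoop (by omega) (by omega) (by omega) (by omega) (by omega) ν₁
      a0).weaken (by rw [a1]) (fun _ h => h)) ?_
    rintro ν₂ ⟨b2, bK⟩
    refine Runs.seq ((runs_mulLoop (by omega) (by omega) (by omega) (by omega) (by omega) ν₂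
      (by rw [bK 0 (by omega) (by omega), a0])).weaken (by rw [bK 1 (by omega) (by omega), a1])
      (fun _ h => h)) ?_
    rintro ν₃ ⟨c3, cK⟩
    refine Runs.seq (runs_copy (by omega) _ (Q := fun ν' => ν' 0 = 1 ∧ ν' 1 = W ∧ ν' 2 = W ^ 2 ∧
      ν' 3 = W ^ 3 ∧ ν' 4 = N ∧ ν' 5 = p + (K - 5 + 1) * N ∧ ν' 6 = k ∧ ν' 7 = μ 3 ∧ ν' 8 = W ∧
      ∀ r, K ≤ r → ν' r = ν r) ?_) ?_
    · refine ⟨?_, ?_, ?_, ?_, ?_, ?_, ?_, ?_, ?_, fun r hr => ?_⟩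
      · rw [Function.update_of_ne (by omega), cK _ (by omega) (by omega),
          bK _ (by omega) (by omega), a0]
      · rw [Function.update_of_ne (by omega), cK _ (by omega) (by omega),
          bK _ (by omega) (by omega), a1]
      · rw [Function.update_of_ne (by omega), cK _ (by omega) (by omega), b2, a1, pow_two]
      · rw [Function.update_of_ne (by omega), c3, b2, bK _ (by omega) (by omega), a1]
        ring
      · rw [Function.update_of_ne (by omega), cK _ (by omega) (by omega),
          bK _ (by omega) (by omega), a4]
      · rw [Function.update_of_ne (by omega), cK _ (by omega) (by omega),
          bK _ (by omega) (by omega), a5]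
      · rw [Function.update_of_ne (by omega), cK _ (by omega) (by omega),
          bK _ (by omega) (by omega), a6]
      · rw [Function.update_of_ne (by omega), cK _ (by omega) (by omega),
          bK _ (by omega) (by omega), a7]
      · rw [Function.update_self, cK _ (by omega) (by omega), bK _ (by omega) (by omega), a1]
      · rw [Function.update_of_ne (by omega), cK _ (by omega) (by omega),
          bK _ (by omega) (by omega), aK r hr]
    clear a0 a1 a4 a5 a6 a7 aK b2 bK c3 cK s0 s2 s3 g1
    rintro ν₄ ⟨a0, a1, a2, a3, a4, a5, a6, a7, a8, aK⟩
    refine Runs.seq (runs_spread hK hZ ν₄ a0 a8) ?_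
    rintro ν₅ ⟨b1, b2⟩
    have hlow : ∀ r, r < 8 → ν₅ r = ν₄ r := fun r hr =>
      b2 r (by omega) (by omega) (by omega) (fun x _ => by omega)
    have hle : ∀ x < W, Z * x ≤ Z * W := fun x hx => Nat.mul_le_mul_left _ hx.le
    refine Runs.seq (runs_restore (N := N) (p := p) hK hZ μ (K - 5) ν₅
      (by rw [hlow _ (by omega), a4]) (by rw [hlow _ (by omega), a5]) ?_ ?_) ?_
    · have : Z * (4 + (K - 5)) ≤ Z * K := Nat.mul_le_mul_left _ (by omega)
      omega
    · intro j hj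
      have hpos : p ≤ p + j * N := Nat.le_add_right _ _
      rw [b2 _ (by omega) (by omega) (by omega), aK _ (by omega), s5 j hj]
      intro x hx
      have := hle x hx
      omega
    rintro ν₆ ⟨c1, c2, c3⟩
    have hlow' : ∀ r, r < 8 → r ≠ 5 → ν₆ r = ν₄ r := fun r hr hr' => by
      rw [c3 r hr' (by omega) (by omega) (fun j _ => by omega), hlow r hr]
    have htab : ∀ x, 4 ≤ x → x < W → ν₆ (K + Z * x) = μ x := by
      intro x hx hxW
      by_cases hxK : x < K
      · have := c2 (x - 4) (by omega)
        rwa [show 4 + (x - 4) = x by omega] at this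
      · rw [c3, b1 x (by omega) hxW, aK x (by omega), s4 x (by omega) (by omega)]
        · omega
        · omega
        · omega
        · intro j hj he
          have : Z * (4 + j) < Z * x := Nat.mul_lt_mul_of_pos_left (by omega) hZ
          omega
    refine Runs.seq (runs_mulAdd (by omega) _ _ (Q := fun ν => ν = _) rfl) ?_
    rintro _ rfl
    refine Runs.seq (Runs.sub (Q := fun ν => ν = _) rfl) ?_
    rintro _ rfl
    refine Runs.seq (Runs.sub (Q := fun ν => ν = _) rfl) ?_
    rintro _ rfl
    refine Runs.seq (Runs.sub (Q := fun ν' => ν' 4 = n ∧ ν' 5 = m ∧ ν' 6 = k ∧ ν' 7 = μ 3 ∧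
      ∀ r, (r < 4 ∨ K ≤ r) → ν' r = ν₆ r) ?_) ?_
    · have d4 := (hlow' 4 (by omega) (by omega)).trans a4
      have d6 := (hlow' 6 (by omega) (by omega)).trans a6
      have d7 := (hlow' 7 (by omega) (by omega)).trans a7
      simp only [Function.update_apply]
      norm_num [c1, d4, d6, d7, ← hC]
      refine ⟨by omega, by omega, fun r hr => ?_⟩
      simp [show r ≠ 4 by omega, show r ≠ 5 by omega, show r ≠ 9 by omega]
    rintro ν₇ ⟨d4, d5, d6, d7, dK⟩
    have step : ∀ (ν : ℕ → ℕ) (x : ℕ) (T : ℕ) (p : RAMProgram) (Q : (ℕ → ℕ) → Prop), x < 4 →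
        (∀ r, 4 ≤ r → r < 8 → ν r = ν₇ r) →
        (∀ ν' : ℕ → ℕ, (∀ r, 4 ≤ r → r < 8 → ν' r = ν₇ r) → ν' (K + Z * x) = ν₇ (4 + x) →
          (∀ r, r ≠ 10 → r ≠ K + Z * x → ν' r = ν r) → Runs p ν' T Q) →
        Runs (.seq (.const 10 (K + Z * x)) (.seq (.store 10 (4 + x)) p)) ν (1 + (1 + T)) Q := by
      intro ν x T p Q hx h1 h2
      refine Runs.seq (Runs.const (Q := fun ν => ν = _) rfl) ?_
      rintro _ rfl
      refine Runs.seq (Runs.store (Q := fun ν => ν = _) rfl) ?_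
      rintro _ rfl
      rw [Function.update_self, Function.update_of_ne (by omega)]
      refine h2 _ (fun r hr hr' => ?_) ?_ (fun r hr hr' => ?_)
      · rw [Function.update_of_ne (by omega), Function.update_of_ne (by omega), h1 r hr hr']
      · rw [Function.update_self, h1 _ (by omega) (by omega)]
      · rw [Function.update_of_ne hr', Function.update_of_ne hr]
    refine step ν₇ 0 _ _ _ (by omega) (fun r _ _ => rfl) ?_
    intro e0 e01 e02 e03
    refine step e0 1 _ _ _ (by omega) e01 ?_
    intro e1 e11 e12 e13
    refine step e1 2 _ _ _ (by omega) e11 ?_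
    intro e2 e21 e22 e23
    refine Runs.seq (Runs.const (Q := fun ν => ν = _) rfl) ?_
    rintro _ rfl
    refine Runs.store ?_
    rw [Function.update_self, Function.update_of_ne (by omega) _ _ (a := 7), e21 7 (by omega)
      (by omega), d7]
    refine ⟨fun d => ?_, fun x hx => ?_⟩
    · have hd : (d : ℕ) < 4 := d.2
      rw [Function.update_of_ne (by omega), Function.update_of_ne (by omega),
        e23 _ (by omega) (by omega), e13 _ (by omega) (by omega), e03 _ (by omega) (by omega),
        dK _ (by omega), hlow' _ (by omega) (by omega)]
      have : (d : ℕ) = 0 ∨ (d : ℕ) = 1 ∨ (d : ℕ) = 2 ∨ (d : ℕ) = 3 := by omega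
      rcases this with h | h | h | h <;> rw [h] <;> simp [a0, a1, a2, a3]
    · have inj : ∀ y, x ≠ y → K + Z * x ≠ K + Z * y := fun y hxy he =>
        hxy (Nat.eq_of_mul_eq_mul_left hZ (by omega))
      by_cases x3 : x = 3
      · subst x3; rw [Function.update_self]
      rw [Function.update_of_ne (inj 3 x3), Function.update_of_ne (by omega)]
      by_cases x2 : x = 2
      · subst x2; rw [e22, d6, h2]
      rw [e23 _ (by omega) (inj 2 x2)]
      by_cases x1 : x = 1
      · subst x1; rw [e12, d5, h1]
      rw [e13 _ (by omega) (inj 1 x1)]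
      by_cases x0 : x = 0
      · subst x0; rw [e02, d4, h0]
      rw [e03 _ (by omega) (inj 0 x0), dK _ (by omega), htab x (by omega) hx]
  · have e1 : W * (Z + 12) = W * (Z + 6) + 6 * W := by ring
    have e2 : Z * K = K * Z := by ring
    have e3 : 4 * K * Z = 4 * (K * Z) := by ring
    simp only [← add_assoc]
    omega

/-- Puts the address of the entry `W ^ 2 + c` of the table `A` into every cell `c ≤ j`. -/
def pointers (K Z A : ℕ) : ℕ → RAMProgram
  | 0 => .mulAdd 0 2 (K + A) Z
  | c + 1 => .seq (pointers K Z A c) (.seq (.const (c + 1) (Z * (c + 1))) (.add (c + 1) (c + 1) 0))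

theorem runs_pointers {K Z A : ℕ} (j : ℕ) (μ : ℕ → ℕ) :
    Runs (pointers K Z A j) μ (2 * j + Z + 1) fun ν =>
      (∀ c ≤ j, ν c = K + Z * (μ 2 + c) + A) ∧ ∀ r, j < r → ν r = μ r := by
  induction j with
  | zero =>
    refine (runs_mulAdd (by omega) Z μ ?_).weaken (by omega) (fun _ h => h)
    refine ⟨fun c hc => ?_, fun r hr => Function.update_of_ne (by omega) _ _⟩
    obtain rfl : c = 0 := by omega
    rw [Function.update_self]; ring
  | succ j ih =>
    refine Runs.weaken (T := (2 * j + Z + 1) + (1 + 1)) ?_ (by omega) (fun _ h => h)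
    refine Runs.seq ih ?_
    rintro ν ⟨h1, h2⟩
    refine Runs.seq (Runs.const (Q := fun ν => ν = _) rfl) ?_
    rintro _ rfl
    refine Runs.add ⟨fun c hc => ?_, fun r hr => ?_⟩
    · by_cases hcj : c = j + 1
      · subst hcj
        rw [Function.update_self, Function.update_self, Function.update_of_ne (by omega),
          h1 0 (by omega)]
        ring
      · rw [Function.update_of_ne hcj, Function.update_of_ne hcj, h1 c (by omega)]
    · rw [Function.update_of_ne (by omega), Function.update_of_ne (by omega), h2 r (by omega)]

/-- Replaces the content of every cell `c ≤ j` by the content of the cell to which it points. -/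
def follow : ℕ → RAMProgram
  | 0 => .load 0 0
  | c + 1 => .seq (follow c) (.load (c + 1) (c + 1))

theorem runs_follow (j : ℕ) (μ : ℕ → ℕ) (h : ∀ c ≤ j, j < μ c) :
    Runs (follow j) μ (j + 1) fun ν => (∀ c ≤ j, ν c = μ (μ c)) ∧ ∀ r, j < r → ν r = μ r := by
  suffices H : ∀ i ≤ j, Runs (follow i) μ (i + 1) fun ν =>
      (∀ c ≤ i, ν c = μ (μ c)) ∧ ∀ r, i < r → ν r = μ r from H j le_rfl
  intro i
  induction i with
  | zero =>
    intro _
    refine Runs.load ⟨fun c hc => ?_, fun r hr => Function.update_of_ne (by omega) _ _⟩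
    obtain rfl : c = 0 := by omega
    rw [Function.update_self]
  | succ i ih =>
    intro hi
    refine Runs.seq (ih (by omega)) ?_
    rintro ν ⟨h1, h2⟩
    refine Runs.load ⟨fun c hc => ?_, fun r hr => ?_⟩
    · by_cases hci : c = i + 1
      · subst hci
        have := h (i + 1) hi
        rw [Function.update_self, h2 (i + 1) (by omega), h2 _ (by omega)]
      · rw [Function.update_of_ne hci, h1 c (by omega)]
    · rw [Function.update_of_ne (by omega), h2 r (by omega)]

/-- Writes the table `A` out to the lowest cells of the memory. The entries `i < K` cannot be written
before all registers have become useless; they are read from a second copy of the table, which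
begins at the entry `W ^ 2`. -/
def epilogue (K Z A : ℕ) : RAMProgram :=
  .seq (.copy 4 2) <| .seq (.const 5 K) <|
  .seq (.loop 4 (.seq (.mulAdd 6 5 (K + A) Z) (.seq (.load 7 6) (.seq (.store 5 7)
    (.seq (.add 5 5 0) (.sub 4 4 0)))))) <|
  .seq (.pointers K Z A (K - 1)) (.follow (K - 1))

theorem runs_epilogue {K Z A W : ℕ} (hK : 11 ≤ K) (hZ : 0 < Z) (μ : ℕ → ℕ) (f : ℕ → ℕ)
    (h0 : μ 0 = 1) (h2 : μ 2 = W ^ 2) (hf : ∀ i, μ (K + Z * i + A) = f i) :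
    Runs (epilogue K Z A) μ (W ^ 2 * (Z + 6) + 3 * K + Z + 10) fun ν =>
      (∀ i < K, ν i = f (W ^ 2 + i)) ∧ ∀ i, K ≤ i → i < W ^ 2 → ν i = f i := by
  set n := W ^ 2 with hn
  have hle : ∀ x, x ≤ Z * x := fun x => Nat.le_mul_of_pos_left x hZ
  refine Runs.weaken (T := 2 + (1 + ((n * (((Z + 1) + (1 + (1 + (1 + 1)))) + 1) + 1) +
    ((2 * (K - 1) + Z + 1) + ((K - 1) + 1))))) ?_ ?_ (fun _ h => h)
  · refine Runs.seq (runs_copy (by omega) _ (Q := fun ν => ν = _) rfl) ?_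
    rintro _ rfl
    refine Runs.seq (Runs.const (Q := fun ν => ν = _) rfl) ?_
    rintro _ rfl
    refine Runs.seq (Runs.loop (n := n) (T := (Z + 1) + (1 + (1 + (1 + 1)))) (fun j ν => ν 4 = n - j ∧ ν 5 = K + j ∧ ν 0 = 1 ∧ ν 2 = n ∧
      (∀ i, K ≤ i → i < K + j → ν i = f i) ∧ ∀ r, K + j ≤ r → ν r = μ r)
      (fun i ν h => h.1) ?_ ?_) ?_
    · rintro j hj ν ⟨g4, g5, g0, g2, gf, gr⟩
      have e1 : K + A + Z * (K + j) = K + Z * (K + j) + A := by ring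
      have e2 := hle (K + j)
      refine Runs.seq (T := Z + 1) (T' := 1 + (1 + (1 + 1)))
        (P := fun ν' => ν' = Function.update ν 6 (K + Z * (K + j) + A))
        (runs_mulAdd (x := 6) (y := 5) (by omega) _ _ (by rw [g5, e1])) ?_
      rintro _ rfl
      refine Runs.seq (T := 1) (T' := 1 + (1 + 1))
        (Runs.load (Q := fun ν' => ν' = Function.update (Function.update ν 6
        (K + Z * (K + j) + A)) 7 (f (K + j))) ?_) ?_
      · rw [Function.update_self, Function.update_of_ne (show K + Z * (K + j) + A ≠ 6 by omega),
          gr _ (by omega), hf]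
      rintro _ rfl
      refine Runs.seq (T := 1) (T' := 1 + 1) (Runs.store (Q := fun ν => ν = _) rfl) ?_
      rintro _ rfl
      rw [Function.update_self, Function.update_of_ne (by omega) _ _ (a := 5),
        Function.update_of_ne (by omega) _ _ (a := 5), g5]
      refine Runs.seq (T := 1) (T' := 1) (Runs.add (Q := fun ν => ν = _) rfl) ?_
      rintro _ rfl
      refine Runs.sub ?_
      have q : ∀ r < K, r ≠ K + j := fun r hr => by omega
      refine ⟨?_, ?_, ?_, ?_, fun i hi hi' => ?_, fun r hr => ?_⟩
      · simp [Function.update_apply, q 0 (by omega), q 4 (by omega), g4, g0]; omega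
      · simp [Function.update_apply, q 0 (by omega), q 5 (by omega), g5, g0]; omega
      · simp [Function.update_apply, q 0 (by omega), g0]
      · simp [Function.update_apply, q 2 (by omega), g2]
      · rw [Function.update_of_ne (by omega), Function.update_of_ne (by omega)]
        by_cases hij : i = K + j
        · subst hij; rw [Function.update_self]
        · rw [Function.update_of_ne hij, Function.update_of_ne (by omega),
            Function.update_of_ne (by omega), gf i hi (by omega)]
      · rw [Function.update_of_ne (by omega), Function.update_of_ne (by omega),
          Function.update_of_ne (by omega), Function.update_of_ne (by omega),
          Function.update_of_ne (by omega), gr r (by omega)]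
    · refine ⟨by simp [h2], by simp, by simp [h0], by simp [h2], fun i hi hi' => by omega,
        fun r hr => ?_⟩
      rw [Function.update_of_ne (by omega), Function.update_of_ne (by omega)]
    · rintro ν ⟨_, _, _, g2, gf, gr⟩
      refine Runs.seq (runs_pointers (K - 1) ν) ?_
      rintro ν₁ ⟨k1, k2⟩
      refine (runs_follow (K - 1) ν₁ ?_).weaken le_rfl ?_
      · intro c hc
        rw [k1 c hc]; omega
      · rintro ν₂ ⟨l1, l2⟩
        refine ⟨fun i hi => ?_, fun i hi hi' => ?_⟩
        · have := hle (n + i)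
          rw [l1 i (by omega), k1 i (by omega), k2 _ (by omega), g2, gr _ (by omega), hf]
        · rw [l2 i (by omega), k2 i (by omega), gf i hi (by omega)]
  · have : n * (Z + 6) = n * (Z + 1 + (1 + (1 + (1 + 1))) + 1) := by ring
    omega

end RAMProgram

/-- Every command is executed by a program in polynomial time. The table `0` is initialized with the
input; the table `A` of the output has to be written twice, the second time from the entry `W ^ 2`
on, as the lowest cells of the output are read from the second copy. -/
theorem TCmd.exists_program (c : TCmd) (A : ℕ) :
    ∃ (prog : RAMProgram) (T : Polynomial ℕ), ∀ (n m k : ℕ) (μ : ℕ → ℕ), μ 0 = n → μ 1 = m →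
      μ 2 = k → Runs prog μ (T.eval (n + m + k)) fun ν => 0 < n + m + k →
        ∃ (s : ℕ → ℕ → ℕ) (v : ℕ → ℕ), (∀ x < 4 * (n + m + k) + 4, s 0 x = μ x) ∧
          ∃ B, ∀ i < (4 * (n + m + k) + 4) ^ 2, ν i =
            c.exec (4 * (n + m + k) + 4) v s A (if i < B then
              (4 * (n + m + k) + 4) ^ 2 + i else i) := by
  set B := c.bound + A + 1 with hB
  set K := 4 + B + c.bound + 11 with hK
  obtain ⟨T, hT⟩ := c.runs_comp (B := B) (K := K) (by omega) (4 + B) le_rfl (by omega) (by omega)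
  set P := RAMProgram.seq (.prologue K (B + 1)) (.seq (c.comp B K (4 + B)) (.epilogue K (B + 1) A))
  set T₁ : Polynomial ℕ := ((4 * Polynomial.X + 4) * Polynomial.C (B + 1 + 12) +
    Polynomial.C (4 * K * (B + 1) + 40 * K + 40 * (B + 1) + 100)) + (T.comp (4 * Polynomial.X + 4) +
      ((4 * Polynomial.X + 4) ^ 2 * Polynomial.C (B + 1 + 6) +
        Polynomial.C (3 * K + (B + 1) + 10))) with hT₁
  -- in the empty network the addresses of the saved cells would coincide; there is nothing to compute
  refine ⟨.branch 0 P (.branch 1 P (.branch 2 P (.const 0 0))), T₁ + (T₁ + (T₁ + 1 + 1) + 1) + 1, ?_⟩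
  intro n m k μ h0 h1 h2
  simp only [Polynomial.eval_add, Polynomial.eval_one]
  have main : 0 < n + m + k → Runs P μ (T₁.eval (n + m + k)) fun ν => 0 < n + m + k →
        ∃ (s : ℕ → ℕ → ℕ) (v : ℕ → ℕ), (∀ x < 4 * (n + m + k) + 4, s 0 x = μ x) ∧
          ∃ B, ∀ i < (4 * (n + m + k) + 4) ^ 2, ν i =
            c.exec (4 * (n + m + k) + 4) v s A (if i < B then
              (4 * (n + m + k) + 4) ^ 2 + i else i) := by
    intro hN
    simp only [hT₁, Polynomial.eval_add, Polynomial.eval_mul, Polynomial.eval_X,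
      Polynomial.eval_ofNat, Polynomial.eval_C, Polynomial.eval_comp, Polynomial.eval_pow]
    refine Runs.seq ((RAMProgram.runs_prologue (by omega) (by omega) hN μ h0 h1 h2).weaken
      (by simp only [add_assoc]; exact le_rfl) (fun _ h => h)) ?_
    rintro ν ⟨g1, g2⟩
    refine Runs.seq (hT (4 * (n + m + k) + 4) (fun A i => ν (K + (B + 1) * i + A))
      (fun j => ν (4 + j)) ν ⟨g1, fun _ _ => rfl, fun _ _ _ => rfl⟩) ?_
    rintro ν' ⟨k1, -⟩
    refine (RAMProgram.runs_epilogue (W := 4 * (n + m + k) + 4) (by omega) (by omega) ν' _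
      (by simpa using k1.1 0) (by simpa using k1.1 2)
      (fun i => k1.2.2 A (by omega) i)).weaken (by simp only [add_assoc]; exact le_rfl) ?_
    rintro ν'' ⟨l1, l2⟩ -
    refine ⟨fun A i => ν (K + (B + 1) * i + A), fun j => ν (4 + j), fun x hx => g2 x hx, K,
      fun i hi => ?_⟩
    by_cases hiK : i < K
    · rw [l1 i hiK, if_pos hiK]
    · rw [l2 i (by omega) hi, if_neg hiK]
  refine Runs.branch (fun h => main (by omega)) fun g0 => ?_
  refine Runs.branch (fun h => main (by omega)) fun g1 => ?_
  refine Runs.branch (fun h => main (by omega)) fun g2 => ?_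
  refine Runs.const fun h => ?_
  omega

/-! ### Cyclic distances -/

/-- The number of steps from `a` to `b` along a cycle of `σ` (and `0` if they are not on a common
cycle). -/
noncomputable def cdist {D : Type} (σ : Equiv.Perm D) (a b : D) : ℕ := sInf {t | (σ ^ t) a = b}

section CyclicDistance

variable {D : Type} [Finite D] {σ : Equiv.Perm D} {a b c d x : D}

theorem pow_cdist (h : σ.SameCycle a b) : (σ ^ cdist σ a b) a = b := by
  obtain ⟨t, ht⟩ := h.exists_nat_pow_eq
  exact Nat.sInf_mem (s := {t | (σ ^ t) a = b}) ⟨t, ht⟩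

omit [Finite D] in
theorem cdist_le {t : ℕ} (h : (σ ^ t) a = b) : cdist σ a b ≤ t := Nat.sInf_le h

/-- Distances between arbitrary points of a cycle in terms of the distances from one point. -/
theorem exists_cdist_rebase (σ : Equiv.Perm D) (x : D) : ∃ L,
    (∀ a, σ.SameCycle x a → cdist σ x a < L) ∧
    (∀ a b, σ.SameCycle x a → σ.SameCycle x b → cdist σ x a = cdist σ x b → a = b) ∧
    ∀ a b, σ.SameCycle x a → σ.SameCycle x b →
      cdist σ a b = if cdist σ x a ≤ cdist σ x b then cdist σ x b - cdist σ x a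
        else L + cdist σ x b - cdist σ x a := by
  have hpos : 0 < Function.minimalPeriod σ x :=
    Function.minimalPeriod_pos_of_mem_periodicPts
      (Function.Injective.mem_periodicPts σ.injective x)
  set L := Function.minimalPeriod σ x with hL
  have hmod : ∀ t, (σ ^ (t % L)) x = (σ ^ t) x := by
    intro t
    rw [← Equiv.Perm.iterate_eq_pow, ← Equiv.Perm.iterate_eq_pow, hL,
      Function.iterate_mod_minimalPeriod_eq]
  have hlt : ∀ a, σ.SameCycle x a → cdist σ x a < L := by
    intro a ha
    obtain ⟨t, ht⟩ := ha.exists_nat_pow_eq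
    exact (cdist_le ((hmod t).trans ht)).trans_lt (Nat.mod_lt _ hpos)
  have hinj : ∀ s t, (σ ^ s) x = (σ ^ t) x → s % L = t % L := by
    intro s t h
    rw [← hmod s, ← hmod t, ← Equiv.Perm.iterate_eq_pow, ← Equiv.Perm.iterate_eq_pow] at h
    exact (Function.iterate_eq_iterate_iff_of_lt_minimalPeriod (Nat.mod_lt _ hpos)
      (Nat.mod_lt _ hpos)).1 h
  refine ⟨L, hlt, ?_, ?_⟩
  · intro a b ha hb h
    rw [← pow_cdist ha, ← pow_cdist hb, h]
  · intro a b ha hb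
    have ha' := pow_cdist ha
    have hb' := pow_cdist hb
    have la := hlt a ha
    have lb := hlt b hb
    obtain ⟨t, ht⟩ := (ha.symm.trans hb).exists_nat_pow_eq
    have hab := pow_cdist (ha.symm.trans hb)
    set i := cdist σ x a
    set j := cdist σ x b
    have low := hinj (cdist σ a b + i) j (by rw [pow_add, Equiv.Perm.mul_apply, ha', hab, hb'])
    rw [Nat.mod_eq_of_lt lb] at low
    have hdm := Nat.div_add_mod (cdist σ a b + i) L
    rw [low] at hdm
    have hup : ∀ v, (v + i) % L = j → cdist σ a b ≤ v := by
      intro v hv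
      refine cdist_le ?_
      rw [← ha', ← Equiv.Perm.mul_apply, ← pow_add, ← hmod, hv, hb']
    split_ifs with hij
    · have := hup (j - i) (by rw [Nat.sub_add_cancel hij, Nat.mod_eq_of_lt lb])
      generalize (cdist σ a b + i) / L = q at hdm
      have := Nat.zero_le (L * q)
      omega
    · have := hup (L + j - i) (by
        rw [Nat.sub_add_cancel (by omega), Nat.add_mod_left, Nat.mod_eq_of_lt lb])
      generalize (cdist σ a b + i) / L = q at hdm
      have hq : q ≠ 0 := by
        rintro rfl
        omega
      have : L * 1 ≤ L * q := Nat.mul_le_mul_left _ (by omega)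
      omega

omit [Finite D] in
theorem cdist_self : cdist σ a a = 0 := Nat.le_zero.1 (cdist_le rfl)

theorem between_iff (h : σ.SameCycle a b) (h' : σ.SameCycle a c) :
    Between σ a b c ↔ cdist σ a b ≤ cdist σ a c := by
  constructor
  · rintro ⟨i, j, hij, hi, hj, hl⟩
    refine (cdist_le hi).trans (hij.trans ?_)
    by_contra hlt
    exact hl _ (not_le.1 hlt) (pow_cdist h')
  · intro hle
    exact ⟨_, _, hle, pow_cdist h, pow_cdist h', fun l hl h => absurd (cdist_le h) (by omega)⟩

variable {p p' q q' : D}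

/-- The three ways in which a pair `q, q'` can lie with respect to a pair `p, p'` on a cycle, in
terms of the distances from `p`. -/
theorem behaviour_iff (hp' : σ.SameCycle p p') (hq : σ.SameCycle p q) (hq' : σ.SameCycle p q')
    (h1 : p ≠ p') (h2 : p ≠ q) (h3 : p ≠ q') (h4 : p' ≠ q) (h5 : p' ≠ q') (h6 : q ≠ q') :
    (¬ ((Between σ q p q' ∧ Between σ q p' q') ∨ (Between σ q' p q ∧ Between σ q' p' q)) ↔
      (cdist σ p q < cdist σ p p' ↔ ¬ cdist σ p q' < cdist σ p p')) ∧
    ((BeforeIn σ q p' p q' ∨ BeforeIn σ q' p' p q) ↔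
      (cdist σ p q < cdist σ p p' ∧ cdist σ p q' < cdist σ p p')) ∧
    ((BeforeIn σ q p p' q' ∨ BeforeIn σ q' p p' q) ↔
      (¬ cdist σ p q < cdist σ p p' ∧ ¬ cdist σ p q' < cdist σ p p')) := by
  obtain ⟨L, hlt, hinj, hd⟩ := exists_cdist_rebase σ p
  have hp : σ.SameCycle p p := Equiv.Perm.SameCycle.refl _ _
  have l1 := hlt _ hp'
  have l2 := hlt _ hq
  have l3 := hlt _ hq'
  have i1 := mt (hinj _ _ hp hp') h1
  have i2 := mt (hinj _ _ hp hq) h2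
  have i3 := mt (hinj _ _ hp hq') h3
  have i4 := mt (hinj _ _ hp' hq) h4
  have i5 := mt (hinj _ _ hp' hq') h5
  have i6 := mt (hinj _ _ hq hq') h6
  rw [cdist_self] at i1 i2 i3
  have qp := hq.symm
  have qp' := hq.symm.trans hp'
  have qq' := hq.symm.trans hq'
  have q'p := hq'.symm
  have q'p' := hq'.symm.trans hp'
  have q'q := hq'.symm.trans hq
  unfold BeforeIn
  rw [between_iff qp qq', between_iff qp' qq', between_iff q'p q'q, between_iff q'p' q'q,
    between_iff qp' qp, between_iff q'p' q'p, between_iff qp qp', between_iff q'p q'p',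
    hd _ _ hq hp, hd _ _ hq hp', hd _ _ hq hq', hd _ _ hq' hp, hd _ _ hq' hp', hd _ _ hq' hq,
    cdist_self]
  generalize cdist σ p p' = α at *
  generalize cdist σ p q = β at *
  generalize cdist σ p q' = γ at *
  refine ⟨?_, ?_, ?_⟩ <;> split_ifs <;> omega

end CyclicDistance

/-! ### Potentials of circulations modulo 2 -/

namespace Network

variable {N : Network}

/-- A linear functional space of functions that are constant on classes is no larger than the number
of classes. -/
theorem finrank_le_of_constant {V : Type} [AddCommGroup V] [Module (ZMod 2) V]
    {ι Ω : Type} [Finite Ω] (f : V →ₗ[ZMod 2] (ι → ZMod 2)) (hf : Function.Injective f)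
    (cl : ι → Ω) (hcl : Function.Surjective cl) (h : ∀ v i j, cl i = cl j → f v i = f v j) :
    Module.finrank (ZMod 2) V ≤ Nat.card Ω := by
  have := Fintype.ofFinite Ω
  choose r hr using hcl
  let g : V →ₗ[ZMod 2] (Ω → ZMod 2) := (LinearMap.funLeft (ZMod 2) (ZMod 2) r).comp f
  have hg : Function.Injective g := by
    intro v w hvw
    apply hf
    funext i
    have := congrFun hvw (cl i)
    simp only [g, LinearMap.comp_apply, LinearMap.funLeft_apply] at this
    rw [h v i (r (cl i)) (hr _).symm, h w i (r (cl i)) (hr _).symm, this]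
  have := LinearMap.finrank_le_finrank_of_injective hg
  simpa using this

/-- On a sphere every circulation modulo 2 is the coboundary of a function on the faces. The value
`ψ d` is that of the face on the right-hand side of the dart `d`. -/
theorem exists_potential (hE : N.SphereEmbedding) (c : Fin N.m → ZMod 2)
    (hc : ∀ v, ∑ d : Fin N.m × Bool, (if N.vert d = v then c d.1 else 0) = 0) :
    ∃ ψ : Fin N.m × Bool → ZMod 2, ∀ d, ψ (N.rot d) = ψ d + c d.1 ∧ ψ (N.rot (N.flip d)) = ψ d := by
  classical
  let D := Fin N.m × Bool
  let Vt := Quotient (Equiv.Perm.SameCycle.setoid N.rot)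
  let Fc := Quotient (Equiv.Perm.SameCycle.setoid (N.rot * N.flip))
  let G := Subgroup.closure ({N.rot, N.flip} : Set (Equiv.Perm D))
  let Ω := MulAction.orbitRel.Quotient G D
  let vt : D → Vt := fun d => Quotient.mk _ d
  let fc : D → Fc := fun d => Quotient.mk _ d
  let om : D → Ω := fun d => Quotient.mk _ d
  have : Fintype Vt := Fintype.ofFinite _
  have : Fintype Fc := Fintype.ofFinite _
  have hom : Function.Surjective om := Quotient.mk_surjective
  have hfcs : Function.Surjective fc := Quotient.mk_surjective
  have hvts : Function.Surjective vt := Quotient.mk_surjective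
  have hff : ∀ d : D, N.flip (N.flip d) = d := by rintro ⟨a, b⟩; simp [flip]
  -- functions invariant under the rotation and the flip are constant on the components
  have hinv : ∀ φ : D → ZMod 2, (∀ d, φ (N.rot d) = φ d) → (∀ d, φ (N.flip d) = φ d) →
      ∀ d d', om d = om d' → φ d = φ d' := by
    intro φ h1 h2 d d' h
    obtain ⟨⟨g, hg⟩, rfl⟩ : ∃ g : G, g • d' = d := Quotient.exact h
    change φ (g d') = φ d'
    induction hg using Subgroup.closure_induction generalizing d' with
    | mem x hx => rcases hx with rfl | rfl <;> [exact h1 _; exact h2 _]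
    | one => rfl
    | mul x y _ _ hx hy =>
      rw [Equiv.Perm.mul_apply, hx (y d') (by
        refine Quotient.sound ?_
        exact ⟨⟨x, by assumption⟩, rfl⟩), hy]
      refine Quotient.sound ?_
      exact ⟨⟨y, by assumption⟩, rfl⟩
    | inv x _ hx =>
      have := hx (x⁻¹ d') (by
        refine Quotient.sound ?_
        exact ⟨⟨x, by assumption⟩, rfl⟩)
      rw [← this]
      exact congrArg φ (x.apply_symm_apply d')
  have hfc : ∀ d, fc (N.rot (N.flip d)) = fc d := fun d =>
    Quotient.sound (Equiv.Perm.SameCycle.symm ⟨1, by simp⟩)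
  have hvt : ∀ d, vt (N.rot d) = vt d := fun d =>
    Quotient.sound (Equiv.Perm.SameCycle.symm ⟨1, by simp⟩)
  -- the coboundary
  let δ : (Fc → ZMod 2) →ₗ[ZMod 2] (Fin N.m → ZMod 2) :=
    { toFun := fun ψ a => ψ (fc (N.rot (a, false))) + ψ (fc (a, false))
      map_add' := fun x y => by funext a; simp only [Pi.add_apply]; ring
      map_smul' := fun r x => by funext a; simp [mul_add] }
  -- the boundary and its transpose
  let M : Matrix Vt (Fin N.m) (ZMod 2) := fun v a =>
    (if vt (a, false) = v then 1 else 0) + (if vt (a, true) = v then 1 else 0)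
  have hM : ∀ x v, M.mulVecLin x v = ∑ d : D, if vt d = v then x d.1 else 0 := by
    intro x v
    rw [Matrix.mulVecLin_apply, Matrix.mulVec, dotProduct, Fintype.sum_prod_type]
    refine Finset.sum_congr rfl fun a _ => ?_
    simp only [M, Fintype.sum_bool, add_mul, ite_mul, one_mul, zero_mul]
    rw [add_comm]
  have hMt : ∀ x a, M.transpose.mulVecLin x a = x (vt (a, false)) + x (vt (a, true)) := by
    intro x a
    have e : ∀ v, M.transpose a v = (if vt (a, false) = v then 1 else 0) +
        (if vt (a, true) = v then 1 else 0) := fun _ => rfl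
    rw [Matrix.mulVecLin_apply, Matrix.mulVec, dotProduct]
    simp only [e, add_mul, Finset.sum_add_distrib, ite_mul, one_mul, zero_mul]
    have s : ∀ w : Vt, ∑ y, (if w = y then x y else 0) = x w := fun w => by
      rw [Finset.sum_eq_single w]
      · exact if_pos rfl
      · intro y _ hy
        exact if_neg (Ne.symm hy)
      · intro h
        exact absurd (Finset.mem_univ w) h
    rw [s, s]
  have two : ∀ x y : ZMod 2, x + y = 0 → x = y := by decide
  have two' : ∀ x : ZMod 2, x + x = 0 := by decide
  have kerδ : Module.finrank (ZMod 2) (LinearMap.ker δ) ≤ Nat.card Ω := by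
    refine finrank_le_of_constant ((LinearMap.funLeft (ZMod 2) (ZMod 2) fc).comp
      (LinearMap.ker δ).subtype) ?_ om hom ?_
    · exact (LinearMap.funLeft_injective_of_surjective (ZMod 2) (ZMod 2) fc hfcs).comp Subtype.val_injective
    · rintro ⟨ψ, hψ⟩ d d' h
      have hψ' : ∀ a, ψ (fc (N.rot (a, false))) = ψ (fc (a, false)) := fun a =>
        two _ _ (congrFun hψ a)
      have e1 : ∀ d, ψ (fc (N.rot d)) = ψ (fc d) := by
        rintro ⟨a, b | b⟩
        · exact hψ' a
        · have h1 := hfc (a, false)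
          have h2 := hfc (a, true)
          simp only [flip, Equiv.prodCongr_apply, Prod.map, Equiv.refl_apply, Equiv.boolNot_apply,
            Bool.not_false, Bool.not_true] at h1 h2
          rw [h1, ← h2, hψ' a]
      refine hinv (fun d => ψ (fc d)) e1 (fun d => ?_) d d' h
      rw [← e1 (N.flip d), hfc]
  have kerMt : Module.finrank (ZMod 2) (LinearMap.ker M.transpose.mulVecLin) ≤ Nat.card Ω := by
    refine finrank_le_of_constant ((LinearMap.funLeft (ZMod 2) (ZMod 2) vt).comp
      (LinearMap.ker M.transpose.mulVecLin).subtype) ?_ om hom ?_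
    · exact (LinearMap.funLeft_injective_of_surjective (ZMod 2) (ZMod 2) vt hvts).comp Subtype.val_injective
    · rintro ⟨g, hg⟩ d d' h
      have hg' : ∀ a, g (vt (a, false)) = g (vt (a, true)) := fun a =>
        two _ _ ((hMt g a).symm.trans (congrFun hg a))
      refine hinv (fun d => g (vt d)) (fun d => congrArg g (hvt d)) ?_ d d' h
      rintro ⟨a, b | b⟩
      · exact (hg' a).symm
      · exact hg' a
  have euler : Fintype.card Vt + Fintype.card Fc = N.m + 2 * Nat.card Ω := by
    have := hE.2
    simp only [cycleCount, componentCount] at this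
    rw [← Nat.card_eq_fintype_card, ← Nat.card_eq_fintype_card]
    exact this
  have hsub : LinearMap.range δ ≤ LinearMap.ker M.mulVecLin := by
    rintro _ ⟨ψ, rfl⟩
    rw [LinearMap.mem_ker]
    funext v
    rw [hM]
    have e : ∀ d : D, δ ψ d.1 = ψ (fc (N.rot d)) + ψ (fc d) := by
      rintro ⟨a, b | b⟩
      · rfl
      · have h1 := hfc (a, false)
        have h2 := hfc (a, true)
        simp only [flip, Equiv.prodCongr_apply, Prod.map, Equiv.refl_apply, Equiv.boolNot_apply,
          Bool.not_false, Bool.not_true] at h1 h2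
        change ψ (fc (N.rot (a, false))) + ψ (fc (a, false)) = _
        rw [h1, h2, add_comm]
    simp only [e]
    have e2 : ∑ d : D, (if vt d = v then ψ (fc (N.rot d)) else 0)
        = ∑ d : D, if vt d = v then ψ (fc d) else 0 := by
      rw [← Equiv.sum_comp N.rot (fun d => if vt d = v then ψ (fc d) else 0)]
      simp only [hvt]
      rfl
    have e3 : ∀ d : D, (if vt d = v then ψ (fc (N.rot d)) + ψ (fc d) else 0) =
        (if vt d = v then ψ (fc (N.rot d)) else 0) + if vt d = v then ψ (fc d) else 0 := by
      intro d
      by_cases h : vt d = v <;> simp only [h, if_true, if_false, add_zero]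
    simp only [e3, Finset.sum_add_distrib, e2]
    exact two' _
  have heq : LinearMap.range δ = LinearMap.ker M.mulVecLin := by
    refine Submodule.eq_of_le_of_finrank_le hsub ?_
    have r1 := LinearMap.finrank_range_add_finrank_ker δ
    have r2 := LinearMap.finrank_range_add_finrank_ker M.mulVecLin
    have r3 := LinearMap.finrank_range_add_finrank_ker M.transpose.mulVecLin
    have r4 : Module.finrank (ZMod 2) (LinearMap.range M.transpose.mulVecLin) =
      Module.finrank (ZMod 2) (LinearMap.range M.mulVecLin) := Matrix.rank_transpose M
    simp only [Module.finrank_pi, Fintype.card_fin] at r1 r2 r3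
    omega
  have hmem : c ∈ LinearMap.ker M.mulVecLin := by
    rw [LinearMap.mem_ker]
    funext v
    obtain ⟨d₀, rfl⟩ := hvts v
    rw [hM]
    refine Eq.trans (Finset.sum_congr rfl fun d _ => if_congr ?_ rfl rfl) (hc (N.vert d₀))
    rw [← hE.1 d d₀]
    exact Quotient.eq
  rw [← heq] at hmem
  obtain ⟨ψ, hψ⟩ := hmem
  refine ⟨fun d => ψ (fc d), fun d => ⟨?_, congrArg ψ (hfc d)⟩⟩
  have two'' : ∀ x y z : ZMod 2, x + y = z → x = y + z := by decide
  have hc' : ∀ a, ψ (fc (N.rot (a, false))) + ψ (fc (a, false)) = c a := fun a => congrFun hψ a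
  obtain ⟨a, b | b⟩ := d
  · exact two'' _ _ _ (hc' a)
  · have h1 := hfc (a, false)
    have h2 := hfc (a, true)
    simp only [flip, Equiv.prodCongr_apply, Prod.map, Equiv.refl_apply, Equiv.boolNot_apply,
      Bool.not_false, Bool.not_true] at h1 h2
    change ψ (fc (N.rot (a, true))) = ψ (fc (a, true)) + c a
    rw [h1, ← h2]
    exact two'' _ _ _ (by rw [add_comm]; exact hc' a)

end Network

/-! ### The routing defined by a solution -/

namespace Network

/-- A decomposition of the whole arc set of `G` into paths for the demands: `lab a` is the first arc
of the path that contains the arc `a`, and `nxt a` is the arc that follows `a` on this path if the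
head of `a` is not a terminal. -/
structure Routing (N : Network) where
  lab : Fin N.m → Fin N.m
  nxt : Fin N.m → Fin N.m
  lab_start : ∀ a h, N.src a = N.org h → lab a = a
  src_lab : ∀ a, ∃ h, N.src (lab a) = N.org h
  src_nxt : ∀ x, (∀ h, N.tgt x ≠ N.snk h) → N.src (nxt x) = N.tgt x
  lab_nxt : ∀ x, (∀ h, N.tgt x ≠ N.snk h) → lab (nxt x) = lab x
  exists_nxt : ∀ y, (∀ h, N.src y ≠ N.org h) → ∃ x, nxt x = y ∧ N.tgt x = N.src y
  out_inj : ∀ y y', N.src y = N.src y' → lab y = lab y' → y = y'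
  in_inj : ∀ x x', N.tgt x = N.tgt x' → lab x = lab x' → x = x'
  exists_last : ∀ p h, N.src p = N.org h → ∃ x, lab x = p ∧ N.tgt x = N.snk h
  src_lab_of_tgt : ∀ x h, N.tgt x = N.snk h → N.src (lab x) = N.org h

/-- A linear order of the vertices in which every arc goes forward. -/
def IsTopological (N : Network) (o : Fin N.n → ℕ) : Prop :=
  Function.Injective o ∧ ∀ a, o (N.src a) < o (N.tgt a)

variable {N : Network}

theorem exists_isTopological (hA : N.Acyclic) : ∃ o, N.IsTopological o ∧ ∀ v, o v < N.n * N.n := by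
  classical
  let f : Fin N.n → ℕ := fun v => (Finset.univ.filter fun u => Relation.TransGen N.Adj u v).card
  have hf : ∀ a, f (N.src a) < f (N.tgt a) := by
    intro a
    have hadj : N.Adj (N.src a) (N.tgt a) := ⟨a, rfl, rfl⟩
    refine Finset.card_lt_card ⟨fun u hu => ?_, fun h => ?_⟩
    · simp only [Finset.mem_filter, Finset.mem_univ, true_and] at hu ⊢
      exact hu.tail hadj
    · have := h (show N.src a ∈ _ by simpa using Relation.TransGen.single hadj)
      simp only [Finset.mem_filter, Finset.mem_univ, true_and] at this
      exact hA _ this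
  have hlt : ∀ v, f v < N.n := by
    intro v
    have h1 : f v < Fintype.card (Fin N.n) := by
      refine Finset.card_lt_univ_of_notMem (x := v) ?_
      simpa using hA v
    simpa using h1
  refine ⟨fun v => f v * N.n + v, ⟨fun u v h => ?_, fun a => ?_⟩, fun v => ?_⟩
  · have h' : f u * N.n + u = f v * N.n + v := h
    have h2 : (f u * N.n + u) % N.n = (f v * N.n + v) % N.n := by rw [h']
    rw [Nat.mul_add_mod_of_lt u.2, Nat.mul_add_mod_of_lt v.2] at h2
    exact Fin.ext h2
  · have h1 : (f (N.src a) + 1) * N.n ≤ f (N.tgt a) * N.n := Nat.mul_le_mul_right _ (hf a)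
    have h2 := (N.src a).2
    rw [Nat.add_mul, one_mul] at h1
    change f (N.src a) * N.n + N.src a < f (N.tgt a) * N.n + N.tgt a
    omega
  · have h1 : (f v + 1) * N.n ≤ N.n * N.n := Nat.mul_le_mul_right _ (hlt v)
    have h2 := v.2
    rw [Nat.add_mul, one_mul] at h1
    change f v * N.n + v < _
    omega

section Path

variable {o : Fin N.n → ℕ} {P : List (Fin N.m)}

theorem IsPath.pairwise (ho : N.IsTopological o) (hP : N.IsPath P) :
    P.Pairwise fun a b => o (N.src a) < o (N.src b) ∧ o (N.tgt a) < o (N.tgt b) := by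
  have : P.IsChain fun a b => o (N.src a) < o (N.src b) ∧ o (N.tgt a) < o (N.tgt b) :=
    hP.2.2.imp fun a b hab => by
      have h1 := ho.2 a
      have h2 := ho.2 b
      rw [hab] at h1
      refine ⟨h1, ?_⟩
      rw [hab]; exact h2
  have tr : IsTrans (Fin N.m) fun a b => o (N.src a) < o (N.src b) ∧ o (N.tgt a) < o (N.tgt b) :=
    ⟨fun a b c h h' => ⟨h.1.trans h'.1, h.2.trans h'.2⟩⟩
  exact List.isChain_iff_pairwise.1 this

theorem IsPath.src_inj (ho : N.IsTopological o) (hP : N.IsPath P) {a b : Fin N.m} (ha : a ∈ P)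
    (hb : b ∈ P) (h : N.src a = N.src b) : a = b := by
  by_contra hab
  have : Std.Symm fun a b : Fin N.m => N.src a ≠ N.src b := ⟨fun _ _ h => h.symm⟩
  refine List.Pairwise.forall (R := fun a b : Fin N.m => N.src a ≠ N.src b)
    ((hP.pairwise ho).imp fun {a b} h' he => ?_) ha hb hab h
  rw [he] at h'; exact lt_irrefl _ h'.1

theorem IsPath.tgt_inj (ho : N.IsTopological o) (hP : N.IsPath P) {a b : Fin N.m} (ha : a ∈ P)
    (hb : b ∈ P) (h : N.tgt a = N.tgt b) : a = b := by
  by_contra hab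
  have : Std.Symm fun a b : Fin N.m => N.tgt a ≠ N.tgt b := ⟨fun _ _ h => h.symm⟩
  refine List.Pairwise.forall (R := fun a b : Fin N.m => N.tgt a ≠ N.tgt b)
    ((hP.pairwise ho).imp fun {a b} h' he => ?_) ha hb hab h
  rw [he] at h'; exact lt_irrefl _ h'.2

theorem IsPath.exists_pred (hP : N.IsPath P) {a : Fin N.m} (ha : a ∈ P) :
    P.head? = some a ∨ ∃ x ∈ P, N.tgt x = N.src a := by
  obtain ⟨i, hi, rfl⟩ := List.getElem_of_mem ha
  cases i with
  | zero => left; rw [List.head?_eq_getElem?, List.getElem?_eq_getElem hi]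
  | succ i =>
    exact Or.inr ⟨P[i], List.getElem_mem _, List.isChain_iff_getElem.1 hP.2.2 i hi⟩

theorem IsPath.exists_succ (hP : N.IsPath P) {a : Fin N.m} (ha : a ∈ P) :
    P.getLast? = some a ∨ ∃ y ∈ P, N.src y = N.tgt a := by
  obtain ⟨i, hi, rfl⟩ := List.getElem_of_mem ha
  by_cases h : i + 1 < P.length
  · exact Or.inr ⟨P[i + 1], List.getElem_mem _, (List.isChain_iff_getElem.1 hP.2.2 i h).symm⟩
  · left
    rw [List.getLast?_eq_getElem?, show P.length - 1 = i by omega, List.getElem?_eq_getElem hi]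

theorem Satisfies.exists_head {h : Fin N.k} (hP : N.Satisfies P h) :
    ∃ p, P.head? = some p ∧ p ∈ P ∧ N.src p = N.org h := by
  obtain ⟨p, hp, hs⟩ := hP.2.1
  exact ⟨p, hp, List.mem_of_mem_head? hp, hs⟩

theorem Satisfies.exists_last {h : Fin N.k} (hP : N.Satisfies P h) :
    ∃ p, P.getLast? = some p ∧ p ∈ P ∧ N.tgt p = N.snk h := by
  obtain ⟨p, hp, hs⟩ := hP.2.2
  exact ⟨p, hp, List.mem_of_mem_getLast? hp, hs⟩

end Path

variable {o : Fin N.n → ℕ} {S : Finset (List (Fin N.m))}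

theorem card_out_org (hEu : N.Eulerian) (hN : N.Normalized) (h : Fin N.k) :
    (Finset.univ.filter fun a => N.src a = N.org h).card = N.req h := by
  have hout := hEu (N.org h)
  have hs : ∑ h' ∈ Finset.univ.filter (fun h' => N.snk h' = N.org h), N.req h' = 0 :=
    Finset.sum_eq_zero fun h' hh' => absurd (Finset.mem_filter.1 hh').2.symm (hN.2.2.1 h h')
  have ht : (Finset.univ.filter fun a => N.tgt a = N.org h).card = 0 :=
    Finset.card_eq_zero.2 (Finset.filter_eq_empty_iff.2 fun a _ => hN.2.2.2.1 h a)
  rw [hs, ht, add_zero, zero_add] at hout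
  rw [hout, Finset.sum_eq_single h]
  · intro h' hh' hne
    exact absurd (hN.1 (Finset.mem_filter.1 hh').2) hne
  · intro hh
    exact absurd (Finset.mem_filter.2 ⟨Finset.mem_univ h, (rfl : N.org h = N.org h)⟩) hh

theorem card_out_eq_card_in (hEu : N.Eulerian) {v : Fin N.n} (h1 : ∀ h, v ≠ N.org h)
    (h2 : ∀ h, v ≠ N.snk h) :
    (Finset.univ.filter fun a => N.src a = v).card =
      (Finset.univ.filter fun a => N.tgt a = v).card := by
  have := hEu v
  rwa [Finset.sum_eq_zero, Finset.sum_eq_zero, add_zero, add_zero] at this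
  · intro h hh
    exact absurd (Finset.mem_filter.1 hh).2.symm (h1 h)
  · intro h hh
    exact absurd (Finset.mem_filter.1 hh).2.symm (h2 h)

theorem IsSolution.eq_of_mem (hS : N.IsSolution S) {P Q : List (Fin N.m)} (hP : P ∈ S) (hQ : Q ∈ S)
    {a : Fin N.m} (haP : a ∈ P) (haQ : a ∈ Q) : P = Q := by
  by_contra h
  exact hS.2.1 P hP Q hQ h haP haQ

/-- Every arc that leaves the origin of a demand is the first arc of a path of the solution. -/
theorem IsSolution.exists_path_of_start (hEu : N.Eulerian) (hN : N.Normalized)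
    (hS : N.IsSolution S) {a : Fin N.m} {h : Fin N.k} (ha : N.src a = N.org h) :
    ∃ P ∈ S, N.Satisfies P h ∧ P.head? = some a := by
  classical
  have hfin : {P | P ∈ S ∧ N.Satisfies P h}.Finite := S.finite_toSet.subset fun P hP => hP.1
  set A := hfin.toFinset with hA
  have hcard : A.card = N.req h := by
    rw [← hS.2.2 h, Set.ncard_eq_toFinset_card _ hfin]
  have hmem : ∀ P, P ∈ A ↔ P ∈ S ∧ N.Satisfies P h := fun P => by simp [hA]
  have hhead : ∀ P ∈ A, ∃ p, P.head? = some p ∧ p ∈ P ∧ N.src p = N.org h := fun P hP =>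
    ((hmem P).1 hP).2.exists_head
  have : Nonempty (Fin N.m) := ⟨a⟩
  choose! f hf using hhead
  have hinj : Set.InjOn f A := by
    intro P hP Q hQ hPQ
    refine hS.eq_of_mem ((hmem P).1 hP).1 ((hmem Q).1 hQ).1 (hf P hP).2.1 ?_
    rw [hPQ]
    exact (hf Q hQ).2.1
  have himg : A.image f = Finset.univ.filter fun a => N.src a = N.org h := by
    refine Finset.eq_of_subset_of_card_le ?_ ?_
    · intro b hb
      obtain ⟨P, hP, rfl⟩ := Finset.mem_image.1 hb
      exact Finset.mem_filter.2 ⟨Finset.mem_univ _, (hf P hP).2.2⟩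
    · rw [card_out_org hEu hN, Finset.card_image_of_injOn hinj, hcard]
  have : a ∈ A.image f := by
    rw [himg]
    exact Finset.mem_filter.2 ⟨Finset.mem_univ _, ha⟩
  obtain ⟨P, hP, rfl⟩ := Finset.mem_image.1 this
  exact ⟨P, ((hmem P).1 hP).1, ((hmem P).1 hP).2, (hf P hP).1⟩

/-- In a path of a solution, an arc whose head is not a terminal is followed by an arc. -/
theorem IsSolution.exists_succ (hS : N.IsSolution S) {P : List (Fin N.m)} (hP : P ∈ S) {x : Fin N.m}
    (hx : x ∈ P) (hxs : ∀ h, N.tgt x ≠ N.snk h) : ∃ y ∈ P, N.src y = N.tgt x := by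
  obtain ⟨h, hPh⟩ := hS.1 P hP
  refine (hPh.1.exists_succ hx).resolve_left fun hl => ?_
  obtain ⟨p, hp, -, hs⟩ := hPh.exists_last
  rw [hl] at hp
  cases hp
  exact hxs h hs

theorem IsSolution.exists_pred (hS : N.IsSolution S) {P : List (Fin N.m)} (hP : P ∈ S) {y : Fin N.m}
    (hy : y ∈ P) (hys : ∀ h, N.src y ≠ N.org h) : ∃ x ∈ P, N.tgt x = N.src y := by
  obtain ⟨h, hPh⟩ := hS.1 P hP
  refine (hPh.1.exists_pred hy).resolve_left fun hl => ?_
  obtain ⟨p, hp, -, hs⟩ := hPh.exists_head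
  rw [hl] at hp
  cases hp
  exact hys h hs

/-- The paths of a solution use all the arcs: at every vertex that is not a terminal, as many arcs
leave as enter, and if all the entering ones are used then so are all the leaving ones. -/
theorem IsSolution.exists_path_of_arc (ho : N.IsTopological o) (hEu : N.Eulerian)
    (hN : N.Normalized) (hS : N.IsSolution S) (a : Fin N.m) : ∃ P ∈ S, a ∈ P := by
  classical
  induction hn : o (N.src a) using Nat.strong_induction_on generalizing a with
  | _ n ih =>
  by_cases hst : ∃ h, N.src a = N.org h
  · obtain ⟨h, hh⟩ := hst
    obtain ⟨P, hP, -, hPa⟩ := hS.exists_path_of_start hEu hN hh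
    exact ⟨P, hP, List.mem_of_mem_head? hPa⟩
  push Not at hst
  have hsnk : ∀ h, N.src a ≠ N.snk h := fun h => hN.2.2.2.2 h a
  have hcard := card_out_eq_card_in hEu hst hsnk
  have hcov : ∀ x, N.tgt x = N.src a → ∃ y, N.src y = N.src a ∧ ∃ P ∈ S, x ∈ P ∧ y ∈ P := by
    intro x hx
    have hlt : o (N.src x) < n := by rw [← hn, ← hx]; exact ho.2 x
    obtain ⟨P, hP, hxP⟩ := ih _ hlt x rfl
    obtain ⟨y, hy, hyx⟩ := hS.exists_succ hP hxP (by rw [hx]; exact hsnk)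
    exact ⟨y, hyx.trans hx, P, hP, hxP, hy⟩
  choose! f hf using hcov
  have hinj : Set.InjOn f ↑(Finset.univ.filter fun x => N.tgt x = N.src a) := by
    intro x hx x' hx' hff
    simp only [Finset.coe_filter, Finset.mem_univ, true_and, Set.mem_ofPred_eq] at hx hx'
    obtain ⟨-, P, hP, h1, h2⟩ := hf x hx
    obtain ⟨-, P', hP', h1', h2'⟩ := hf x' hx'
    rw [hff] at h2
    obtain rfl := hS.eq_of_mem hP hP' h2 h2'
    obtain ⟨h, hPh⟩ := hS.1 P hP
    exact hPh.1.tgt_inj ho h1 h1' (hx.trans hx'.symm)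
  have himg : (Finset.univ.filter fun x => N.tgt x = N.src a).image f =
      Finset.univ.filter fun y => N.src y = N.src a := by
    refine Finset.eq_of_subset_of_card_le ?_ ?_
    · intro b hb
      obtain ⟨x, hx, rfl⟩ := Finset.mem_image.1 hb
      exact Finset.mem_filter.2 ⟨Finset.mem_univ _, (hf x (Finset.mem_filter.1 hx).2).1⟩
    · rw [Finset.card_image_of_injOn hinj, hcard]
  have : a ∈ (Finset.univ.filter fun x => N.tgt x = N.src a).image f := by
    rw [himg]
    exact Finset.mem_filter.2 ⟨Finset.mem_univ _, rfl⟩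
  obtain ⟨x, hx, rfl⟩ := Finset.mem_image.1 this
  obtain ⟨-, P, hP, -, h⟩ := hf x (Finset.mem_filter.1 hx).2
  exact ⟨P, hP, h⟩

/-- Every solution comes from a routing. -/
theorem IsSolution.exists_routing (ho : N.IsTopological o) (hEu : N.Eulerian)
    (hN : N.Normalized) (hS : N.IsSolution S) :
    ∃ r : N.Routing, ∀ P ∈ S, ∃ p, P.head? = some p ∧ (∃ h, N.src p = N.org h ∧
      N.Satisfies P h) ∧ ∀ a, a ∈ P ↔ r.lab a = p := by
  classical
  choose pth hpth using hS.exists_path_of_arc ho hEu hN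
  have huniq : ∀ P ∈ S, ∀ a ∈ P, pth a = P := fun P hP a ha =>
    hS.eq_of_mem (hpth a).1 hP (hpth a).2 ha
  have hlab : ∀ a, ∃ p, (pth a).head? = some p ∧ p ∈ pth a ∧ ∃ h, N.src p = N.org h ∧
      N.Satisfies (pth a) h := by
    intro a
    obtain ⟨h, hh⟩ := hS.1 _ (hpth a).1
    obtain ⟨p, h1, h2, h3⟩ := hh.exists_head
    exact ⟨p, h1, h2, h, h3, hh⟩
  choose lab hlab using hlab
  have hnxt : ∀ x, ∃ y, (∀ h, N.tgt x ≠ N.snk h) → y ∈ pth x ∧ N.src y = N.tgt x := by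
    intro x
    by_cases hx : ∀ h, N.tgt x ≠ N.snk h
    · obtain ⟨y, hy⟩ := hS.exists_succ (hpth x).1 (hpth x).2 hx
      exact ⟨y, fun _ => hy⟩
    · exact ⟨x, fun h => absurd h hx⟩
  choose nxt hnxt using hnxt
  have hlabmem : ∀ P ∈ S, ∀ a ∈ P, P.head? = some (lab a) := by
    intro P hP a ha
    rw [← huniq P hP a ha]
    exact (hlab a).1
  have hpath : ∀ a, N.IsPath (pth a) := fun a => by
    obtain ⟨-, -, h, -, hh⟩ := hlab a
    exact hh.1
  have hsame : ∀ a b, lab a = lab b → pth a = pth b := by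
    intro a b hab
    refine hS.eq_of_mem (hpth a).1 (hpth b).1 (hlab a).2.1 ?_
    rw [hab]
    exact (hlab b).2.1
  have hpthlab : ∀ a b, b ∈ pth a → lab b = lab a := by
    intro a b hb
    have h1 := hlabmem _ (hpth a).1 b hb
    rw [(hlab a).1] at h1
    exact (Option.some.inj h1).symm
  refine ⟨{ lab := lab, nxt := nxt, lab_start := ?_, src_lab := ?_, src_nxt := ?_, lab_nxt := ?_,
            exists_nxt := ?_, out_inj := ?_, in_inj := ?_, exists_last := ?_,
            src_lab_of_tgt := ?_ }, ?_⟩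
  · intro a h ha
    obtain ⟨P, hP, -, hPa⟩ := hS.exists_path_of_start hEu hN ha
    have := hlabmem P hP a (List.mem_of_mem_head? hPa)
    rw [hPa] at this
    exact (Option.some.inj this).symm
  · intro a
    obtain ⟨-, -, h, hh, -⟩ := hlab a
    exact ⟨h, hh⟩
  · exact fun x hx => (hnxt x hx).2
  · exact fun x hx => hpthlab x _ (hnxt x hx).1
  · intro y hy
    obtain ⟨x, hx, hxy⟩ := hS.exists_pred (hpth y).1 (hpth y).2 hy
    have hx' : ∀ h, N.tgt x ≠ N.snk h := fun h => by rw [hxy]; exact hN.2.2.2.2 h y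
    refine ⟨x, ?_, hxy⟩
    have h1 := hnxt x hx'
    rw [huniq _ (hpth y).1 x hx] at h1
    exact (hpath y).src_inj ho h1.1 (hpth y).2 (h1.2.trans hxy)
  · intro y y' hyy hl
    have := hsame y y' hl
    exact (hpath y).src_inj ho (hpth y).2 (this ▸ (hpth y').2) hyy
  · intro y y' hyy hl
    have := hsame y y' hl
    exact (hpath y).tgt_inj ho (hpth y).2 (this ▸ (hpth y').2) hyy
  · intro p h hp
    obtain ⟨P, hP, hPh, hPp⟩ := hS.exists_path_of_start hEu hN hp
    obtain ⟨x, h1, h2, h3⟩ := hPh.exists_last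
    refine ⟨x, ?_, h3⟩
    have := hlabmem P hP x h2
    rw [hPp] at this
    exact (Option.some.inj this).symm
  · intro x h hx
    obtain ⟨h1, h2, h', h3, h4⟩ := hlab x
    obtain ⟨z, g1, g2, g3⟩ := h4.exists_last
    rcases (hpath x).exists_succ (hpth x).2 with hl | ⟨y, -, hy⟩
    · rw [hl] at g1
      cases g1
      rw [h3, hN.2.1 (hx.symm.trans g3)]
    · exact absurd (hy.trans hx) (hN.2.2.2.2 h y)
  · intro P hP
    obtain ⟨h, hPh⟩ := hS.1 P hP
    obtain ⟨p, h1, h2, h3⟩ := hPh.exists_head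
    refine ⟨p, h1, ⟨h, h3, hPh⟩, fun a => ⟨fun ha => ?_, ?_⟩⟩
    · have := hlabmem P hP a ha
      rw [h1] at this
      exact (Option.some.inj this).symm
    · rintro rfl
      have := hS.eq_of_mem hP (hpth a).1 h2 (hlab a).2.1
      rw [this]
      exact (hpth a).2

end Network

/-! ### Intervals of darts at a vertex -/

section CyclicDistance

variable {D : Type} [Finite D] {σ : Equiv.Perm D} {a b c d x : D}

theorem cdist_pow_of_le (h : σ.SameCycle a b) {s : ℕ} (hs : s ≤ cdist σ a b) :
    cdist σ a ((σ ^ s) a) = s := by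
  refine le_antisymm (cdist_le rfl) ?_
  by_contra hlt
  have h1 : (σ ^ cdist σ a ((σ ^ s) a)) a = (σ ^ s) a := pow_cdist ⟨s, by simp⟩
  have h2 : (σ ^ (cdist σ a b - s + cdist σ a ((σ ^ s) a))) a = b := by
    rw [pow_add, Equiv.Perm.mul_apply, h1, ← Equiv.Perm.mul_apply, ← pow_add,
      Nat.sub_add_cancel hs, pow_cdist h]
  have := cdist_le h2
  omega

theorem cdist_inj (h : σ.SameCycle a b) (h' : σ.SameCycle a c) (he : cdist σ a b = cdist σ a c) :
    b = c := by
  rw [← pow_cdist h, ← pow_cdist h', he]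

end CyclicDistance

namespace Network

variable {N : Network}

/-- The darts met when turning from `d` to `e`, without `e`. -/
noncomputable def seg (N : Network) (d e : Fin N.m × Bool) : Finset (Fin N.m × Bool) := by
  classical
  exact Finset.univ.filter fun f => N.vert f = N.vert d ∧ cdist N.rot d f < cdist N.rot d e

theorem mem_seg {d e f : Fin N.m × Bool} :
    f ∈ N.seg d e ↔ N.vert f = N.vert d ∧ cdist N.rot d f < cdist N.rot d e := by
  classical
  simp [seg]

variable (hE : N.SphereEmbedding)
include hE

theorem SphereEmbedding.sameCycle {d e : Fin N.m × Bool} (h : N.vert d = N.vert e) :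
    N.rot.SameCycle d e := (hE.1 d e).2 h

theorem SphereEmbedding.sum_seg {M : Type} [AddCommMonoid M] {d e : Fin N.m × Bool}
    (h : N.vert d = N.vert e) (g : Fin N.m × Bool → M) :
    ∑ f ∈ N.seg d e, g f = ∑ s ∈ Finset.range (cdist N.rot d e), g ((N.rot ^ s) d) := by
  symm
  have hs := hE.sameCycle h
  refine Finset.sum_bij (fun s _ => (N.rot ^ s) d) ?_ ?_ ?_ ?_
  · intro s hs'
    rw [Finset.mem_range] at hs'
    rw [mem_seg, cdist_pow_of_le hs hs'.le]
    exact ⟨((hE.1 _ _).1 ⟨s, by simp⟩).symm, hs'⟩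
  · intro s h1 t h2 hst
    rw [Finset.mem_range] at h1 h2
    rw [← cdist_pow_of_le hs h1.le, ← cdist_pow_of_le hs h2.le]
    exact congrArg _ hst
  · intro f hf
    rw [mem_seg] at hf
    exact ⟨_, Finset.mem_range.2 hf.2, pow_cdist (hE.sameCycle hf.1.symm)⟩
  · intro s _
    rfl

theorem SphereEmbedding.card_seg {d e : Fin N.m × Bool} (h : N.vert d = N.vert e) :
    (N.seg d e).card = cdist N.rot d e := by
  rw [Finset.card_eq_sum_ones, hE.sum_seg h, Finset.sum_const, Finset.card_range, smul_eq_mul,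
    mul_one]

omit hE in
theorem potential_pow {c : Fin N.m → ZMod 2} {ψ : Fin N.m × Bool → ZMod 2}
    (hψ : ∀ d, ψ (N.rot d) = ψ d + c d.1) (d : Fin N.m × Bool) (t : ℕ) :
    ψ ((N.rot ^ t) d) = ψ d + ∑ s ∈ Finset.range t, c ((N.rot ^ s) d).1 := by
  induction t with
  | zero => simp
  | succ t ih => rw [pow_succ', Equiv.Perm.mul_apply, hψ, ih, Finset.sum_range_succ, add_assoc]

/-- The variation of a potential around a vertex. -/
theorem SphereEmbedding.potential_eq {c : Fin N.m → ZMod 2} {ψ : Fin N.m × Bool → ZMod 2}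
    (hψ : ∀ d, ψ (N.rot d) = ψ d + c d.1) {d e : Fin N.m × Bool} (h : N.vert d = N.vert e) :
    ψ e = ψ d + ∑ f ∈ N.seg d e, c f.1 := by
  rw [hE.sum_seg h (fun f => c f.1), ← potential_pow hψ, pow_cdist (hE.sameCycle h)]

omit hE

theorem vert_true (x : Fin N.m) : N.vert (x, true) = N.tgt x := rfl

theorem vert_false (x : Fin N.m) : N.vert (x, false) = N.src x := rfl

namespace Routing

variable (r : N.Routing)

theorem nxt_inj {x x' : Fin N.m} (h : ∀ h, N.tgt x ≠ N.snk h) (hx : N.tgt x = N.tgt x')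
    (he : r.nxt x = r.nxt x') : x = x' := by
  refine r.in_inj x x' hx ?_
  rw [← r.lab_nxt x h, he, r.lab_nxt x' (hx ▸ h)]

/-- At an inner vertex, the darts are paired by the routing. -/
theorem sum_star {M : Type} [AddCommMonoid M] {v : Fin N.n}
    (h1 : ∀ h, v ≠ N.org h) (h2 : ∀ h, v ≠ N.snk h) (g : Fin N.m × Bool → M) :
    ∑ d with N.vert d = v, g d = ∑ x with N.tgt x = v, (g (x, true) + g (r.nxt x, false)) := by
  rw [Finset.sum_filter, Fintype.sum_prod_type]
  have e : ∀ x : Fin N.m, ∑ b, (if N.vert (x, b) = v then g (x, b) else 0) =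
      (if N.tgt x = v then g (x, true) else 0) + if N.src x = v then g (x, false) else 0 := by
    intro x
    rw [Fintype.sum_bool]
    rfl
  rw [Finset.sum_congr rfl fun x _ => e x, Finset.sum_add_distrib, Finset.sum_add_distrib,
    ← Finset.sum_filter, ← Finset.sum_filter]
  congr 1
  symm
  refine Finset.sum_bij (fun x _ => r.nxt x) ?_ ?_ ?_ ?_
  · intro x hx
    rw [Finset.mem_filter] at hx ⊢
    exact ⟨Finset.mem_univ _, (r.src_nxt x (hx.2.symm ▸ h2)).trans hx.2⟩
  · intro x hx x' hx' he
    rw [Finset.mem_filter] at hx hx'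
    exact r.nxt_inj (hx.2.symm ▸ h2) (hx.2.trans hx'.2.symm) he
  · intro y hy
    rw [Finset.mem_filter] at hy
    obtain ⟨x, hx, hxy⟩ := r.exists_nxt y (hy.2.symm ▸ h1)
    exact ⟨x, Finset.mem_filter.2 ⟨Finset.mem_univ _, hxy.trans hy.2⟩, hx⟩
  · intro x _
    rfl

/-- When turning anticlockwise from the arc `x`, the dart `d` is met before the arc that follows `x`
on its path. -/
def Inside (x : Fin N.m) (d : Fin N.m × Bool) : Prop :=
  cdist N.rot (x, true) d < cdist N.rot (x, true) (r.nxt x, false)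

/-- The path of `x` crosses the one of `y` at the common head of `x` and `y`. -/
def Cross (x y : Fin N.m) : Prop := r.Inside x (y, true) ↔ ¬ r.Inside x (r.nxt y, false)

/-- The path of `x` goes to the left of the one of `y` at the common head of `x` and `y`. -/
def Left (x y : Fin N.m) : Prop := r.Inside x (y, true) ∧ r.Inside x (r.nxt y, false)

/-- Two arcs with the same head, which is not the end of a path. -/
def Meet (x y : Fin N.m) : Prop := N.tgt x = N.tgt y ∧ ∀ h, N.tgt x ≠ N.snk h

variable {r}

theorem Meet.symm {x y : Fin N.m} (h : Meet x y) : Meet y x :=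
  ⟨h.1.symm, h.1 ▸ h.2⟩

variable (r)

/-- The distances from an arc `x` to the other darts at its head: distinct darts have distinct
distances, and distances from other darts can be computed from these ones. -/
theorem exists_distances (hE : N.SphereEmbedding) (x : Fin N.m) : ∃ L,
    (∀ d, N.vert d = N.tgt x → cdist N.rot (x, true) d < L) ∧
    (∀ d e, N.vert d = N.tgt x → N.vert e = N.tgt x → d ≠ e →
      cdist N.rot (x, true) d ≠ cdist N.rot (x, true) e) ∧
    (cdist N.rot (x, true) (x, true) = 0) ∧
    ∀ d e, N.vert d = N.tgt x → N.vert e = N.tgt x →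
      cdist N.rot d e = if cdist N.rot (x, true) d ≤ cdist N.rot (x, true) e
        then cdist N.rot (x, true) e - cdist N.rot (x, true) d
        else L + cdist N.rot (x, true) e - cdist N.rot (x, true) d := by
  obtain ⟨L, h1, h2, h3⟩ := exists_cdist_rebase N.rot (x, true)
  have hs : ∀ d, N.vert d = N.tgt x → N.rot.SameCycle (x, true) d := fun d hd =>
    hE.sameCycle hd.symm
  exact ⟨L, fun d hd => h1 d (hs d hd), fun d e hd he hne => mt (h2 d e (hs d hd) (hs e he)) hne,
    cdist_self, fun d e hd he => h3 d e (hs d hd) (hs e he)⟩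

theorem cross_comm (hE : N.SphereEmbedding) {x y : Fin N.m} (h : Meet x y) (hxy : x ≠ y) :
    r.Cross x y ↔ r.Cross y x := by
  obtain ⟨L, hlt, hinj, h0, hd⟩ := exists_distances hE x
  have vx := r.src_nxt x h.2
  have vy := (r.src_nxt y h.symm.2).trans h.1.symm
  have hM := mt (r.nxt_inj h.2 h.1) hxy
  have e1 := hinj (x, true) (y, true) rfl h.1.symm (by simpa using hxy)
  have e2 := hinj (x, true) (r.nxt x, false) rfl vx (by simp)
  have e3 := hinj (x, true) (r.nxt y, false) rfl vy (by simp)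
  have e4 := hinj (y, true) (r.nxt x, false) h.1.symm vx (by simp)
  have e5 := hinj (y, true) (r.nxt y, false) h.1.symm vy (by simp)
  have e6 := hinj (r.nxt x, false) (r.nxt y, false) vx vy (by simpa using hM)
  have l1 := hlt (y, true) h.1.symm
  have l2 := hlt (r.nxt x, false) vx
  have l3 := hlt (r.nxt y, false) vy
  rw [h0] at e1 e2 e3
  unfold Cross Inside
  rw [hd (y, true) (x, true) h.1.symm rfl, hd (y, true) (r.nxt x, false) h.1.symm vx,
    hd (y, true) (r.nxt y, false) h.1.symm vy, h0]
  generalize cdist N.rot (x, true) (y, true) = α at *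
  generalize cdist N.rot (x, true) (r.nxt x, false) = β at *
  generalize cdist N.rot (x, true) (r.nxt y, false) = γ at *
  split_ifs <;> omega

/-- If two paths cross at a vertex and a third one crosses neither of them there, then it does not
separate one from the other. -/
theorem lt_iff_of_cross (hE : N.SphereEmbedding) {x y w : Fin N.m} (h : Meet x y) (h' : Meet x w)
    (hxy : x ≠ y) (hxw : x ≠ w) (hyw : y ≠ w) (hc : r.Cross x y) (h1 : ¬ r.Cross x w)
    (h2 : ¬ r.Cross y w) :
    cdist N.rot (x, true) (w, true) < cdist N.rot (x, true) (y, true) ↔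
      cdist N.rot (x, true) (r.nxt w, false) < cdist N.rot (x, true) (y, true) := by
  obtain ⟨L, hlt, hinj, h0, hd⟩ := exists_distances hE x
  have vx := r.src_nxt x h.2
  have vy := (r.src_nxt y h.symm.2).trans h.1.symm
  have vw := (r.src_nxt w h'.symm.2).trans h'.1.symm
  have hM := mt (r.nxt_inj h.2 h.1) hxy
  have hM' := mt (r.nxt_inj h.2 h'.1) hxw
  have hM'' := mt (r.nxt_inj h.symm.2 (h.1.symm.trans h'.1)) hyw
  have e1 := hinj (x, true) (y, true) rfl h.1.symm (by simpa using hxy)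
  have e2 := hinj (x, true) (r.nxt x, false) rfl vx (by simp)
  have e3 := hinj (x, true) (r.nxt y, false) rfl vy (by simp)
  have e4 := hinj (y, true) (r.nxt x, false) h.1.symm vx (by simp)
  have e5 := hinj (y, true) (r.nxt y, false) h.1.symm vy (by simp)
  have e6 := hinj (r.nxt x, false) (r.nxt y, false) vx vy (by simpa using hM)
  have f1 := hinj (x, true) (w, true) rfl h'.1.symm (by simpa using hxw)
  have f2 := hinj (x, true) (r.nxt w, false) rfl vw (by simp)
  have f3 := hinj (w, true) (r.nxt x, false) h'.1.symm vx (by simp)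
  have f4 := hinj (w, true) (r.nxt w, false) h'.1.symm vw (by simp)
  have f5 := hinj (r.nxt x, false) (r.nxt w, false) vx vw (by simpa using hM')
  have g1 := hinj (y, true) (w, true) h.1.symm h'.1.symm (by simpa using hyw)
  have g2 := hinj (y, true) (r.nxt w, false) h.1.symm vw (by simp)
  have g3 := hinj (w, true) (r.nxt y, false) h'.1.symm vy (by simp)
  have g4 := hinj (r.nxt y, false) (r.nxt w, false) vy vw (by simpa using hM'')
  have l1 := hlt (y, true) h.1.symm
  have l2 := hlt (r.nxt x, false) vx
  have l3 := hlt (r.nxt y, false) vy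
  have l4 := hlt (w, true) h'.1.symm
  have l5 := hlt (r.nxt w, false) vw
  rw [h0] at e1 e2 e3 f1 f2
  unfold Cross Inside at hc h1 h2
  rw [hd (y, true) (w, true) h.1.symm h'.1.symm, hd (y, true) (r.nxt w, false) h.1.symm vw,
    hd (y, true) (r.nxt y, false) h.1.symm vy] at h2
  generalize cdist N.rot (x, true) (y, true) = α at *
  generalize cdist N.rot (x, true) (r.nxt x, false) = β at *
  generalize cdist N.rot (x, true) (r.nxt y, false) = γ at *
  generalize cdist N.rot (x, true) (w, true) = α' at *
  generalize cdist N.rot (x, true) (r.nxt w, false) = γ' at *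
  clear hd hlt hinj
  split_ifs at h2 <;> omega

open Classical in
/-- The number of darts between an arc and the following one on its path is determined by the
behaviour of the path with respect to the other ones at the vertex. -/
theorem cdist_nxt (hE : N.SphereEmbedding) (hN : N.Normalized) {x : Fin N.m}
    (hx : ∀ h, N.tgt x ≠ N.snk h) :
    cdist N.rot (x, true) (r.nxt x, false) =
      1 + 2 * (Finset.univ.filter fun y => N.tgt y = N.tgt x ∧ y ≠ x ∧ ¬ r.Cross x y ∧
        r.Left x y).card
      + (Finset.univ.filter fun y => N.tgt y = N.tgt x ∧ y ≠ x ∧ r.Cross x y).card := by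
  have hv : N.vert (x, true) = N.vert (r.nxt x, false) := (r.src_nxt x hx).symm
  have h0 : cdist N.rot (x, true) (x, true) = 0 := cdist_self
  have hpos : 0 < cdist N.rot (x, true) (r.nxt x, false) := by
    obtain ⟨L, hlt, hinj, h0, hd⟩ := exists_distances hE x
    have := hinj (x, true) (r.nxt x, false) rfl hv.symm (by simp)
    omega
  rw [← hE.card_seg hv]
  have hseg : N.seg (x, true) (r.nxt x, false) =
      (Finset.univ.filter fun d => N.vert d = N.tgt x).filter (fun d => r.Inside x d) := by
    ext f
    rw [mem_seg, Finset.mem_filter, Finset.mem_filter, vert_true]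
    simp [Inside]
  rw [hseg, Finset.card_filter, r.sum_star (fun h => hN.2.2.2.1 h x) hx,
    Finset.sum_filter, Finset.card_filter, Finset.card_filter, ← Finset.add_sum_erase _ _
      (Finset.mem_univ x), if_pos rfl, if_pos (show r.Inside x (x, true) by
        unfold Inside; omega), if_neg (show ¬ r.Inside x (r.nxt x, false) from lt_irrefl _),
    ← Finset.add_sum_erase _ (fun y => if N.tgt y = N.tgt x ∧ y ≠ x ∧ ¬ r.Cross x y ∧ r.Left x y
      then 1 else 0) (Finset.mem_univ x), if_neg (by simp),
    ← Finset.add_sum_erase _ (fun y => if N.tgt y = N.tgt x ∧ y ≠ x ∧ r.Cross x y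
      then 1 else 0) (Finset.mem_univ x), if_neg (by simp), zero_add, zero_add, add_zero,
    Finset.mul_sum, add_assoc, ← Finset.sum_add_distrib]
  congr 1
  refine Finset.sum_congr rfl fun y hy => ?_
  have hy' := Finset.ne_of_mem_erase hy
  unfold Left Cross
  by_cases h1 : N.tgt y = N.tgt x <;> by_cases h2 : r.Inside x (y, true) <;>
    by_cases h3 : r.Inside x (r.nxt y, false) <;> simp [h1, h2, h3, hy']

/-- An induction along a path. -/
theorem path_induction {o : Fin N.n → ℕ} (ho : N.IsTopological o) {p : Fin N.m}
    {C : Fin N.m → Prop} (h0 : C p)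
    (hs : ∀ y, r.lab y = p → (∀ h, N.tgt y ≠ N.snk h) → C y → C (r.nxt y))
    (hsrc : ∀ h a, N.src a ≠ N.snk h) (y : Fin N.m) (hy : r.lab y = p) : C y := by
  induction hn : o (N.src y) using Nat.strong_induction_on generalizing y with
  | _ n ih =>
  by_cases hst : ∃ h, N.src y = N.org h
  · obtain ⟨h, hh⟩ := hst
    rw [r.lab_start y h hh] at hy
    rwa [hy]
  · push Not at hst
    obtain ⟨x, rfl, hxy⟩ := r.exists_nxt y hst
    have hx : ∀ h, N.tgt x ≠ N.snk h := fun h => hxy ▸ hsrc h _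
    rw [r.lab_nxt x hx] at hy
    refine hs x hy hx (ih _ ?_ x hy rfl)
    rw [← hn, ← hxy]
    exact ho.2 x

end Routing

end Network

/-! ### Parities of crossings -/

namespace Network

variable {N : Network}

namespace Routing

variable (r : N.Routing)

/-- The paths with the first arcs `p` and `q` cross. -/
def Crosses (p q : Fin N.m) : Prop :=
  ∃ x y, r.lab x = p ∧ r.lab y = q ∧ Meet x y ∧ r.Cross x y

/-- Paths of the same demand do not cross, and two paths cross at their first common vertex only. -/
structure IsUncrossed (o : Fin N.n → ℕ) : Prop where
  same : ∀ x y, Meet x y → x ≠ y → N.src (r.lab x) = N.src (r.lab y) → ¬ r.Cross x y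
  first : ∀ x y x' y', Meet x y → x ≠ y → r.Cross x y → r.lab x' = r.lab x → r.lab y' = r.lab y →
    N.tgt x' = N.tgt y' → o (N.tgt x) ≤ o (N.tgt x')

/-- The sum modulo 2 of two paths, as a function on the arcs. -/
def pairSum (p p' a : Fin N.m) : ZMod 2 :=
  (if r.lab a = p then 1 else 0) + (if r.lab a = p' then 1 else 0)

variable {r} {o : Fin N.n → ℕ} {h h' : Fin N.k} {p p' q q' : Fin N.m}

theorem crosses_comm (hE : N.SphereEmbedding) (hpq : p ≠ q) : r.Crosses p q ↔ r.Crosses q p := by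
  constructor
  · rintro ⟨x, y, rfl, rfl, hm, hc⟩
    exact ⟨y, x, rfl, rfl, hm.symm, (r.cross_comm hE hm (ne_of_apply_ne _ hpq)).1 hc⟩
  · rintro ⟨x, y, rfl, rfl, hm, hc⟩
    exact ⟨y, x, rfl, rfl, hm.symm, (r.cross_comm hE hm (ne_of_apply_ne _ hpq.symm)).1 hc⟩

theorem pairSum_nxt {x : Fin N.m} (hx : ∀ h, N.tgt x ≠ N.snk h) :
    r.pairSum p p' (r.nxt x) = r.pairSum p p' x := by
  rw [pairSum, pairSum, r.lab_nxt x hx]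

/-- Two paths of the same demand form a circulation. -/
theorem pairSum_circulation (hN : N.Normalized) (hp : N.src p = N.org h) (hp' : N.src p' = N.org h)
    (v : Fin N.n) :
    ∑ d : Fin N.m × Bool, (if N.vert d = v then r.pairSum p p' d.1 else 0) = 0 := by
  have two : ∀ x : ZMod 2, x + x = 0 := by decide
  by_cases h1 : ∃ j, v = N.org j
  · obtain ⟨j, rfl⟩ := h1
    have key : ∀ p, N.src p = N.org h → ∑ d : Fin N.m × Bool, (if N.vert d = N.org j then
        (if r.lab d.1 = p then (1 : ZMod 2) else 0) else 0) = if h = j then 1 else 0 := by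
      intro p hp
      have e : ∀ d : Fin N.m × Bool, (if N.vert d = N.org j then
          (if r.lab d.1 = p then (1 : ZMod 2) else 0) else 0) =
          if d = (p, false) then (if h = j then 1 else 0) else 0 := by
        rintro ⟨a, b | b⟩
        · change (if N.src a = N.org j then (if r.lab a = p then (1 : ZMod 2) else 0) else 0) = _
          by_cases ha : N.src a = N.org j
          · rw [if_pos ha, r.lab_start a j ha]
            by_cases hap : a = p
            · rw [if_pos hap, if_pos (by rw [hap]), if_pos (hN.1 (by rw [← hp, ← ha, hap]))]
            · rw [if_neg hap, if_neg (by simpa using hap)]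
          · rw [if_neg ha]
            by_cases hap : a = p
            · rw [if_pos (by rw [hap]), if_neg]
              rintro rfl
              exact ha (hap ▸ hp)
            · rw [if_neg (by simpa using hap)]
        · rw [if_neg (show N.vert (a, true) ≠ N.org j from hN.2.2.2.1 j a), if_neg (by simp)]
      rw [Finset.sum_congr rfl fun d _ => e d, Finset.sum_ite_eq' Finset.univ (p, false),
        if_pos (Finset.mem_univ _)]
    unfold pairSum
    have e : ∀ d : Fin N.m × Bool, ∀ x y : ZMod 2, (if N.vert d = N.org j then x + y else 0) =
        (if N.vert d = N.org j then x else 0) + if N.vert d = N.org j then y else 0 := by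
      intro d x y
      split_ifs <;> simp
    simp only [e]
    rw [Finset.sum_add_distrib, key p hp, key p' hp', two]
  by_cases h2 : ∃ j, v = N.snk j
  · obtain ⟨j, rfl⟩ := h2
    have key : ∀ p, N.src p = N.org h → ∑ d : Fin N.m × Bool, (if N.vert d = N.snk j then
        (if r.lab d.1 = p then (1 : ZMod 2) else 0) else 0) = if h = j then 1 else 0 := by
      intro p hp
      obtain ⟨z, hz, hzt⟩ := r.exists_last p h hp
      have e : ∀ d : Fin N.m × Bool, (if N.vert d = N.snk j then
          (if r.lab d.1 = p then (1 : ZMod 2) else 0) else 0) =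
          if d = (z, true) then (if h = j then 1 else 0) else 0 := by
        rintro ⟨a, b | b⟩
        · rw [if_neg (show N.vert (a, false) ≠ N.snk j from hN.2.2.2.2 j a), if_neg (by simp)]
        · change (if N.tgt a = N.snk j then (if r.lab a = p then (1 : ZMod 2) else 0) else 0) = _
          by_cases ha : N.tgt a = N.snk j
          · rw [if_pos ha]
            by_cases hap : r.lab a = p
            · have hj : h = j := hN.1 (by rw [← hp, ← hap, r.src_lab_of_tgt a j ha])
              have haz : a = z := r.in_inj a z (by rw [ha, hzt, hj]) (hap.trans hz.symm)
              rw [if_pos hap, if_pos (by rw [haz]), if_pos hj]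
            · rw [if_neg hap, if_neg]
              rintro he
              rw [Prod.mk.injEq] at he
              exact hap (he.1 ▸ hz)
          · rw [if_neg ha]
            by_cases hap : a = z
            · rw [if_pos (by rw [hap]), if_neg]
              rintro rfl
              exact ha (hap ▸ hzt)
            · rw [if_neg (by simpa using hap)]
      rw [Finset.sum_congr rfl fun d _ => e d, Finset.sum_ite_eq' Finset.univ (z, true),
        if_pos (Finset.mem_univ _)]
    unfold pairSum
    have e : ∀ d : Fin N.m × Bool, ∀ x y : ZMod 2, (if N.vert d = N.snk j then x + y else 0) =
        (if N.vert d = N.snk j then x else 0) + if N.vert d = N.snk j then y else 0 := by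
      intro d x y
      split_ifs <;> simp
    simp only [e]
    rw [Finset.sum_add_distrib, key p hp, key p' hp', two]
  · push Not at h1 h2
    rw [← Finset.sum_filter, r.sum_star h1 h2]
    refine Finset.sum_eq_zero fun x hx => ?_
    rw [pairSum_nxt ((Finset.mem_filter.1 hx).2 ▸ h2), two]

/-- Sums along a path telescope. -/
theorem sum_path (hN : N.Normalized) (φ : Fin N.m → ZMod 2) {q z : Fin N.m} {h : Fin N.k}
    (hq : N.src q = N.org h) (hz : r.lab z = q) (hzt : N.tgt z = N.snk h) :
    ∑ y with r.lab y = q ∧ ∀ h, N.tgt y ≠ N.snk h, (φ (r.nxt y) + φ y) = φ q + φ z := by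
  have hlast : (Finset.univ.filter fun y => r.lab y = q ∧ ∀ h, N.tgt y ≠ N.snk h) =
      (Finset.univ.filter fun y => r.lab y = q).erase z := by
    ext y
    simp only [Finset.mem_filter, Finset.mem_univ, true_and, Finset.mem_erase]
    constructor
    · rintro ⟨h1, h2⟩
      refine ⟨?_, h1⟩
      rintro rfl
      exact h2 h hzt
    · rintro ⟨h1, h2⟩
      refine ⟨h2, fun j hj => h1 (r.in_inj y z ?_ (h2.trans hz.symm))⟩
      have := r.src_lab_of_tgt y j hj
      rw [h2, hq] at this
      rw [hj, hzt, hN.1 this]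
  have hfirst : ∑ y with r.lab y = q ∧ ∀ h, N.tgt y ≠ N.snk h, φ (r.nxt y) =
      ∑ y ∈ (Finset.univ.filter fun y => r.lab y = q).erase q, φ y := by
    refine Finset.sum_bij (fun y _ => r.nxt y) ?_ ?_ ?_ ?_
    · intro y hy
      simp only [Finset.mem_filter, Finset.mem_univ, true_and, Finset.mem_erase] at hy ⊢
      refine ⟨?_, (r.lab_nxt y hy.2).trans hy.1⟩
      rintro he
      exact hN.2.2.2.1 h y (by rw [← hq, ← he, r.src_nxt y hy.2])
    · intro y hy y' hy' he
      simp only [Finset.mem_filter, Finset.mem_univ, true_and] at hy hy'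
      refine r.nxt_inj hy.2 ?_ he
      rw [← r.src_nxt y hy.2, he, r.src_nxt y' hy'.2]
    · intro y hy
      simp only [Finset.mem_filter, Finset.mem_univ, true_and, Finset.mem_erase] at hy
      have hs : ∀ h, N.src y ≠ N.org h := by
        intro j hj
        have := r.lab_start y j hj
        exact hy.1 (this.symm.trans hy.2)
      obtain ⟨x, rfl, hx⟩ := r.exists_nxt y hs
      have hx' : ∀ h, N.tgt x ≠ N.snk h := fun h => hx ▸ hN.2.2.2.2 h _
      refine ⟨x, ?_, rfl⟩
      simp only [Finset.mem_filter, Finset.mem_univ, true_and]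
      exact ⟨(r.lab_nxt x hx').symm.trans hy.2, hx'⟩
    · intro y _
      rfl
  have hqm : q ∈ Finset.univ.filter fun y => r.lab y = q :=
    Finset.mem_filter.2 ⟨Finset.mem_univ _, r.lab_start q h hq⟩
  have hzm : z ∈ Finset.univ.filter fun y => r.lab y = q :=
    Finset.mem_filter.2 ⟨Finset.mem_univ _, hz⟩
  have s1 := Finset.add_sum_erase _ φ hqm
  have s2 := Finset.add_sum_erase _ φ hzm
  rw [Finset.sum_add_distrib, hfirst, hlast]
  have key : ∀ a b c d e : ZMod 2, a + b = e → c + d = e → b + d = a + c := by decide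
  exact key _ _ _ _ _ s1 s2

variable {ψ : Fin N.m × Bool → ZMod 2}

/-- A potential has the same value at both ends of an arc that is not in the circulation. -/
theorem potential_flip {c : Fin N.m → ZMod 2}
    (hψ : ∀ d, ψ (N.rot d) = ψ d + c d.1 ∧ ψ (N.rot (N.flip d)) = ψ d) {y : Fin N.m}
    (hy : c y = 0) : ψ (y, true) = ψ (y, false) := by
  have h1 := (hψ (y, false)).2
  have h2 := (hψ (y, true)).1
  rw [show N.flip (y, false) = (y, true) from rfl, h2, hy, add_zero] at h1
  exact h1

/-- The variation of the potential of two paths along a third one at a vertex is the number of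
crossings there. -/
theorem potential_nxt (hE : N.SphereEmbedding) (hN : N.Normalized)
    (hψ : ∀ d, ψ (N.rot d) = ψ d + r.pairSum p p' d.1) {y : Fin N.m}
    (hy : ∀ h, N.tgt y ≠ N.snk h) :
    open Classical in
    ψ (r.nxt y, false) = ψ (y, true) + ∑ x with N.tgt x = N.tgt y,
      ((if r.lab x = p ∧ r.Cross y x then 1 else 0) +
        if r.lab x = p' ∧ r.Cross y x then 1 else 0) := by
  classical
  rw [hE.potential_eq hψ (d := (y, true)) (e := (r.nxt y, false)) (r.src_nxt y hy).symm]
  congr 1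
  have hseg : N.seg (y, true) (r.nxt y, false) =
      (Finset.univ.filter fun d => N.vert d = N.tgt y).filter (fun d => r.Inside y d) := by
    ext f
    rw [mem_seg, Finset.mem_filter, Finset.mem_filter, vert_true]
    simp [Inside]
  rw [hseg, Finset.sum_filter, r.sum_star (fun h => hN.2.2.2.1 h y) hy]
  refine Finset.sum_congr rfl fun x hx => ?_
  rw [pairSum_nxt ((Finset.mem_filter.1 hx).2 ▸ hy), pairSum]
  unfold Cross
  split_ifs <;> first | rfl | (exfalso; tauto)

open Classical in
theorem sum_crossings (hE : N.SphereEmbedding) (ho : N.IsTopological o) (hr : r.IsUncrossed o)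
    (hpq : p ≠ q) :
    ∑ y with r.lab y = q ∧ ∀ h, N.tgt y ≠ N.snk h, ∑ x with N.tgt x = N.tgt y,
      (if r.lab x = p ∧ r.Cross y x then (1 : ZMod 2) else 0) =
    if r.Crosses p q then 1 else 0 := by
  split_ifs with h
  · obtain ⟨x, y, hx, hy, hm, hc⟩ := h
    have hxy : x ≠ y := ne_of_apply_ne r.lab (by rwa [hx, hy])
    have huniq : ∀ x' y', r.lab x' = p → r.lab y' = q → Meet x' y' → r.Cross y' x' →
        x' = x ∧ y' = y := by
      intro x' y' hx' hy' hm' hc'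
      have hxy' : x' ≠ y' := ne_of_apply_ne r.lab (by rwa [hx', hy'])
      rw [← r.cross_comm hE hm' hxy'] at hc'
      have h1 := hr.first x y x' y' hm hxy hc (hx'.trans hx.symm) (hy'.trans hy.symm) hm'.1
      have h2 := hr.first x' y' x y hm' hxy' hc' (hx.trans hx'.symm) (hy.trans hy'.symm) hm.1
      have ht := ho.1 (le_antisymm h2 h1)
      exact ⟨r.in_inj _ _ ht (hx'.trans hx.symm),
        r.in_inj _ _ (hm'.1.symm.trans (ht.trans hm.1)) (hy'.trans hy.symm)⟩
    rw [Finset.sum_eq_single y, Finset.sum_eq_single x, if_pos ⟨hx, (r.cross_comm hE hm hxy).1 hc⟩]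
    · intro x' hx' hne
      rw [if_neg]
      rintro ⟨h1, h2⟩
      rw [Finset.mem_filter] at hx'
      exact hne (huniq x' y h1 hy ⟨hx'.2, hx'.2 ▸ hm.1 ▸ hm.2⟩ h2).1
    · intro h
      exact absurd (Finset.mem_filter.2 ⟨Finset.mem_univ x, hm.1⟩) h
    · intro y' hy' hne
      rw [Finset.mem_filter] at hy'
      refine Finset.sum_eq_zero fun x' hx' => ?_
      rw [if_neg]
      rintro ⟨h1, h2⟩
      rw [Finset.mem_filter] at hx'
      exact hne (huniq x' y' h1 hy'.2.1 ⟨hx'.2, hx'.2 ▸ hy'.2.2⟩ h2).2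
    · intro h
      exact absurd (Finset.mem_filter.2 ⟨Finset.mem_univ _, hy, hm.1 ▸ hm.2⟩) h
  · refine Finset.sum_eq_zero fun y hy => Finset.sum_eq_zero fun x hx => ?_
    rw [if_neg]
    rintro ⟨h1, h2⟩
    rw [Finset.mem_filter] at hx hy
    have hxy : x ≠ y := ne_of_apply_ne r.lab (by rwa [h1, hy.2.1])
    have hm : Meet x y := ⟨hx.2, hx.2 ▸ hy.2.2⟩
    exact h ⟨x, y, h1, hy.2.1, hm, (r.cross_comm hE hm hxy).2 h2⟩

open Classical in
/-- The parity of the crossings between the paths of two demands is a sum of two functions of one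
path each. -/
theorem crosses_add (hE : N.SphereEmbedding) (hN : N.Normalized) (ho : N.IsTopological o)
    (hr : r.IsUncrossed o) (hh : h ≠ h') (hp : N.src p = N.org h) (hp' : N.src p' = N.org h)
    (hq : N.src q = N.org h') (hq' : N.src q' = N.org h') :
    (if r.Crosses p q then (1 : ZMod 2) else 0) + (if r.Crosses p' q then 1 else 0) =
      (if r.Crosses p q' then 1 else 0) + (if r.Crosses p' q' then 1 else 0) := by
  obtain ⟨ψ, hψ⟩ := exists_potential hE _ (pairSum_circulation (r := r) hN hp hp')
  have hne : ∀ p q, N.src p = N.org h → N.src q = N.org h' → p ≠ q := by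
    rintro p q h1 h2 rfl
    exact hh (hN.1 (h1.symm.trans h2))
  have zero : ∀ y, N.src (r.lab y) = N.org h' → r.pairSum p p' y = 0 := by
    intro y hy
    rw [pairSum, if_neg (hne p _ hp hy).symm, if_neg (hne p' _ hp' hy).symm, add_zero]
  -- along a path of the other demand the potential changes exactly at the crossings with the two
  -- paths
  have key : ∀ q z, N.src q = N.org h' → r.lab z = q → N.tgt z = N.snk h' →
      (if r.Crosses p q then (1 : ZMod 2) else 0) + (if r.Crosses p' q then 1 else 0) =
      ψ (q, false) + ψ (z, true) := by
    intro q z hq hz hzt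
    rw [← sum_crossings hE ho hr (hne p q hp hq), ← sum_crossings hE ho hr (hne p' q hp' hq),
      ← Finset.sum_add_distrib, potential_flip hψ (zero z (hz ▸ hq)),
      ← sum_path hN (fun a => ψ (a, false)) hq hz hzt]
    refine Finset.sum_congr rfl fun y hy => ?_
    rw [Finset.mem_filter] at hy
    rw [potential_nxt hE hN (fun d => (hψ d).1) hy.2.2,
      potential_flip hψ (zero y (hy.2.1 ▸ hq)), ← Finset.sum_add_distrib]
    have e : ∀ a b : ZMod 2, b = a + b + a := by decide
    exact e _ _
  -- neither of the two paths uses an arc at the ends of the other demand, so that the potential is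
  -- constant around these ends
  obtain ⟨z, hz, hzt⟩ := r.exists_last q h' hq
  obtain ⟨z', hz', hzt'⟩ := r.exists_last q' h' hq'
  rw [key q z hq hz hzt, key q' z' hq' hz' hzt']
  congr 1
  · rw [hE.potential_eq (fun d => (hψ d).1) (d := (q', false)) (e := (q, false))
      (show N.src q' = N.src q by rw [hq, hq']), Finset.sum_eq_zero, add_zero]
    rintro ⟨a, b⟩ hf
    rw [mem_seg, vert_false, hq'] at hf
    refine zero a ?_
    cases b
    · rw [r.lab_start a h' hf.1]
      exact hf.1
    · exact absurd hf.1 (hN.2.2.2.1 h' a)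
  · rw [hE.potential_eq (fun d => (hψ d).1) (d := (z', true)) (e := (z, true))
      (show N.tgt z' = N.tgt z by rw [hzt, hzt']), Finset.sum_eq_zero, add_zero]
    rintro ⟨a, b⟩ hf
    rw [mem_seg, vert_true, hzt'] at hf
    refine zero a ?_
    cases b
    · exact absurd hf.1 (hN.2.2.2.2 h' a)
    · exact r.src_lab_of_tgt a h' hf.1

/-- A path crosses the paths of another demand in a cyclic interval: it cannot cross the first and
the third of four consecutive ones and avoid the two other ones. -/
theorem not_alternating (hE : N.SphereEmbedding) (hN : N.Normalized) (ho : N.IsTopological o)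
    (hr : r.IsUncrossed o) (hh : h ≠ h') {p₁ p₂ p₃ p₄ : Fin N.m} (h1 : N.src p₁ = N.org h)
    (h2 : N.src p₂ = N.org h) (h3 : N.src p₃ = N.org h) (h4 : N.src p₄ = N.org h)
    (hq : N.src q = N.org h') (h0 : p₁ ≠ p₂)
    (h12 : cdist N.rot (p₁, false) (p₂, false) < cdist N.rot (p₁, false) (p₃, false))
    (h34 : cdist N.rot (p₁, false) (p₃, false) < cdist N.rot (p₁, false) (p₄, false))
    (c1 : r.Crosses p₁ q) (c3 : r.Crosses p₃ q) (c2 : ¬ r.Crosses p₂ q) (c4 : ¬ r.Crosses p₄ q) :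
    False := by
  classical
  obtain ⟨ψ, hψ⟩ := exists_potential hE _ (pairSum_circulation (r := r) hN h2 h4)
  have hdist : ∀ a b, N.src a = N.org h → N.src b = N.org h → r.lab a = r.lab b → a = b := by
    intro a b ha hb hab
    rwa [r.lab_start a h ha, r.lab_start b h hb] at hab
  have n13 : p₁ ≠ p₃ := by rintro rfl; rw [cdist_self] at h12; omega
  have n14 : p₁ ≠ p₄ := by rintro rfl; rw [cdist_self] at h34; omega
  have n23 : p₂ ≠ p₃ := by rintro rfl; omega
  have n34 : p₃ ≠ p₄ := by rintro rfl; omega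
  have n24 : p₂ ≠ p₄ := by rintro rfl; omega
  have hne : ∀ p, N.src p = N.org h → q ≠ p := by
    rintro p h1 rfl
    exact hh (hN.1 (h1.symm.trans hq))
  -- the potential is constant along a path that does not cross `p₂` and `p₄`
  have const : ∀ a, N.src a = N.src (r.lab a) → a ≠ p₂ → a ≠ p₄ → r.lab a = a →
      (∀ x y, Meet x y → r.lab x = a → r.lab y = p₂ ∨ r.lab y = p₄ → ¬ r.Cross x y) →
      ∀ y, r.lab y = a → ψ (y, true) = ψ (a, false) := by
    intro a _ hap2 hap4 haa hcr y hy
    have zero : ∀ y, r.lab y = a → r.pairSum p₂ p₄ y = 0 := by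
      intro y hy
      rw [pairSum, hy, if_neg hap2, if_neg hap4, add_zero]
    rw [potential_flip hψ (zero y hy)]
    refine r.path_induction ho (C := fun y => ψ (y, false) = ψ (a, false)) rfl ?_
      (fun h a => hN.2.2.2.2 h a) y hy
    intro y hy hys ih
    rw [potential_nxt hE hN (fun d => (hψ d).1) hys, Finset.sum_eq_zero, add_zero,
      potential_flip hψ (zero y hy), ih]
    intro x hx
    have hm : Meet y x := ⟨(Finset.mem_filter.1 hx).2.symm, hys⟩
    rw [if_neg, if_neg, add_zero]
    · rintro ⟨g1, g2⟩
      exact hcr y x hm hy (Or.inr g1) g2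
    · rintro ⟨g1, g2⟩
      exact hcr y x hm hy (Or.inl g1) g2
  have constp : ∀ a, N.src a = N.org h → a ≠ p₂ → a ≠ p₄ → ∀ y, r.lab y = a →
      ψ (y, true) = ψ (a, false) := by
    intro a ha ha2 ha4
    have haa := r.lab_start a h ha
    refine const a (by rw [haa]) ha2 ha4 haa ?_
    intro x y hm hx hy
    refine hr.same x y hm ?_ ?_
    · rintro rfl
      rcases hy with hy | hy
      · exact ha2 (hx.symm.trans hy)
      · exact ha4 (hx.symm.trans hy)
    · rw [hx, ha]
      rcases hy with hy | hy
      · rw [hy, h2]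
      · rw [hy, h4]
  have constq := const q (by rw [r.lab_start q h' hq]) (hne p₂ h2) (hne p₄ h4)
    (r.lab_start q h' hq) (by
      intro x y hm hx hy hc
      rcases hy with hy | hy
      · refine c2 ⟨y, x, hy, hx, hm.symm, (r.cross_comm hE hm ?_).1 hc⟩
        exact ne_of_apply_ne r.lab (by rw [hx, hy]; exact hne _ h2)
      · refine c4 ⟨y, x, hy, hx, hm.symm, (r.cross_comm hE hm ?_).1 hc⟩
        exact ne_of_apply_ne r.lab (by rw [hx, hy]; exact hne _ h4))
  -- hence a path that crosses `q` has the same potential as `q`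
  have key : ∀ a, N.src a = N.org h → a ≠ p₂ → a ≠ p₄ → r.Crosses a q →
      ψ (a, false) = ψ (q, false) := by
    rintro a ha ha2 ha4 ⟨x, y, hx, hy, hm, hc⟩
    rw [← constp a ha ha2 ha4 x hx, ← constq y hy,
      hE.potential_eq (fun d => (hψ d).1) (d := (x, true)) (e := (y, true)) hm.1]
    have hseg : N.seg (x, true) (y, true) = (Finset.univ.filter fun d => N.vert d = N.tgt x).filter
        (fun d => cdist N.rot (x, true) d < cdist N.rot (x, true) (y, true)) := by
      ext f
      rw [mem_seg, Finset.mem_filter, Finset.mem_filter, vert_true]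
      simp
    have hxy : x ≠ y := ne_of_apply_ne r.lab (by rw [hx, hy]; exact (hne a ha).symm)
    rw [hseg, Finset.sum_filter, r.sum_star (fun h => hN.2.2.2.1 h x) hm.2, Finset.sum_eq_zero,
      add_zero]
    intro w hw
    have hmw : Meet x w := ⟨(Finset.mem_filter.1 hw).2.symm, hm.2⟩
    rw [pairSum_nxt hmw.symm.2]
    by_cases hw24 : r.lab w = p₂ ∨ r.lab w = p₄
    · have hsw : N.src (r.lab w) = N.org h := by
        rcases hw24 with g | g
        · rw [g, h2]
        · rw [g, h4]
      have hxw : x ≠ w := by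
        rintro rfl
        rcases hw24 with g | g
        · exact ha2 (hx.symm.trans g)
        · exact ha4 (hx.symm.trans g)
      have hyw : y ≠ w := by
        rintro rfl
        rw [hy] at hw24
        rcases hw24 with g | g
        · exact hne p₂ h2 g
        · exact hne p₄ h4 g
      have hmy : Meet y w := ⟨hm.1.symm.trans hmw.1, hm.symm.2⟩
      have t : ∀ x : ZMod 2, x + x = 0 := by decide
      have := r.lt_iff_of_cross hE hm hmw hxy hxw hyw hc
        (hr.same x w hmw hxw (by rw [hx, ha, hsw])) (fun hcw => by
          rcases hw24 with g | g
          · exact c2 ⟨w, y, g, hy, hmy.symm, (r.cross_comm hE hmy hyw).1 hcw⟩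
          · exact c4 ⟨w, y, g, hy, hmy.symm, (r.cross_comm hE hmy hyw).1 hcw⟩)
      rw [if_congr this rfl rfl, t]
    · push Not at hw24
      rw [pairSum, if_neg hw24.1, if_neg hw24.2, add_zero, ite_self, ite_self, add_zero]
  -- but between `p₁` and `p₃` the potential changes exactly once, at `p₂`
  have e1 := key p₁ h1 h0 n14 c1
  have e3 := key p₃ h3 n23.symm n34 c3
  have hpot := hE.potential_eq (fun d => (hψ d).1) (d := (p₁, false)) (e := (p₃, false))
    (show N.src p₁ = N.src p₃ by rw [h1, h3])
  rw [e1, e3, Finset.sum_eq_single (p₂, false)] at hpot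
  · rw [pairSum, r.lab_start p₂ h h2, if_pos rfl, if_neg n24] at hpot
    have t : ∀ x : ZMod 2, x ≠ x + (1 + 0) := by decide
    exact t _ hpot
  · rintro ⟨a, b⟩ hf hne2
    rw [mem_seg, vert_false, h1] at hf
    cases b
    · rw [pairSum, r.lab_start a h hf.1, if_neg, if_neg, add_zero]
      · rintro rfl
        omega
      · rintro rfl
        exact hne2 rfl
    · exact absurd hf.1 (hN.2.2.2.1 h a)
  · intro hf
    refine absurd (mem_seg.2 ⟨?_, h12⟩) hf
    change N.src p₂ = N.src p₁
    rw [h1, h2]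

end Routing

end Network

/-! ### Encoding the crossings by intervals -/

/-- A cyclic interval of an initial segment of the natural numbers, given by two bounds. It is
`[a, b)` if `a ≤ b` and the complement of `[b, a)` otherwise. -/
def InInterval (a b i : ℕ) : Prop := i < a ↔ (i < b ↔ b < a)

theorem exists_inInterval (g : ℕ → Prop) (r : ℕ)
    (h : ∀ i j k l, i < j → j < k → k < l → l < r → g i → ¬ g j → g k → ¬ g l → False)
    (h' : ∀ i j k l, i < j → j < k → k < l → l < r → ¬ g i → g j → ¬ g k → g l → False) :
    ∃ a b, a ≤ r ∧ b ≤ r ∧ ∀ i < r, g i ↔ InInterval a b i := by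
  classical
  -- the first element `≥ s` of a set, or `r`
  have first : ∀ (f : ℕ → Prop) (s : ℕ), s ≤ r → ∃ a, s ≤ a ∧ a ≤ r ∧
      (∀ i, s ≤ i → i < a → ¬ f i) ∧ (a < r → f a) := by
    intro f s hs
    by_cases hf : ∃ a, s ≤ a ∧ a < r ∧ f a
    · obtain ⟨h1, h2, h3⟩ := Nat.find_spec hf
      refine ⟨Nat.find hf, h1, h2.le, fun i hi hia hfi => ?_, fun _ => h3⟩
      exact Nat.find_min hf hia ⟨hi, hia.trans h2, hfi⟩
    · exact ⟨r, hs, le_rfl, fun i hi hir hfi => hf ⟨i, hi, hir, hfi⟩, fun hr => absurd hr (by omega)⟩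
  unfold InInterval
  by_cases h0 : g 0
  · obtain ⟨b, -, hb, hb1, hb2⟩ := first (fun i => ¬ g i) 0 (Nat.zero_le _)
    obtain ⟨a, hba, ha, ha1, ha2⟩ := first g b hb
    by_cases hbr : b = r
    · refine ⟨0, r, Nat.zero_le _, le_rfl, fun i hi => ?_⟩
      have := hb1 i (Nat.zero_le _) (by omega)
      simp only [not_not] at this
      simp only [this, true_iff]
      omega
    have hgb := hb2 (by omega)
    have hb0 : 0 < b := by
      rcases Nat.eq_zero_or_pos b with rfl | h
      · exact absurd h0 hgb
      · exact h
    have hab : b < a := by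
      rcases hba.eq_or_lt with rfl | h
      · exact absurd (ha2 (by omega)) hgb
      · exact h
    refine ⟨a, b, ha, hb, fun i hi => ?_⟩
    rcases lt_or_ge i b with hib | hib
    · have := hb1 i (Nat.zero_le _) hib
      simp only [not_not] at this
      simp only [this, true_iff]
      omega
    rcases lt_or_ge i a with hia | hia
    · have := ha1 i hib hia
      simp only [this, false_iff]
      omega
    · have : g i := by
        by_contra hgi
        rcases hia.eq_or_lt with rfl | hlt
        · exact hgi (ha2 hi)
        · exact h 0 b a i hb0 hab hlt hi h0 hgb (ha2 (by omega)) hgi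
      simp only [this, true_iff]
      omega
  · obtain ⟨a, -, ha, ha1, ha2⟩ := first g 0 (Nat.zero_le _)
    obtain ⟨b, hab, hb, hb1, hb2⟩ := first (fun i => ¬ g i) a ha
    refine ⟨a, b, ha, hb, fun i hi => ?_⟩
    rcases lt_or_ge i a with hia | hia
    · have := ha1 i (Nat.zero_le _) hia
      simp only [this, false_iff]
      omega
    rcases lt_or_ge i b with hib | hib
    · have := hb1 i hia hib
      simp only [not_not] at this
      simp only [this, true_iff]
      omega
    · have : ¬ g i := by
        intro hgi
        have har : a < r := by omega
        have ha0 : 0 < a := by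
          rcases Nat.eq_zero_or_pos a with rfl | h
          · exact absurd (ha2 har) h0
          · exact h
        have hlt : a < b := by
          rcases hab.eq_or_lt with rfl | h
          · exact absurd (ha2 har) (hb2 har)
          · exact h
        rcases hib.eq_or_lt with rfl | hlt'
        · exact hb2 hi hgi
        · exact h' 0 a b i ha0 hlt hlt' hi h0 (ha2 har) (hb2 (by omega)) hgi
      simp only [this, false_iff]
      omega

namespace Network

variable {N : Network}

/-- The arc with the smallest number among those with the same tail as `p`. -/
def base (N : Network) (p : Fin N.m) : Fin N.m :=
  (Finset.univ.filter fun a => N.src a = N.src p).min'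
    ⟨p, Finset.mem_filter.2 ⟨Finset.mem_univ _, rfl⟩⟩

theorem src_base (p : Fin N.m) : N.src (N.base p) = N.src p := by
  have := (Finset.univ.filter fun a => N.src a = N.src p).min'_mem
    ⟨p, Finset.mem_filter.2 ⟨Finset.mem_univ _, rfl⟩⟩
  exact (Finset.mem_filter.1 this).2

theorem base_le {p a : Fin N.m} (h : N.src a = N.src p) : N.base p ≤ a :=
  Finset.min'_le _ _ (Finset.mem_filter.2 ⟨Finset.mem_univ a, h⟩)

theorem base_congr {p q : Fin N.m} (h : N.src p = N.src q) : N.base p = N.base q :=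
  le_antisymm (base_le ((src_base q).trans h.symm)) (base_le ((src_base p).trans h))

/-- The position of an arc in the anticlockwise order around its tail. -/
noncomputable def pos (N : Network) (p : Fin N.m) : ℕ := cdist N.rot (N.base p, false) (p, false)

theorem pos_lt (hE : N.SphereEmbedding) (hEu : N.Eulerian) (hN : N.Normalized) {p : Fin N.m}
    {h : Fin N.k} (hp : N.src p = N.org h) : N.pos p < N.req h := by
  rw [pos, ← hE.card_seg (d := (N.base p, false)) (e := (p, false)) (src_base p),
    ← card_out_org hEu hN h]
  have hsub : N.seg (N.base p, false) (p, false) ⊆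
      ((Finset.univ.filter fun a => N.src a = N.org h).erase p).map
        ⟨fun a => (a, false), fun a b hab => (Prod.mk.inj hab).1⟩ := by
    rintro ⟨a, b⟩ hf
    rw [mem_seg, vert_false, src_base, hp] at hf
    cases b
    · refine Finset.mem_map.2 ⟨a, Finset.mem_erase.2 ⟨?_, Finset.mem_filter.2
        ⟨Finset.mem_univ _, hf.1⟩⟩, rfl⟩
      rintro rfl
      exact lt_irrefl _ hf.2
    · exact absurd hf.1 (hN.2.2.2.1 h a)
  refine (Finset.card_le_card hsub).trans_lt ?_
  rw [Finset.card_map]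
  exact Finset.card_erase_lt_of_mem (Finset.mem_filter.2 ⟨Finset.mem_univ _, hp⟩)

theorem pos_inj (hE : N.SphereEmbedding) {p q : Fin N.m} (h : N.src p = N.src q)
    (hpq : N.pos p = N.pos q) : p = q := by
  unfold pos at hpq
  rw [base_congr h] at hpq
  have := cdist_inj (hE.sameCycle (d := (N.base q, false)) (e := (p, false))
    ((src_base q).trans h.symm)) (hE.sameCycle (e := (q, false)) (src_base q)) hpq
  exact (Prod.mk.inj this).1

theorem exists_pos (hE : N.SphereEmbedding) (hEu : N.Eulerian) (hN : N.Normalized) {h : Fin N.k}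
    {i : ℕ} (hi : i < N.req h) : ∃ p, N.src p = N.org h ∧ N.pos p = i := by
  obtain ⟨p, hp, he⟩ := Finset.surj_on_of_inj_on_of_card_le
    (s := Finset.univ.filter fun a => N.src a = N.org h) (t := Finset.range (N.req h))
    (fun p _ => N.pos p)
    (fun p hp => Finset.mem_range.2 (pos_lt hE hEu hN (Finset.mem_filter.1 hp).2))
    (fun p q hp hq he => pos_inj hE ((Finset.mem_filter.1 hp).2.trans
      (Finset.mem_filter.1 hq).2.symm) he)
    (by rw [Finset.card_range, card_out_org hEu hN]) i (Finset.mem_range.2 hi)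
  exact ⟨p, (Finset.mem_filter.1 hp).2, he.symm⟩

theorem exists_cdist_pos (hE : N.SphereEmbedding) (p : Fin N.m) : ∃ L,
    (∀ q, N.src q = N.src p → N.pos q < L) ∧
    ∀ q q', N.src q = N.src p → N.src q' = N.src p →
      cdist N.rot (q, false) (q', false) =
        if N.pos q ≤ N.pos q' then N.pos q' - N.pos q else L + N.pos q' - N.pos q := by
  obtain ⟨L, h1, h2, h3⟩ := exists_cdist_rebase N.rot (N.base p, false)
  have hs : ∀ q, N.src q = N.src p → N.rot.SameCycle (N.base p, false) (q, false) := fun q hq =>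
    hE.sameCycle ((src_base p).trans hq.symm)
  have hb : ∀ q, N.src q = N.src p → cdist N.rot (N.base p, false) (q, false) = N.pos q :=
    fun q hq => by rw [pos, base_congr hq]
  refine ⟨L, fun q hq => ?_, fun q q' hq hq' => ?_⟩
  · rw [← hb q hq]
    exact h1 _ (hs q hq)
  · rw [h3 _ _ (hs q hq) (hs q' hq'), hb q hq, hb q' hq']

namespace Routing

variable {r : N.Routing} {o : Fin N.n → ℕ}

theorem exists_interval (hE : N.SphereEmbedding) (hEu : N.Eulerian) (hN : N.Normalized)
    (ho : N.IsTopological o) (hr : r.IsUncrossed o) {h h' : Fin N.k} (hh : h ≠ h') {q : Fin N.m}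
    (hq : N.src q = N.org h') (e : Prop) : ∃ a b, a ≤ N.req h ∧ b ≤ N.req h ∧
      ∀ p, N.src p = N.org h → ((r.Crosses p q ↔ e) ↔ InInterval a b (N.pos p)) := by
  have key : ∀ i j k l, i < j → j < k → k < l → l < N.req h →
      ∃ p₁ p₂ p₃ p₄, N.src p₁ = N.org h ∧ N.src p₂ = N.org h ∧ N.src p₃ = N.org h ∧
        N.src p₄ = N.org h ∧ N.pos p₁ = i ∧ N.pos p₂ = j ∧ N.pos p₃ = k ∧ N.pos p₄ = l ∧
        (r.Crosses p₁ q → ¬ r.Crosses p₂ q → r.Crosses p₃ q → ¬ r.Crosses p₄ q → False) ∧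
        (¬ r.Crosses p₁ q → r.Crosses p₂ q → ¬ r.Crosses p₃ q → r.Crosses p₄ q → False) := by
    intro i j k l hij hjk hkl hl
    obtain ⟨p₁, h1, e1⟩ := exists_pos hE hEu hN (show i < N.req h by omega)
    obtain ⟨p₂, h2, e2⟩ := exists_pos hE hEu hN (show j < N.req h by omega)
    obtain ⟨p₃, h3, e3⟩ := exists_pos hE hEu hN (show k < N.req h by omega)
    obtain ⟨p₄, h4, e4⟩ := exists_pos hE hEu hN hl
    obtain ⟨L, hL, hd⟩ := exists_cdist_pos hE p₁
    have n12 : p₁ ≠ p₂ := by rintro rfl; omega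
    have n23 : p₂ ≠ p₃ := by rintro rfl; omega
    have g2 := h2.trans h1.symm
    have g3 := h3.trans h1.symm
    have g4 := h4.trans h1.symm
    have l4 := hL p₄ g4
    refine ⟨p₁, p₂, p₃, p₄, h1, h2, h3, h4, e1, e2, e3, e4, ?_, ?_⟩
    · intro c1 c2 c3 c4
      refine not_alternating hE hN ho hr hh h1 h2 h3 h4 hq n12 ?_ ?_ c1 c3 c2 c4
      · rw [hd _ _ rfl g2, hd _ _ rfl g3]
        split_ifs <;> omega
      · rw [hd _ _ rfl g3, hd _ _ rfl g4]
        split_ifs <;> omega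
    · intro c1 c2 c3 c4
      refine not_alternating hE hN ho hr hh h2 h3 h4 h1 hq n23 ?_ ?_ c2 c4 c3 c1
      · rw [hd _ _ g2 g3, hd _ _ g2 g4]
        split_ifs <;> omega
      · rw [hd _ _ g2 g4, hd _ _ g2 rfl]
        split_ifs <;> omega
  have hpos : ∀ p p', N.src p = N.org h → N.src p' = N.org h → N.pos p = N.pos p' → p = p' :=
    fun p p' hp hp' => pos_inj hE (hp.trans hp'.symm)
  have hg : ∀ p, N.src p = N.org h →
      ((∃ p', N.src p' = N.org h ∧ N.pos p' = N.pos p ∧ (r.Crosses p' q ↔ e)) ↔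
        (r.Crosses p q ↔ e)) := by
    intro p hp
    constructor
    · rintro ⟨p', hp', he, hc⟩
      rwa [hpos p' p hp' hp he] at hc
    · intro hc
      exact ⟨p, hp, rfl, hc⟩
  obtain ⟨a, b, ha, hb, hab⟩ := exists_inInterval
    (fun i => ∃ p, N.src p = N.org h ∧ N.pos p = i ∧ (r.Crosses p q ↔ e)) (N.req h) (by
      intro i j k l hij hjk hkl hl g1 g2 g3 g4
      obtain ⟨p₁, p₂, p₃, p₄, h1, h2, h3, h4, rfl, rfl, rfl, rfl, k1, k2⟩ := key i j k l hij hjk hkl hl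
      rw [hg _ h1] at g1
      rw [hg _ h2] at g2
      rw [hg _ h3] at g3
      rw [hg _ h4] at g4
      by_cases he : e <;> simp only [he, iff_true, iff_false, not_not] at g1 g2 g3 g4
      · exact k1 g1 g2 g3 g4
      · exact k2 g1 g2 g3 g4) (by
      intro i j k l hij hjk hkl hl g1 g2 g3 g4
      obtain ⟨p₁, p₂, p₃, p₄, h1, h2, h3, h4, rfl, rfl, rfl, rfl, k1, k2⟩ := key i j k l hij hjk hkl hl
      rw [hg _ h1] at g1
      rw [hg _ h2] at g2
      rw [hg _ h3] at g3
      rw [hg _ h4] at g4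
      by_cases he : e <;> simp only [he, iff_true, iff_false, not_not] at g1 g2 g3 g4
      · exact k2 g1 g2 g3 g4
      · exact k1 g1 g2 g3 g4)
  refine ⟨a, b, ha, hb, fun p hp => ?_⟩
  rw [← hg p hp]
  exact hab _ (pos_lt hE hEu hN hp)

theorem exists_intervals_pair (hE : N.SphereEmbedding) (hEu : N.Eulerian) (hN : N.Normalized)
    (ho : N.IsTopological o) (hr : r.IsUncrossed o) {h h' : Fin N.k} (hh : h ≠ h') :
    ∃ a b a' b', (a ≤ N.req h ∧ b ≤ N.req h ∧ a' ≤ N.req h' ∧ b' ≤ N.req h') ∧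
      ∀ p q, N.src p = N.org h → N.src q = N.org h' →
        (r.Crosses p q ↔ (InInterval a b (N.pos p) ↔ ¬ InInterval a' b' (N.pos q))) := by
  classical
  by_cases h1 : ∃ p₀, N.src p₀ = N.org h
  swap
  · exact ⟨0, 0, 0, 0, by simp, fun p q hp _ => absurd ⟨p, hp⟩ h1⟩
  by_cases h2 : ∃ q₀, N.src q₀ = N.org h'
  swap
  · exact ⟨0, 0, 0, 0, by simp, fun p q _ hq => absurd ⟨q, hq⟩ h2⟩
  obtain ⟨p₀, hp₀⟩ := h1
  obtain ⟨q₀, hq₀⟩ := h2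
  obtain ⟨a, b, ha, hb, hab⟩ := exists_interval hE hEu hN ho hr hh hq₀ True
  obtain ⟨a', b', ha', hb', hab'⟩ := exists_interval hE hEu hN ho hr hh.symm hp₀
    (¬ r.Crosses p₀ q₀)
  refine ⟨a, b, a', b', ⟨ha, hb, ha', hb'⟩, fun p q hp hq => ?_⟩
  rw [← hab p hp, ← hab' q hq]
  have hne : p₀ ≠ q := by
    rintro rfl
    exact hh (hN.1 (hp₀.symm.trans hq))
  rw [crosses_comm hE hne.symm]
  have := crosses_add hE hN ho hr hh hp hp₀ hq hq₀
  by_cases c1 : r.Crosses p q <;> by_cases c2 : r.Crosses p₀ q <;> by_cases c3 : r.Crosses p q₀ <;>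
    by_cases c4 : r.Crosses p₀ q₀ <;> simp only [c1, c2, c3, c4, if_true, if_false] at this ⊢ <;>
    (revert this; decide)

/-- Whether two paths of different demands cross is determined by their positions at their origins
and by four numbers for every pair of demands. -/
theorem exists_intervals (hE : N.SphereEmbedding) (hEu : N.Eulerian) (hN : N.Normalized)
    (ho : N.IsTopological o) (hr : r.IsUncrossed o) :
    ∃ A B : Fin N.k → Fin N.k → ℕ, (∀ h h', A h h' ≤ N.req h ∧ B h h' ≤ N.req h) ∧
      ∀ h h' p q, h ≠ h' → N.src p = N.org h → N.src q = N.org h' →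
        (r.Crosses p q ↔ (InInterval (A h h') (B h h') (N.pos p) ↔
          ¬ InInterval (A h' h) (B h' h) (N.pos q))) := by
  have H : ∀ h h', ∃ a b a' b', (a ≤ N.req h ∧ b ≤ N.req h ∧ a' ≤ N.req h' ∧ b' ≤ N.req h') ∧
      (h ≠ h' → ∀ p q, N.src p = N.org h → N.src q = N.org h' →
        (r.Crosses p q ↔ (InInterval a b (N.pos p) ↔ ¬ InInterval a' b' (N.pos q)))) := by
    intro h h'
    by_cases hh : h = h'
    · exact ⟨0, 0, 0, 0, by simp, fun h => absurd hh h⟩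
    · obtain ⟨a, b, a', b', h1, h2⟩ := exists_intervals_pair hE hEu hN ho hr hh
      exact ⟨a, b, a', b', h1, fun _ => h2⟩
  choose a b a' b' h1 h2 using H
  refine ⟨fun h h' => if h < h' then a h h' else a' h' h,
    fun h h' => if h < h' then b h h' else b' h' h, fun h h' => ?_, ?_⟩
  · by_cases hlt : h < h'
    · simp only [if_pos hlt]
      exact ⟨(h1 h h').1, (h1 h h').2.1⟩
    · simp only [if_neg hlt]
      exact ⟨(h1 h' h).2.2.1, (h1 h' h).2.2.2⟩
  · intro h h' p q hne hp hq
    rcases lt_or_gt_of_ne hne with hlt | hlt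
    · simp only [if_pos hlt, if_neg hlt.asymm]
      exact h2 h h' hne p q hp hq
    · simp only [if_pos hlt, if_neg hlt.asymm]
      have hpq : p ≠ q := by
        rintro rfl
        exact hne (hN.1 (hp.symm.trans hq))
      rw [crosses_comm hE hpq, h2 h' h hne.symm q p hq hp]
      tauto

end Routing

end Network

/-! ### Separation by cycles through a vertex -/

namespace Network

variable {N : Network}

/-- Connectedness in the subgraph of `G` induced by `A`, regardless of the orientation. -/
def Conn (N : Network) (A : Set (Fin N.n)) : Fin N.n → Fin N.n → Prop :=
  Relation.ReflTransGen fun u w => u ∈ A ∧ w ∈ A ∧ (N.Adj u w ∨ N.Adj w u)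

theorem Conn.symm {A : Set (Fin N.n)} {u w : Fin N.n} (h : N.Conn A u w) : N.Conn A w u := by
  induction h with
  | refl => exact Relation.ReflTransGen.refl
  | tail _ h ih => exact Relation.ReflTransGen.head ⟨h.2.1, h.1, h.2.2.symm⟩ ih

theorem Conn.mono {A B : Set (Fin N.n)} (hAB : A ⊆ B) {u w : Fin N.n} (h : N.Conn A u w) :
    N.Conn B u w := by
  induction h with
  | refl => exact Relation.ReflTransGen.refl
  | tail _ h ih => exact Relation.ReflTransGen.tail ih ⟨hAB h.1, hAB h.2.1, h.2.2⟩

/-- Connected vertices are connected inside their component. -/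
theorem Conn.component {A : Set (Fin N.n)} {u w : Fin N.n} (h : N.Conn A u w) :
    N.Conn {x | x ∈ A ∧ N.Conn A u x} u w := by
  induction h with
  | refl => exact Relation.ReflTransGen.refl
  | tail h1 h2 ih => exact ih.tail ⟨⟨h2.1, h1⟩, ⟨h2.2.1, h1.tail h2⟩, h2.2.2⟩

theorem sum_vert_single (d₀ : Fin N.m × Bool) (v : Fin N.n) :
    ∑ d : Fin N.m × Bool, (if N.vert d = v then (Pi.single d₀.1 1 : Fin N.m → ZMod 2) d.1 else 0) =
      (if N.vert d₀ = v then 1 else 0) + if N.vert (N.flip d₀) = v then 1 else 0 := by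
  rw [Fintype.sum_prod_type, Finset.sum_eq_single d₀.1]
  · rw [Fintype.sum_bool, Pi.single_eq_same]
    obtain ⟨a, b | b⟩ := d₀
    · exact add_comm _ _
    · rfl
  · intro a _ ha
    simp [Pi.single_eq_of_ne ha]
  · intro h
    exact absurd (Finset.mem_univ _) h

theorem flip_flip (d : Fin N.m × Bool) : N.flip (N.flip d) = d := by
  obtain ⟨a, b⟩ := d
  simp [flip]

theorem eq_or_eq_flip {d d' : Fin N.m × Bool} (h : d'.1 = d.1) : d' = d ∨ d' = N.flip d := by
  obtain ⟨a, b⟩ := d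
  obtain ⟨a', b'⟩ := d'
  obtain rfl : a' = a := h
  cases b <;> cases b' <;> first | exact Or.inl rfl | exact Or.inr rfl

theorem sum_vert_add (c c' : Fin N.m → ZMod 2) (v : Fin N.n) :
    ∑ d : Fin N.m × Bool, (if N.vert d = v then (c + c') d.1 else 0) =
      ∑ d : Fin N.m × Bool, (if N.vert d = v then c d.1 else 0) +
        ∑ d : Fin N.m × Bool, (if N.vert d = v then c' d.1 else 0) := by
  rw [← Finset.sum_add_distrib]
  refine Finset.sum_congr rfl fun d _ => ?_
  split_ifs <;> simp

/-- A path, as a chain modulo 2. -/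
theorem Conn.exists_chain {A : Set (Fin N.n)} {u w : Fin N.n} (h : N.Conn A u w) :
    ∃ c : Fin N.m → ZMod 2, (∀ a, c a ≠ 0 → N.src a ∈ A ∧ N.tgt a ∈ A) ∧
      ∀ v, ∑ d : Fin N.m × Bool, (if N.vert d = v then c d.1 else 0) =
        (if u = v then 1 else 0) + if w = v then 1 else 0 := by
  have two : ∀ x : ZMod 2, x + x = 0 := by decide
  induction h with
  | refl => exact ⟨0, fun a ha => absurd rfl ha, fun v => by simp [two]⟩
  | @tail w w' _ h2 ih =>
    obtain ⟨c, hc, hb⟩ := ih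
    obtain ⟨h1, h2, h3⟩ := h2
    obtain ⟨d, hd, hd'⟩ : ∃ d : Fin N.m × Bool, N.vert d = w ∧ N.vert (N.flip d) = w' := by
      rcases h3 with ⟨a, ha, ha'⟩ | ⟨a, ha, ha'⟩
      · exact ⟨(a, false), ha, ha'⟩
      · exact ⟨(a, true), ha', ha⟩
    refine ⟨c + Pi.single d.1 1, fun a ha => ?_, fun v => ?_⟩
    · by_cases hca : c a = 0
      · have hda : a = d.1 := by
          by_contra hne
          exact ha (by rw [Pi.add_apply, hca, Pi.single_eq_of_ne hne, add_zero])
        subst hda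
        rw [← hd] at h1
        rw [← hd'] at h2
        obtain ⟨a, b | b⟩ := d
        · exact ⟨h1, h2⟩
        · exact ⟨h2, h1⟩
      · exact hc a hca
    · rw [sum_vert_add, hb, sum_vert_single, hd, hd']
      have e : ∀ x y z : ZMod 2, x + y + (y + z) = x + z := by decide
      exact e _ _ _

/-- A closed walk through `v` that enters and leaves `v` by the darts `d₁` and `d₂` does not
separate two darts `e₁` and `e₂` at `v` whose other ends are connected by a disjoint walk. -/
theorem SphereEmbedding.not_separated (hE : N.SphereEmbedding) {v : Fin N.n} {A B : Set (Fin N.n)}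
    (hvA : v ∉ A) (hvB : v ∉ B) (hAB : ∀ u, u ∈ A → u ∉ B) {d₁ d₂ e₁ e₂ : Fin N.m × Bool}
    (hd₁ : N.vert d₁ = v) (hd₂ : N.vert d₂ = v) (he₁ : N.vert e₁ = v) (he₂ : N.vert e₂ = v)
    (hA₁ : N.vert (N.flip d₁) ∈ A) (hA₂ : N.vert (N.flip d₂) ∈ A)
    (hB₁ : N.vert (N.flip e₁) ∈ B)
    (hA : N.Conn A (N.vert (N.flip d₁)) (N.vert (N.flip d₂)))
    (hB : N.Conn B (N.vert (N.flip e₁)) (N.vert (N.flip e₂))) :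
    cdist N.rot d₁ d₂ < cdist N.rot d₁ e₁ ↔ cdist N.rot d₁ d₂ < cdist N.rot d₁ e₂ := by
  have hB₂ : N.vert (N.flip e₂) ∈ B := by
    rcases Relation.ReflTransGen.cases_tail hB with h | ⟨_, _, h⟩
    · rw [h]; exact hB₁
    · exact h.2.1
  have hpos : ∀ e, N.vert e = v → N.vert (N.flip e) ∈ B → 0 < cdist N.rot d₁ e := by
    intro e he heB
    refine Nat.pos_of_ne_zero fun h0 => ?_
    have := pow_cdist (hE.sameCycle (hd₁.trans he.symm))
    rw [h0, pow_zero, Equiv.Perm.one_apply] at this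
    exact hAB _ hA₁ (this ▸ heB)
  by_cases hdd : d₁ = d₂
  · subst hdd
    rw [cdist_self]
    exact ⟨fun _ => hpos e₂ he₂ hB₂, fun _ => hpos e₁ he₁ hB₁⟩
  obtain ⟨c₀, hc₀, hb₀⟩ := hA.exists_chain
  set c : Fin N.m → ZMod 2 := c₀ + Pi.single d₁.1 1 + Pi.single d₂.1 1 with hc
  -- the values of the circulation at the arcs
  have hends : ∀ d d' : Fin N.m × Bool, d'.1 = d.1 → N.vert d = v → N.vert (N.flip d) ∈ A →
      N.vert d' = v → d' = d := by
    intro d d' h h1 h2 h3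
    refine (eq_or_eq_flip h).resolve_right ?_
    rintro rfl
    exact hvA (h3 ▸ h2)
  have hcv : ∀ d, N.vert d = v → d ≠ d₁ → d ≠ d₂ → c d.1 = 0 := by
    intro d hd h1 h2
    have g0 : c₀ d.1 = 0 := by
      by_contra hne
      have := hc₀ _ hne
      obtain ⟨a, b | b⟩ := d
      · exact hvA (hd ▸ this.1)
      · exact hvA (hd ▸ this.2)
    have g1 : d.1 ≠ d₁.1 := fun h => h1 (hends d₁ d h hd₁ hA₁ hd)
    have g2 : d.1 ≠ d₂.1 := fun h => h2 (hends d₂ d h hd₂ hA₂ hd)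
    rw [hc, Pi.add_apply, Pi.add_apply, g0, Pi.single_eq_of_ne g1, Pi.single_eq_of_ne g2]
    rfl
  have hne12 : d₁.1 ≠ d₂.1 := fun h => hdd (hends d₂ d₁ h hd₂ hA₂ hd₁)
  have hcd : ∀ d, N.vert d = v → c₀ d.1 = 0 := by
    intro d hd
    by_contra hne
    have := hc₀ _ hne
    obtain ⟨a, b | b⟩ := d
    · exact hvA (hd ▸ this.1)
    · exact hvA (hd ▸ this.2)
  have hc1 : c d₁.1 = 1 := by
    rw [hc, Pi.add_apply, Pi.add_apply, hcd d₁ hd₁, Pi.single_eq_same, Pi.single_eq_of_ne hne12]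
    rfl
  have hc2 : c d₂.1 = 1 := by
    rw [hc, Pi.add_apply, Pi.add_apply, hcd d₂ hd₂, Pi.single_eq_same,
      Pi.single_eq_of_ne hne12.symm]
    rfl
  have hcB : ∀ d, N.vert d ∈ B → c d.1 = 0 := by
    intro d hd
    have g0 : c₀ d.1 = 0 := by
      by_contra hne
      have := hc₀ _ hne
      obtain ⟨a, b | b⟩ := d
      · exact hAB _ this.1 hd
      · exact hAB _ this.2 hd
    have g : ∀ d' : Fin N.m × Bool, N.vert d' = v → N.vert (N.flip d') ∈ A → d.1 ≠ d'.1 := by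
      intro d' h1 h2 he
      rcases eq_or_eq_flip he with rfl | rfl
      · exact hvB (h1 ▸ hd)
      · exact hAB _ h2 hd
    rw [hc, Pi.add_apply, Pi.add_apply, g0, Pi.single_eq_of_ne (g d₁ hd₁ hA₁),
      Pi.single_eq_of_ne (g d₂ hd₂ hA₂)]
    rfl
  obtain ⟨ψ, hψ⟩ := exists_potential hE c (by
    intro u
    rw [hc, sum_vert_add, sum_vert_add, hb₀, sum_vert_single, sum_vert_single, hd₁, hd₂]
    have e : ∀ x y z : ZMod 2, x + y + (z + x) + (z + y) = 0 := by decide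
    exact e _ _ _)
  -- the potential is constant on the component of the other ends of `e₁` and `e₂`
  have hvert : ∀ d d', N.vert d ∈ B → N.vert d = N.vert d' → ψ d' = ψ d := by
    intro d d' hd hdd'
    rw [hE.potential_eq (fun d => (hψ d).1) hdd', Finset.sum_eq_zero, add_zero]
    intro f hf
    exact hcB f ((mem_seg.1 hf).1.symm ▸ hd)
  have hconst : ∀ w, N.Conn B (N.vert (N.flip e₁)) w → ∀ d, N.vert d = w →
      ψ d = ψ (N.flip e₁) := by
    intro w hw
    induction hw with
    | refl => exact fun d hd => hvert _ _ hB₁ hd.symm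
    | @tail w w' _ h2 ih =>
      obtain ⟨h1, h2, h3⟩ := h2
      obtain ⟨d, hd, hd'⟩ : ∃ d : Fin N.m × Bool, N.vert d = w ∧ N.vert (N.flip d) = w' := by
        rcases h3 with ⟨a, ha, ha'⟩ | ⟨a, ha, ha'⟩
        · exact ⟨(a, false), ha, ha'⟩
        · exact ⟨(a, true), ha', ha⟩
      intro d' hd2
      rw [← ih d hd, ← (hψ d).2]
      have hrot : N.vert (N.rot (N.flip d)) = N.vert (N.flip d) :=
        (hE.1 _ _).1 (Equiv.Perm.SameCycle.symm ⟨1, by simp⟩)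
      refine hvert _ _ ?_ ?_
      · rw [hrot, hd']; exact h2
      · rw [hrot, hd', hd2]
  have hend : ∀ e, N.vert (N.flip e) ∈ B → ψ e = ψ (N.flip e) := by
    intro e he
    have h1 := (hψ (N.flip e)).2
    rw [flip_flip, (hψ e).1] at h1
    have h2 := hcB _ he
    rw [show (N.flip e).1 = e.1 from rfl] at h2
    rwa [h2, add_zero] at h1
  have heq : ψ e₁ = ψ e₂ := by
    rw [hend e₁ hB₁, hend e₂ hB₂]
    exact (hconst _ hB _ rfl).symm
  -- and it changes at `d₁` and `d₂` only when turning around `v`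
  have key : ∀ e, N.vert e = v → N.vert (N.flip e) ∈ B →
      ψ e = ψ d₁ + (1 + if cdist N.rot d₁ d₂ < cdist N.rot d₁ e then 1 else 0) := by
    intro e he heB
    rw [hE.potential_eq (fun d => (hψ d).1) (hd₁.trans he.symm)]
    congr 1
    rw [← Finset.add_sum_erase _ _ (mem_seg.2 ⟨rfl, by rw [cdist_self]; exact hpos e he heB⟩), hc1]
    congr 1
    split_ifs with hlt
    · rw [Finset.sum_eq_single d₂, hc2]
      · intro f hf hf2
        rw [Finset.mem_erase, mem_seg] at hf
        exact hcv f (hf.2.1.trans hd₁) hf.1 hf2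
      · intro hf
        exact absurd (Finset.mem_erase.2 ⟨Ne.symm hdd, mem_seg.2 ⟨hd₂.trans hd₁.symm, hlt⟩⟩) hf
    · refine Finset.sum_eq_zero fun f hf => ?_
      rw [Finset.mem_erase, mem_seg] at hf
      refine hcv f (hf.2.1.trans hd₁) hf.1 ?_
      rintro rfl
      exact hlt hf.2.2
  rw [key e₁ he₁ hB₁, key e₂ he₂ hB₂] at heq
  have h10 : ∀ x : ZMod 2, x + (1 + 1) ≠ x + (1 + 0) := by decide
  have h10' : ∀ x : ZMod 2, x + (1 + 0) ≠ x + (1 + 1) := by decide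
  split_ifs at heq with g1 g2 g2
  · exact ⟨fun _ => g2, fun _ => g1⟩
  · exact absurd heq (h10 _)
  · exact absurd heq (h10' _)
  · exact ⟨fun h => absurd h g1, fun h => absurd h g2⟩

/-- The subgraph of the vertices that come before `v`. -/
def Past (o : Fin N.n → ℕ) (v : Fin N.n) : Set (Fin N.n) := {u | o u < o v}

variable {o : Fin N.n → ℕ}

theorem reach_conn (ho : N.IsTopological o) {v u t : Fin N.n} (h : Relation.ReflTransGen N.Adj u t)
    (hu : o v < o u) : N.Conn {w | o v < o w} u t ∧ o v < o t := by
  induction h with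
  | refl => exact ⟨Relation.ReflTransGen.refl, hu⟩
  | tail _ h ih =>
    obtain ⟨a, rfl, rfl⟩ := h
    have := ih.2.trans (ho.2 a)
    exact ⟨ih.1.tail ⟨ih.2, this, Or.inl ⟨a, rfl, rfl⟩⟩, this⟩

/-- Two arcs that enter a vertex and whose tails are connected before it do not separate the arcs
that leave it towards a given vertex. -/
theorem not_separated_future (hE : N.SphereEmbedding) (ho : N.IsTopological o) {x y z z' : Fin N.m}
    {t : Fin N.n} (hxy : N.tgt x = N.tgt y) (hz : N.src z = N.tgt x) (hz' : N.src z' = N.tgt x)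
    (hc : N.Conn (Past o (N.tgt x)) (N.src x) (N.src y))
    (ht : Relation.ReflTransGen N.Adj (N.tgt z) t)
    (ht' : Relation.ReflTransGen N.Adj (N.tgt z') t) :
    cdist N.rot (x, true) (y, true) < cdist N.rot (x, true) (z, false) ↔
      cdist N.rot (x, true) (y, true) < cdist N.rot (x, true) (z', false) := by
  have l1 : o (N.tgt x) < o (N.tgt z) := by rw [← hz]; exact ho.2 z
  have l2 : o (N.tgt x) < o (N.tgt z') := by rw [← hz']; exact ho.2 z'
  refine hE.not_separated (v := N.tgt x) (A := Past o (N.tgt x)) (B := {w | o (N.tgt x) < o w})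
    (lt_irrefl (o _)) (lt_irrefl (o _)) (fun u h1 h2 => lt_asymm (a := o u) h1 h2) rfl hxy.symm hz hz'
    (ho.2 x) ?_ l1 hc ?_
  · change o (N.src y) < o (N.tgt x)
    rw [hxy]
    exact ho.2 y
  · exact Relation.ReflTransGen.trans (reach_conn ho ht l1).1 (reach_conn ho ht' l2).1.symm

/-- Two arcs that enter a vertex and come from one component of the vertices before it do not
separate two such arcs that come from another component. -/
theorem not_separated_past (hE : N.SphereEmbedding) (ho : N.IsTopological o) {x x' y y' : Fin N.m}
    {s s' : Fin N.n} (hx : N.tgt x' = N.tgt x) (hy : N.tgt y = N.tgt x) (hy' : N.tgt y' = N.tgt x)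
    (c1 : N.Conn (Past o (N.tgt x)) s (N.src x)) (c2 : N.Conn (Past o (N.tgt x)) s (N.src x'))
    (c3 : N.Conn (Past o (N.tgt x)) s' (N.src y)) (c4 : N.Conn (Past o (N.tgt x)) s' (N.src y'))
    (hs : ¬ N.Conn (Past o (N.tgt x)) s s') :
    cdist N.rot (x, true) (x', true) < cdist N.rot (x, true) (y, true) ↔
      cdist N.rot (x, true) (x', true) < cdist N.rot (x, true) (y', true) := by
  have hsrc : ∀ a, N.tgt a = N.tgt x → N.src a ∈ Past o (N.tgt x) := fun a ha => by
    rw [← ha]; exact ho.2 a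
  refine hE.not_separated (v := N.tgt x)
    (A := {w | w ∈ Past o (N.tgt x) ∧ N.Conn (Past o (N.tgt x)) s w})
    (B := {w | w ∈ Past o (N.tgt x) ∧ N.Conn (Past o (N.tgt x)) s' w})
    (fun h => lt_irrefl (o (N.tgt x)) h.1) (fun h => lt_irrefl (o (N.tgt x)) h.1) ?_
    rfl hx hy hy' ⟨hsrc x rfl, c1⟩ ⟨hsrc x' hx, c2⟩ ⟨hsrc y hy, c3⟩ ?_ ?_
  · rintro u ⟨-, h1⟩ ⟨-, h2⟩
    exact hs (Relation.ReflTransGen.trans h1 h2.symm)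
  · exact Relation.ReflTransGen.trans c1.component.symm c2.component
  · exact Relation.ReflTransGen.trans c3.component.symm c4.component

end Network

/-! ### Left and right -/

namespace Network

variable {N : Network}

namespace Routing

variable {r : N.Routing} {o : Fin N.n → ℕ} {h h' : Fin N.k}

/-- The path of an arc joins the arc to its origin before the head of the arc. -/
theorem conn_past (hN : N.Normalized) (ho : N.IsTopological o) (x : Fin N.m) :
    N.Conn (Past o (N.tgt x)) (N.src (r.lab x)) (N.src x) := by
  have key := r.path_induction ho (p := r.lab x)
    (C := fun y => N.Conn {w | o w ≤ o (N.src y)} (N.src (r.lab x)) (N.src y))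
    Relation.ReflTransGen.refl (by
      intro y _ hys ih
      rw [r.src_nxt y hys]
      have hlt := ho.2 y
      refine Relation.ReflTransGen.tail (ih.mono fun w (hw : o w ≤ _) => hw.trans hlt.le)
        ⟨hlt.le, le_refl (o (N.tgt y)), Or.inl ⟨y, rfl, rfl⟩⟩) (fun h a => hN.2.2.2.2 h a) x rfl
  exact key.mono fun w (hw : o w ≤ _) => hw.trans_lt (ho.2 x)

/-- The sink of its demand is reachable from every arc of a path. -/
theorem reach_snk (hN : N.Normalized) (ho : N.IsTopological o) (x : Fin N.m)
    (hx : N.src (r.lab x) = N.org h) : Relation.ReflTransGen N.Adj (N.tgt x) (N.snk h) := by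
  induction hn : Finset.univ.sup o - o (N.tgt x) using Nat.strong_induction_on generalizing x with
  | _ n ih =>
  by_cases hs : ∃ j, N.tgt x = N.snk j
  · obtain ⟨j, hj⟩ := hs
    rw [hj, ← hN.1 (hx.symm.trans (r.src_lab_of_tgt x j hj))]
  · push Not at hs
    have h1 := r.src_nxt x hs
    have h2 := ho.2 (r.nxt x)
    have h3 : o (N.tgt (r.nxt x)) ≤ Finset.univ.sup o := Finset.le_sup (Finset.mem_univ _)
    rw [h1] at h2
    refine Relation.ReflTransGen.head ⟨r.nxt x, h1, rfl⟩ (ih _ ?_ _ ?_ rfl)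
    · omega
    · rw [r.lab_nxt x hs, hx]

/-- The arc `z` leaves the head of `x` and leads to the sink `h`. -/
def Leads (x : Fin N.m) (h : Fin N.k) (z : Fin N.m) : Prop :=
  N.src z = N.tgt x ∧ Relation.ReflTransGen N.Adj (N.tgt z) (N.snk h)

theorem leads_nxt (hN : N.Normalized) (ho : N.IsTopological o) {x : Fin N.m}
    (hx : N.src (r.lab x) = N.org h) (hxs : ∀ h, N.tgt x ≠ N.snk h) : Leads x h (r.nxt x) :=
  ⟨r.src_nxt x hxs, reach_snk hN ho (r.nxt x) (by rw [r.lab_nxt x hxs, hx])⟩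

/-- Some arcs that lead from the head of `x` to the sink `h` come before `y` and some come after `y`
when turning from `x`. -/
structure Mixed (h : Fin N.k) (x y : Fin N.m) : Prop where
  after : ∃ z, Leads x h z ∧
    cdist N.rot (x, true) (y, true) < cdist N.rot (x, true) (z, false)
  before : ∃ z, Leads x h z ∧
    cdist N.rot (x, true) (z, false) < cdist N.rot (x, true) (y, true)

variable (r) in
open Classical in
/-- The rank of `x`, counted from `y`, among the arcs that enter its head and belong to the same
demand. -/
noncomputable def rank (x y : Fin N.m) : ℕ :=
  (Finset.univ.filter fun x' => N.tgt x' = N.tgt x ∧ N.src (r.lab x') = N.src (r.lab x) ∧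
    cdist N.rot (y, true) (x', true) ≤ cdist N.rot (y, true) (x, true)).card

theorem rank_pos (x y : Fin N.m) : 0 < r.rank x y :=
  Finset.card_pos.2 ⟨x, Finset.mem_filter.2 ⟨Finset.mem_univ _, rfl, rfl, le_rfl⟩⟩

theorem rank_le (hEu : N.Eulerian) (hN : N.Normalized) {x y : Fin N.m}
    (hx : N.src (r.lab x) = N.org h) : r.rank x y ≤ N.req h := by
  rw [← card_out_org hEu hN h]
  refine Finset.card_le_card_of_injOn r.lab ?_ ?_
  · intro x' hx'
    simp only [Finset.coe_filter, Finset.mem_univ, true_and, Set.mem_ofPred_eq] at hx' ⊢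
    exact hx'.2.1.trans hx
  · intro x' hx' x'' hx'' he
    simp only [Finset.coe_filter, Finset.mem_univ, true_and, Set.mem_ofPred_eq] at hx' hx''
    exact r.in_inj _ _ (hx'.1.trans hx''.1.symm) he

/-- If the arcs of `Mixed` surround `y`, then the two paths come from different components of the
past. -/
theorem Mixed.not_conn (hE : N.SphereEmbedding) (hN : N.Normalized) (ho : N.IsTopological o)
    {x y : Fin N.m} (hm : Meet x y) (hxy : Mixed h x y) (hx : N.src (r.lab x) = N.org h)
    (hy : N.src (r.lab y) = N.org h') :
    ¬ N.Conn (Past o (N.tgt x)) (N.org h) (N.org h') := by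
  intro hc
  obtain ⟨⟨z, ⟨hz, hzt⟩, hlt⟩, ⟨z', ⟨hz', hzt'⟩, hlt'⟩⟩ := hxy
  have cx := conn_past (r := r) hN ho x
  have cy := conn_past (r := r) hN ho y
  rw [hx] at cx
  rw [hy, ← hm.1] at cy
  have := (not_separated_future hE ho hm.1 hz hz'
    (Relation.ReflTransGen.trans cx.symm (Relation.ReflTransGen.trans hc cy)) hzt hzt').1 hlt
  omega

/-- There is at most one vertex where a given pair of demands is mixed. -/
theorem Mixed.tgt_unique (hE : N.SphereEmbedding) (hN : N.Normalized) (ho : N.IsTopological o)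
    {x y x₁ y₁ : Fin N.m} (hm : Meet x y) (hm₁ : Meet x₁ y₁) (hxy : Mixed h x y)
    (hxy₁ : Mixed h x₁ y₁) (hx : N.src (r.lab x) = N.org h) (hy : N.src (r.lab y) = N.org h')
    (hx₁ : N.src (r.lab x₁) = N.org h) (hy₁ : N.src (r.lab y₁) = N.org h') :
    N.tgt x = N.tgt x₁ := by
  have key : ∀ {x y x₁ y₁ : Fin N.m}, Meet x y → Meet x₁ y₁ → Mixed h x₁ y₁ →
      N.src (r.lab x) = N.org h → N.src (r.lab y) = N.org h' → N.src (r.lab x₁) = N.org h →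
      N.src (r.lab y₁) = N.org h' → ¬ o (N.tgt x) < o (N.tgt x₁) := by
    intro x y x₁ y₁ hm hm₁ hxy₁ hx hy hx₁ hy₁ hlt
    refine hxy₁.not_conn hE hN ho hm₁ hx₁ hy₁ ?_
    have cx := (conn_past (r := r) hN ho x).mono
      (B := Past o (N.tgt x₁)) fun w (hw : o w < _) => hw.trans hlt
    have cy := (conn_past (r := r) hN ho y).mono
      (B := Past o (N.tgt x₁)) fun w (hw : o w < _) => hw.trans (hm.1 ▸ hlt)
    rw [hx] at cx
    rw [hy] at cy
    refine Relation.ReflTransGen.trans (cx.tail ⟨?_, hlt, Or.inl ⟨x, rfl, rfl⟩⟩)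
      (Relation.ReflTransGen.head ⟨hlt, ?_, Or.inr ⟨y, rfl, hm.1.symm⟩⟩ cy.symm)
    · exact (ho.2 x).trans hlt
    · exact (ho.2 y).trans (hm.1 ▸ hlt)
  refine ho.1 (le_antisymm (not_lt.1 ?_) (not_lt.1 ?_))
  · exact key hm₁ hm hxy hx₁ hy₁ hx hy
  · exact key hm hm₁ hxy₁ hx hy hx₁ hy₁

/-- At a vertex where a pair of demands is mixed, going to the left is monotone in the rank. -/
theorem Mixed.inside_of_rank_le (hE : N.SphereEmbedding) (hN : N.Normalized)
    (ho : N.IsTopological o) (hr : r.IsUncrossed o) {x y x₁ y₁ : Fin N.m} (hm : Meet x y)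
    (hm₁ : Meet x₁ y₁) (hxy : Mixed h x y) (hxy₁ : Mixed h x₁ y₁) (hx : N.src (r.lab x) = N.org h)
    (hy : N.src (r.lab y) = N.org h') (hx₁ : N.src (r.lab x₁) = N.org h)
    (hy₁ : N.src (r.lab y₁) = N.org h') (hi : r.Inside x₁ (y₁, true))
    (hle : r.rank x y ≤ r.rank x₁ y₁) : r.Inside x (y, true) := by
  have hv := hxy.tgt_unique hE hN ho hm hm₁ hxy₁ hx hy hx₁ hy₁
  have hnc := hxy.not_conn hE hN ho hm hx hy
  have cpast : ∀ a j, N.tgt a = N.tgt x → N.src (r.lab a) = N.org j →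
      N.Conn (Past o (N.tgt x)) (N.org j) (N.src a) := by
    intro a j ha hj
    have := conn_past (r := r) hN ho a
    rwa [ha, hj] at this
  have hyv := hm.1.symm
  have hx₁v := hv.symm
  have hy₁v := hm₁.1.symm.trans hv.symm
  have vx := r.src_nxt x hm.2
  have vx₁ := (r.src_nxt x₁ hm₁.2).trans hx₁v
  obtain ⟨L, hlt, hinj, h0, hd⟩ := exists_distances hE x
  have hne : ∀ a b, N.src (r.lab a) = N.org h → N.src (r.lab b) = N.org h' → a ≠ b := by
    rintro a b ha hb rfl
    refine hnc ?_
    rw [← ha, hb]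
    exact Relation.ReflTransGen.refl
  -- the arcs of the other demand are not separated by those of the first demand
  have sep : ∀ a, N.tgt a = N.tgt x → N.src (r.lab a) = N.org h →
      (cdist N.rot (x, true) (a, true) < cdist N.rot (x, true) (y, true) ↔
        cdist N.rot (x, true) (a, true) < cdist N.rot (x, true) (y₁, true)) := fun a ha haj =>
    not_separated_past hE ho ha hyv hy₁v (cpast x h rfl hx) (cpast a h ha haj) (cpast y h' hyv hy)
      (cpast y₁ h' hy₁v hy₁) hnc
  have ly := hlt (y, true) hyv
  have ly₁ := hlt (y₁, true) hy₁v
  have py := hinj (x, true) (y, true) rfl hyv (by simpa using hne x y hx hy)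
  have py₁ := hinj (x, true) (y₁, true) rfl hy₁v (by simpa using hne x y₁ hx hy₁)
  have lx₁ := hlt (x₁, true) hx₁v
  rw [h0] at py py₁
  -- the rank does not depend on the arc from which it is counted
  have rank_eq : r.rank x y = r.rank x y₁ := by
    unfold rank
    congr 1
    refine Finset.filter_congr fun a _ => and_congr_right fun ha => and_congr_right fun haj => ?_
    have s := sep a ha (haj.trans hx)
    have la := hlt (a, true) ha
    have i1 := hinj (a, true) (y, true) ha hyv (by simpa using hne a y (haj.trans hx) hy)
    have i2 := hinj (a, true) (y₁, true) ha hy₁v (by simpa using hne a y₁ (haj.trans hx) hy₁)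
    rw [hd (y, true) (a, true) hyv ha, hd (y, true) (x, true) hyv rfl,
      hd (y₁, true) (a, true) hy₁v ha, hd (y₁, true) (x, true) hy₁v rfl, h0]
    split_ifs <;> omega
  -- hence `x` does not come after `x₁` when turning from `y₁`
  have order : cdist N.rot (y₁, true) (x, true) ≤ cdist N.rot (y₁, true) (x₁, true) := by
    by_contra hlt'
    have : r.rank x₁ y₁ < r.rank x y₁ := by
      refine Finset.card_lt_card ⟨?_, fun hsub => ?_⟩
      · intro a ha
        rw [Finset.mem_filter] at ha ⊢
        exact ⟨Finset.mem_univ _, ha.2.1.trans hx₁v, (ha.2.2.1.trans hx₁).trans hx.symm, by omega⟩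
      · have := hsub (Finset.mem_filter.2 ⟨Finset.mem_univ x, rfl, rfl, le_rfl⟩)
        rw [Finset.mem_filter] at this
        omega
    omega
  have sx₁ := sep x₁ hx₁v hx₁
  obtain ⟨z₂, hz₂, hlt₂⟩ := hxy.after
  have cx₁ : N.Conn (Past o (N.tgt x)) (N.src x) (N.src x₁) :=
    Relation.ReflTransGen.trans (cpast x h rfl hx).symm (cpast x₁ h hx₁v hx₁)
  have cy : N.Conn (Past o (N.tgt y₁)) (N.src y₁) (N.src y) := by
    rw [hy₁v]
    exact Relation.ReflTransGen.trans (cpast y₁ h' hy₁v hy₁).symm (cpast y h' hyv hy)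
  have l1 := leads_nxt (r := r) hN ho hx hm.2
  have l2 := leads_nxt (r := r) hN ho hx₁ hm₁.2
  -- all the arcs that lead to the sink lie on the same side of `x` and `x₁`, and of `y` and `y₁`
  have f1 := not_separated_future hE ho hv l1.1 hz₂.1 cx₁ l1.2 hz₂.2
  have f2 := not_separated_future hE ho hv vx₁ hz₂.1 cx₁ l2.2 hz₂.2
  have f3 := not_separated_future hE ho (hy₁v.trans hyv.symm) (vx₁.trans hy₁v.symm)
    (hz₂.1.trans hy₁v.symm) cy l2.2 hz₂.2
  -- and the paths of `x` and `x₁` do not cross; what remains is a comparison of positions around the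
  -- vertex
  have cr : x ≠ x₁ → ¬ r.Cross x x₁ := fun hne => hr.same x x₁ ⟨hv, hm.2⟩ hne (hx.trans hx₁.symm)
  have i3 := hinj (y₁, true) (r.nxt x₁, false) hy₁v vx₁ (by simp)
  have i4 := hinj (y, true) (r.nxt x₁, false) hyv vx₁ (by simp)
  have i5 := hinj (x₁, true) (y₁, true) hx₁v hy₁v (by simpa using hne x₁ y₁ hx₁ hy₁)
  rw [hd (y₁, true) (y, true) hy₁v hyv, hd (y₁, true) (r.nxt x₁, false) hy₁v vx₁,
    hd (y₁, true) (z₂, false) hy₁v hz₂.1] at f3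
  rw [hd (y₁, true) (x, true) hy₁v rfl, hd (y₁, true) (x₁, true) hy₁v hx₁v, h0] at order
  unfold Inside at hi ⊢
  rw [hd (x₁, true) (y₁, true) hx₁v hy₁v, hd (x₁, true) (r.nxt x₁, false) hx₁v vx₁] at hi
  have lM := hlt (r.nxt x₁, false) vx₁
  by_cases hxx : x = x₁
  · subst hxx
    rw [h0] at *
    generalize cdist N.rot (x, true) (y, true) = β at *
    generalize cdist N.rot (x, true) (y₁, true) = β₁ at *
    generalize cdist N.rot (x, true) (r.nxt x, false) = μ at *
    generalize cdist N.rot (x, true) (z₂, false) = ζ at *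
    clear hd hlt hinj sep cpast hne
    by_contra hcon
    split_ifs at f3 hi order <;> omega
  · have cr' := cr hxx
    unfold Cross Inside at cr'
    have i0 := hinj (x, true) (x₁, true) rfl hx₁v (by simpa using hxx)
    rw [h0] at i0
    generalize cdist N.rot (x, true) (y, true) = β at *
    generalize cdist N.rot (x, true) (y₁, true) = β₁ at *
    generalize cdist N.rot (x, true) (x₁, true) = α at *
    generalize cdist N.rot (x, true) (r.nxt x, false) = μ at *
    generalize cdist N.rot (x, true) (r.nxt x₁, false) = μ₁ at *
    generalize cdist N.rot (x, true) (z₂, false) = ζ at *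
    clear hd hlt hinj sep cpast hne
    by_contra hcon
    split_ifs at f3 hi order <;> omega

/-- For every ordered pair of demands, one number tells which paths go to the left at the vertex
where the pair is mixed. -/
theorem exists_threshold (hE : N.SphereEmbedding) (hEu : N.Eulerian) (hN : N.Normalized)
    (ho : N.IsTopological o) (hr : r.IsUncrossed o) :
    ∃ τ : Fin N.k → Fin N.k → ℕ, (∀ h h', τ h h' ≤ N.req h) ∧
      ∀ h h' x y, Meet x y → Mixed h x y → N.src (r.lab x) = N.org h → N.src (r.lab y) = N.org h' →
        (r.Inside x (y, true) ↔ r.rank x y ≤ τ h h') := by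
  classical
  let E : Fin N.k → Fin N.k → Finset (Fin N.m × Fin N.m) := fun h h' =>
    Finset.univ.filter fun e => Meet e.1 e.2 ∧ Mixed h e.1 e.2 ∧
      N.src (r.lab e.1) = N.org h ∧ N.src (r.lab e.2) = N.org h' ∧ r.Inside e.1 (e.2, true)
  refine ⟨fun h h' => (E h h').sup fun e => r.rank e.1 e.2, fun h h' => ?_, ?_⟩
  · refine Finset.sup_le fun e he => ?_
    exact rank_le hEu hN (Finset.mem_filter.1 he).2.2.2.1
  · intro h h' x y hm hmix hx hy
    constructor
    · intro hi
      exact Finset.le_sup (f := fun e : Fin N.m × Fin N.m => r.rank e.1 e.2) (b := (x, y))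
        (Finset.mem_filter.2 ⟨Finset.mem_univ _, hm, hmix, hx, hy, hi⟩)
    · intro hle
      have hne : (E h h').Nonempty := by
        by_contra hemp
        rw [Finset.not_nonempty_iff_eq_empty] at hemp
        simp only [hemp, Finset.sup_empty] at hle
        exact absurd (rank_pos (r := r) x y) (not_lt.2 hle)
      obtain ⟨e, he, hmax⟩ := Finset.exists_mem_eq_sup _ hne fun e => r.rank e.1 e.2
      change _ ≤ (E h h').sup _ at hle
      rw [hmax] at hle
      obtain ⟨-, h1, h2, h3, h4, h5⟩ := Finset.mem_filter.1 he
      exact hmix.inside_of_rank_le hE hN ho hr hm h1 h2 hx hy h3 h4 h5 hle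

end Routing

end Network

/-! ### The behaviour of paths in terms of the routing -/

namespace Network

variable {N : Network}

namespace Routing

variable {r : N.Routing} {o : Fin N.n → ℕ} {h h' : Fin N.k}

variable (r) in
/-- The number of the behaviour of the path of `x` relative to the one of `y` at their common
head. -/
noncomputable def code (x y : Fin N.m) : ℕ := by
  classical
  exact if r.Cross x y then 1 else if r.Inside x (y, true) then 2 else 3

variable (r) in
/-- The paths of `x` and `y` have a common vertex before the head of `x`. -/
def MetBefore (o : Fin N.n → ℕ) (x y : Fin N.m) : Prop :=
  ∃ x' y', r.lab x' = r.lab x ∧ r.lab y' = r.lab y ∧ N.tgt x' = N.tgt y' ∧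
    o (N.tgt x') < o (N.tgt x)

variable (r) in
/-- The common head of `x` and `y` is the first common vertex of their paths, which satisfy
different demands. -/
def FirstMeet (o : Fin N.n → ℕ) (x y : Fin N.m) : Prop :=
  N.tgt x = N.tgt y ∧ N.src (r.lab x) ≠ N.src (r.lab y) ∧ ¬ r.MetBefore o x y

/-- The paths of different demands have no common end. -/
theorem meet_of_ne {x y : Fin N.m} (ht : N.tgt x = N.tgt y)
    (hne : N.src (r.lab x) ≠ N.src (r.lab y)) : Meet x y := by
  refine ⟨ht, fun h hh => hne ?_⟩
  rw [r.src_lab_of_tgt x h hh, r.src_lab_of_tgt y h (ht ▸ hh)]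

theorem FirstMeet.unique (ho : N.IsTopological o) {x y x' y' : Fin N.m} (h : r.FirstMeet o x y)
    (h' : r.FirstMeet o x' y') (hx : r.lab x' = r.lab x) (hy : r.lab y' = r.lab y) :
    x' = x ∧ y' = y := by
  have h1 : ¬ o (N.tgt x') < o (N.tgt x) := fun hlt => h.2.2 ⟨x', y', hx, hy, h'.1, hlt⟩
  have h2 : ¬ o (N.tgt x) < o (N.tgt x') := fun hlt => h'.2.2 ⟨x, y, hx.symm, hy.symm, h.1, hlt⟩
  have ht := ho.1 (le_antisymm (not_lt.1 h2) (not_lt.1 h1))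
  exact ⟨r.in_inj _ _ ht hx, r.in_inj _ _ (h'.1.symm.trans (ht.trans h.1)) hy⟩

theorem cross_iff (ho : N.IsTopological o) (hr : r.IsUncrossed o) {x y : Fin N.m}
    (hm : Meet x y) (hxy : x ≠ y) :
    r.Cross x y ↔ N.src (r.lab x) ≠ N.src (r.lab y) ∧ ¬ r.MetBefore o x y ∧
      r.Crosses (r.lab x) (r.lab y) := by
  constructor
  · intro hc
    refine ⟨fun he => hr.same x y hm hxy he hc, ?_, x, y, rfl, rfl, hm, hc⟩
    rintro ⟨x', y', hx, hy, ht, hlt⟩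
    exact absurd (hr.first x y x' y' hm hxy hc hx hy ht) (not_le.2 hlt)
  · rintro ⟨hne, hmet, x', y', hx, hy, hm', hc⟩
    have hxy' : x' ≠ y' := by
      rintro rfl
      exact hne (by rw [← hx, ← hy])
    have f' : r.FirstMeet o x' y' := by
      refine ⟨hm'.1, by rwa [hx, hy], ?_⟩
      rintro ⟨x'', y'', hx'', hy'', ht, hlt⟩
      exact absurd (hr.first x' y' x'' y'' hm' hxy' hc hx'' hy'' ht) (not_le.2 hlt)
    obtain ⟨rfl, rfl⟩ := FirstMeet.unique (r := r) ho ⟨hm.1, hne, hmet⟩ f' hx hy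
    exact hc

/-- Paths that do not cross: if all the arcs that lead to the sink of the first path are on the same
side of the second path, then the first path leaves on that side. -/
theorem inside_iff (hN : N.Normalized) (ho : N.IsTopological o)
    {τ : Fin N.k → Fin N.k → ℕ}
    (hτ : ∀ h h' x y, Meet x y → Mixed h x y → N.src (r.lab x) = N.org h →
      N.src (r.lab y) = N.org h' → (r.Inside x (y, true) ↔ r.rank x y ≤ τ h h'))
    {x y : Fin N.m} (hm : Meet x y) (hx : N.src (r.lab x) = N.org h)
    (hy : N.src (r.lab y) = N.org h') (hE : N.SphereEmbedding) :
    r.Inside x (y, true) ↔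
      ((¬ ∃ z, Leads x h z ∧
        cdist N.rot (x, true) (z, false) < cdist N.rot (x, true) (y, true)) ∨
      ((∃ z, Leads x h z ∧ cdist N.rot (x, true) (y, true) < cdist N.rot (x, true) (z, false)) ∧
        r.rank x y ≤ τ h h')) := by
  have hl := leads_nxt (r := r) hN ho hx hm.2
  have hne : cdist N.rot (x, true) (y, true) ≠ cdist N.rot (x, true) (r.nxt x, false) := by
    obtain ⟨L, -, hinj, -, -⟩ := exists_distances hE x
    exact hinj _ _ hm.1.symm hl.1 (by simp)
  by_cases hB : ∃ z, Leads x h z ∧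
      cdist N.rot (x, true) (z, false) < cdist N.rot (x, true) (y, true)
  · simp only [hB, not_true_eq_false, false_or]
    by_cases hA : ∃ z, Leads x h z ∧
        cdist N.rot (x, true) (y, true) < cdist N.rot (x, true) (z, false)
    · simp only [hA, true_and]
      exact hτ h h' x y hm ⟨hA, hB⟩ hx hy
    · simp only [hA, false_and, iff_false]
      exact fun hi => hA ⟨_, hl, hi⟩
  · simp only [hB, not_false_eq_true, true_or, iff_true]
    by_contra hi
    unfold Inside at hi
    exact hB ⟨_, hl, by omega⟩

end Routing

variable {S : Finset (List (Fin N.m))} {o : Fin N.n → ℕ} {P Q : List (Fin N.m)}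

/-- The relation between the paths of a solution and a routing. -/
def Traces (N : Network) (S : Finset (List (Fin N.m))) (r : N.Routing) : Prop :=
  (∀ P ∈ S, ∃ p h, P.head? = some p ∧ N.src p = N.org h ∧ N.Satisfies P h ∧
    ∀ a, a ∈ P ↔ r.lab a = p) ∧
  ∀ p h, N.src p = N.org h → ∃ P ∈ S, P.head? = some p ∧ N.Satisfies P h ∧ ∀ a, a ∈ P ↔ r.lab a = p

theorem IsSolution.exists_traces (ho : N.IsTopological o) (hEu : N.Eulerian)
    (hN : N.Normalized) (hS : N.IsSolution S) : ∃ r, N.Traces S r := by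
  obtain ⟨r, hr⟩ := hS.exists_routing ho hEu hN
  refine ⟨r, fun P hP => ?_, fun p h hp => ?_⟩
  · obtain ⟨p, h1, ⟨h, h2, h3⟩, h4⟩ := hr P hP
    exact ⟨p, h, h1, h2, h3, h4⟩
  · obtain ⟨P, hP, h1, h2⟩ := hS.exists_path_of_start hEu hN hp
    obtain ⟨p', h3, -, h4⟩ := hr P hP
    rw [h2] at h3
    cases h3
    exact ⟨P, hP, h2, h1, h4⟩

theorem IsPath.reach (hP : N.IsPath P) {a b : Fin N.m} (ha : a ∈ P) (hb : b ∈ P) :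
    Relation.ReflTransGen N.Adj (N.tgt a) (N.tgt b) ∨
      Relation.ReflTransGen N.Adj (N.tgt b) (N.tgt a) := by
  by_cases hab : a = b
  · exact Or.inl (hab ▸ Relation.ReflTransGen.refl)
  have h1 : P.IsChain fun a b => Relation.ReflTransGen N.Adj (N.tgt a) (N.tgt b) :=
    hP.2.2.imp fun a b hab => Relation.ReflTransGen.single ⟨b, hab.symm, rfl⟩
  have tr : IsTrans (Fin N.m) fun a b => Relation.ReflTransGen N.Adj (N.tgt a) (N.tgt b) :=
    ⟨fun a b c h h' => h.trans h'⟩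
  have h2 := List.isChain_iff_pairwise.1 h1
  have : Std.Symm fun a b : Fin N.m => Relation.ReflTransGen N.Adj (N.tgt a) (N.tgt b) ∨
      Relation.ReflTransGen N.Adj (N.tgt b) (N.tgt a) := ⟨fun _ _ h => h.symm⟩
  exact List.Pairwise.forall (R := fun a b : Fin N.m =>
    Relation.ReflTransGen N.Adj (N.tgt a) (N.tgt b) ∨
      Relation.ReflTransGen N.Adj (N.tgt b) (N.tgt a)) (h2.imp fun h => Or.inl h) ha hb hab

theorem IsTopological.le_of_reach (ho : N.IsTopological o) {u w : Fin N.n}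
    (h : Relation.ReflTransGen N.Adj u w) : o u ≤ o w := by
  induction h with
  | refl => exact le_rfl
  | tail _ h ih =>
    obtain ⟨a, rfl, rfl⟩ := h
    exact ih.trans (ho.2 a).le

variable {r : N.Routing} {p q : Fin N.m}

open Routing

/-- The condition on the routing that corresponds to a behaviour. -/
def _root_.Behaviour.Cond (r : N.Routing) (x y : Fin N.m) : Behaviour → Prop
  | .cross => r.Cross x y
  | .left => r.Left x y
  | .right => ¬ r.Inside x (y, true) ∧ ¬ r.Inside x (r.nxt y, false)

theorem hasBehaviour_iff (hE : N.SphereEmbedding) (hN : N.Normalized) (hP : ∀ a, a ∈ P ↔ r.lab a = p)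
    (hQ : ∀ a, a ∈ Q ↔ r.lab a = q) (hpq : p ≠ q) (v : Fin N.n) (β : Behaviour) :
    N.HasBehaviour P Q v β ↔ ∃ x y, r.lab x = p ∧ r.lab y = q ∧ Meet x y ∧ N.tgt x = v ∧
      β.Cond r x y := by
  have key : ∀ x y, r.lab x = p → r.lab y = q → Meet x y →
      ((match β with
        | .cross => ¬ ((Between N.rot (y, true) (x, true) (r.nxt y, false) ∧
              Between N.rot (y, true) (r.nxt x, false) (r.nxt y, false)) ∨
            (Between N.rot (r.nxt y, false) (x, true) (y, true) ∧
              Between N.rot (r.nxt y, false) (r.nxt x, false) (y, true)))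
        | .right => BeforeIn N.rot (y, true) (x, true) (r.nxt x, false) (r.nxt y, false) ∨
            BeforeIn N.rot (r.nxt y, false) (x, true) (r.nxt x, false) (y, true)
        | .left => BeforeIn N.rot (y, true) (r.nxt x, false) (x, true) (r.nxt y, false) ∨
            BeforeIn N.rot (r.nxt y, false) (r.nxt x, false) (x, true) (y, true)) ↔
        β.Cond r x y) := by
    intro x y hx hy hm
    have hxy : x ≠ y := ne_of_apply_ne r.lab (by rwa [hx, hy])
    have vx := r.src_nxt x hm.2
    have vy := (r.src_nxt y hm.symm.2).trans hm.1.symm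
    have hM := mt (r.nxt_inj hm.2 hm.1) hxy
    obtain ⟨k1, k2, k3⟩ := behaviour_iff (hE.sameCycle (d := (x, true)) (e := (r.nxt x, false)) vx.symm)
      (hE.sameCycle (d := (x, true)) (e := (y, true)) hm.1)
      (hE.sameCycle (d := (x, true)) (e := (r.nxt y, false)) vy.symm)
      (by simp) (by simpa using hxy) (by simp) (by simp) (by simpa using hM) (by simp)
    cases β
    · exact k1
    · exact k2
    · exact k3
  constructor
  · rintro ⟨x, x', y, y', ⟨h1, h2, h3, h4⟩, ⟨h5, h6, h7, h8⟩, hβ⟩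
    rw [hP] at h1 h2
    rw [hQ] at h5 h6
    have hv : ∀ h, v ≠ N.snk h := fun h hh => hN.2.2.2.2 h x' (h4.trans hh)
    have hm : Meet x y := ⟨h3.trans h7.symm, fun h => h3.symm ▸ hv h⟩
    have e1 : x' = r.nxt x := r.out_inj _ _ (h4.trans (h3.symm.trans (r.src_nxt x hm.2).symm))
      (h2.trans (h1.symm.trans (r.lab_nxt x hm.2).symm))
    have e2 : y' = r.nxt y := r.out_inj _ _
      (h8.trans (h7.symm.trans (r.src_nxt y hm.symm.2).symm))
      (h6.trans (h5.symm.trans (r.lab_nxt y hm.symm.2).symm))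
    subst e1 e2
    exact ⟨x, y, h1, h5, hm, h3, (key x y h1 h5 hm).1 hβ⟩
  · rintro ⟨x, y, hx, hy, hm, rfl, hβ⟩
    exact ⟨x, r.nxt x, y, r.nxt y,
      ⟨(hP x).2 hx, (hP _).2 ((r.lab_nxt x hm.2).trans hx), rfl, r.src_nxt x hm.2⟩,
      ⟨(hQ y).2 hy, (hQ _).2 ((r.lab_nxt y hm.symm.2).trans hy), hm.1.symm,
        (r.src_nxt y hm.symm.2).trans hm.1.symm⟩, (key x y hx hy hm).2 hβ⟩

theorem Traces.isUncrossed (hE : N.SphereEmbedding) (hN : N.Normalized) (ho : N.IsTopological o)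
    (hr : N.Traces S r) (hU : N.Uncrossed S) : r.IsUncrossed o := by
  have key : ∀ x y, Meet x y → x ≠ y → ∃ P ∈ S, ∃ Q ∈ S, P ≠ Q ∧ N.IsOrigin P (N.src (r.lab x)) ∧
      N.IsOrigin Q (N.src (r.lab y)) ∧ (∀ a, a ∈ P ↔ r.lab a = r.lab x) ∧
      (∀ a, a ∈ Q ↔ r.lab a = r.lab y) ∧
      (r.Cross x y → N.HasBehaviour P Q (N.tgt x) .cross) := by
    intro x y hm hxy
    obtain ⟨h, hh⟩ := r.src_lab x
    obtain ⟨h', hh'⟩ := r.src_lab y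
    obtain ⟨P, hP, h1, h2, h3⟩ := hr.2 _ _ hh
    obtain ⟨Q, hQ, g1, g2, g3⟩ := hr.2 _ _ hh'
    have hl : r.lab x ≠ r.lab y := mt (r.in_inj x y hm.1) hxy
    refine ⟨P, hP, Q, hQ, ?_, ⟨_, h1, rfl⟩, ⟨_, g1, rfl⟩, h3, g3, fun hc => ?_⟩
    · rintro rfl
      rw [h1] at g1
      exact hl (Option.some.inj g1)
    · exact (hasBehaviour_iff hE hN h3 g3 hl _ _).2 ⟨x, y, rfl, rfl, hm, rfl, hc⟩
  constructor
  · intro x y hm hxy hs hc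
    obtain ⟨P, hP, Q, hQ, hne, h1, h2, -, -, h3⟩ := key x y hm hxy
    exact (hU P hP Q hQ hne).1 ⟨_, Or.inl h1, Or.inl (hs ▸ h2)⟩ _ (h3 hc)
  · intro x y x' y' hm hxy hc hx hy ht
    obtain ⟨P, hP, Q, hQ, hne, -, -, h1, h2, h3⟩ := key x y hm hxy
    have := ((hU P hP Q hQ hne).2 _ (h3 hc)).2.2 (N.tgt x') ⟨x', (h1 x').2 hx, Or.inr rfl⟩
      ⟨y', (h2 y').2 hy, Or.inr ht.symm⟩
    exact ho.le_of_reach this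

theorem firstCommon_iff (hE : N.SphereEmbedding) (hN : N.Normalized) (ho : N.IsTopological o)
    (hPath : N.IsPath P) (hpP : P.head? = some p) (hqQ : Q.head? = some q)
    (hp : N.src p = N.org h) (hP : ∀ a, a ∈ P ↔ r.lab a = p) (hQ : ∀ a, a ∈ Q ↔ r.lab a = q) (β : Behaviour) :
    (∃ v, N.IsFirstCommon P Q v ∧ N.HasBehaviour P Q v β) ↔
      ∃ x y, r.lab x = p ∧ r.lab y = q ∧ r.FirstMeet o x y ∧ β.Cond r x y := by
  have hpm : p ∈ P := List.mem_of_mem_head? hpP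
  have hqm : q ∈ Q := List.mem_of_mem_head? hqQ
  -- an inner vertex cannot be the first common vertex of two paths with the same origin
  have horg : ∀ v x, N.tgt x = v → N.IsFirstCommon P Q v → N.src p ≠ N.src q := by
    rintro v x hx hf he
    have hreach := hf.2.2 (N.src p) ⟨p, hpm, Or.inl rfl⟩ ⟨q, hqm, Or.inl he.symm⟩
    rcases Relation.ReflTransGen.cases_tail hreach with h1 | ⟨_, _, a, _, ha⟩
    · exact hN.2.2.2.1 h x (by rw [hx, ← h1, hp])
    · exact hN.2.2.2.1 h a (ha.trans hp)
  constructor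
  · rintro ⟨v, hf, hb⟩
    have hne : N.src p ≠ N.src q := by
      obtain ⟨x, _, _, _, hx, _⟩ := hb
      exact horg v x hx.2.2.1 hf
    obtain ⟨x, y, hx, hy, hm, rfl, hc⟩ :=
      (hasBehaviour_iff hE hN hP hQ (ne_of_apply_ne _ hne) v β).1 hb
    refine ⟨x, y, hx, hy, ⟨hm.1, by rwa [hx, hy], ?_⟩, hc⟩
    rintro ⟨x', y', hx', hy', ht, hlt⟩
    have := hf.2.2 (N.tgt x') ⟨x', (hP _).2 (hx'.trans hx), Or.inr rfl⟩
      ⟨y', (hQ _).2 (hy'.trans hy), Or.inr ht.symm⟩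
    exact absurd (ho.le_of_reach this) (not_le.2 hlt)
  · rintro ⟨x, y, hx, hy, hf, hc⟩
    have hne : N.src p ≠ N.src q := by
      have := hf.2.1
      rwa [hx, hy] at this
    have hm := meet_of_ne hf.1 hf.2.1
    refine ⟨N.tgt x, ⟨⟨x, (hP x).2 hx, Or.inr rfl⟩, ⟨y, (hQ y).2 hy, Or.inr hf.1.symm⟩, ?_⟩,
      (hasBehaviour_iff hE hN hP hQ (ne_of_apply_ne _ hne) _ β).2 ⟨x, y, hx, hy, hm, rfl, hc⟩⟩
    -- a vertex on a path is its origin or the head of one of its arcs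
    have hon : ∀ {P p w}, (∀ a, a ∈ P ↔ r.lab a = p) → N.OnPath P w →
        (∃ j, w = N.org j ∧ N.src p = N.org j) ∨ ∃ a, r.lab a = p ∧ N.tgt a = w := by
      rintro P p w hP ⟨a, ha, rfl | rfl⟩
      · by_cases hst : ∃ j, N.src a = N.org j
        · obtain ⟨j, hj⟩ := hst
          left
          refine ⟨j, hj, ?_⟩
          rw [← (hP a).1 ha, r.lab_start a j hj, hj]
        · push Not at hst
          obtain ⟨b, rfl, hb⟩ := r.exists_nxt a hst
          right
          refine ⟨b, ?_, hb⟩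
          rw [← (hP _).1 ha, r.lab_nxt b fun j hj => hN.2.2.2.2 j (r.nxt b) (hb.symm.trans hj)]
      · exact Or.inr ⟨a, (hP a).1 ha, rfl⟩
    intro w hwP hwQ
    rcases hon hP hwP with ⟨j, rfl, hj⟩ | ⟨a, ha, rfl⟩
    · rcases hon hQ hwQ with ⟨j', hj', hj2⟩ | ⟨b, -, hb⟩
      · exact absurd (hj.trans (hj'.trans hj2.symm)) hne
      · exact absurd hb (hN.2.2.2.1 j b)
    · rcases hon hQ hwQ with ⟨j', hj', -⟩ | ⟨b, hb, hab⟩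
      · exact absurd hj' (hN.2.2.2.1 j' a)
      · rcases hPath.reach ((hP x).2 hx) ((hP a).2 ha) with hre | hre
        · exact hre
        · have h1 := ho.le_of_reach hre
          have h2 : ¬ o (N.tgt a) < o (N.tgt x) := fun hlt =>
            hf.2.2 ⟨a, b, ha.trans hx.symm, hb.trans hy.symm, hab.symm, hlt⟩
          rw [ho.1 (le_antisymm h1 (not_lt.1 h2))]

/-- The values of the routing scheme that a solution respects. -/
theorem Traces.valueCode_eq (hE : N.SphereEmbedding) (hN : N.Normalized) (ho : N.IsTopological o)
    (hr : N.Traces S r) {ρ : N.RoutingScheme} (hρ : N.Respects S ρ) (a b : N.StartArc) :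
    (∀ x y, r.lab x = a.1 → r.lab y = b.1 → r.FirstMeet o x y →
      valueCode (ρ a b) = r.code x y) ∧
    ((¬ ∃ x y, r.lab x = a.1 ∧ r.lab y = b.1 ∧ r.FirstMeet o x y) → valueCode (ρ a b) = 0) := by
  obtain ⟨p, h, hp⟩ := a
  obtain ⟨q, h', hq⟩ := b
  obtain ⟨P, hP, h1, h2, h3⟩ := hr.2 p h hp
  obtain ⟨Q, hQ, g1, g2, g3⟩ := hr.2 q h' hq
  have key : ∀ β, ρ ⟨p, h, hp⟩ ⟨q, h', hq⟩ = some β ↔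
      ∃ x y, r.lab x = p ∧ r.lab y = q ∧ r.FirstMeet o x y ∧ β.Cond r x y := fun β =>
    (hρ P hP Q hQ ⟨p, h, hp⟩ ⟨q, h', hq⟩ h1 g1 β).trans
      (firstCommon_iff hE hN ho h2.1 h1 g1 hp h3 g3 β)
  constructor
  · intro x y hx hy hf
    unfold code
    split_ifs with c1 c2
    · rw [(key .cross).2 ⟨x, y, hx, hy, hf, c1⟩]
      rfl
    · rw [(key .left).2 ⟨x, y, hx, hy, hf, c2, ?_⟩]
      · rfl
      · by_contra c3
        exact c1 ⟨fun _ => c3, fun _ => c2⟩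
    · rw [(key .right).2 ⟨x, y, hx, hy, hf, c2, ?_⟩]
      · rfl
      · intro c3
        exact c1 ⟨fun h => absurd h c2, fun h => absurd c3 h⟩
  · intro hno
    cases hv : ρ ⟨p, h, hp⟩ ⟨q, h', hq⟩ with
    | none => rfl
    | some β =>
      obtain ⟨x, y, hx, hy, hf, -⟩ := (key β).1 hv
      exact absurd ⟨x, y, hx, hy, hf⟩ hno

end Network

/-! ### Expressions for the algorithm -/

namespace TExpr

/-! A condition is an expression; it holds if the value is not zero. The truncated subtraction makes
comparisons expressible. -/

def less (a b : TExpr) : TExpr := .sub b a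

def leq (a b : TExpr) : TExpr := .sub (.add b (.lit 1)) a

def equ (a b : TExpr) : TExpr := .sub (.lit 1) (.add (.sub a b) (.sub b a))

def conj (a b : TExpr) : TExpr := .ite a b (.lit 0)

def neg (a : TExpr) : TExpr := .sub (.lit 1) a

def bicond (a b : TExpr) : TExpr := .ite a b (neg b)

/-- The global parameter. -/
def size : TExpr := .sum 1 0 (.lit 1)

/-- The number of values of the variable `x` below the `d`-th power of the global parameter that
satisfy a condition. -/
def count (d : Fin 4) (x : ℕ) (c : TExpr) : TExpr := .sum d x (.ite c (.lit 1) (.lit 0))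

/-- A sum over the values of the variable `x` below the entry `j` of the table `0`. -/
def sumBelow (j x : ℕ) (e : TExpr) : TExpr :=
  .sum 1 x (.ite (less (.var x) (.rd 0 (.lit j))) e (.lit 0))

def countBelow (j x : ℕ) (c : TExpr) : TExpr := sumBelow j x (.ite c (.lit 1) (.lit 0))

section Eval

variable (W : ℕ) (s : ℕ → ℕ → ℕ) (v : ℕ → ℕ) (a b : TExpr)

@[simp] theorem eval_less : (less a b).eval W s v ≠ 0 ↔ a.eval W s v < b.eval W s v := by
  simp only [less, eval]; omega

@[simp] theorem eval_leq : (leq a b).eval W s v ≠ 0 ↔ a.eval W s v ≤ b.eval W s v := by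
  simp only [leq, eval]; omega

@[simp] theorem eval_equ : (equ a b).eval W s v ≠ 0 ↔ a.eval W s v = b.eval W s v := by
  simp only [equ, eval]; omega

@[simp] theorem eval_conj :
    (conj a b).eval W s v ≠ 0 ↔ a.eval W s v ≠ 0 ∧ b.eval W s v ≠ 0 := by
  simp only [conj, eval]; split_ifs with h <;> simp [h]

@[simp] theorem eval_neg : (neg a).eval W s v ≠ 0 ↔ ¬ a.eval W s v ≠ 0 := by
  simp only [neg, eval]; omega

@[simp] theorem eval_bicond :
    (bicond a b).eval W s v ≠ 0 ↔ (a.eval W s v ≠ 0 ↔ b.eval W s v ≠ 0) := by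
  simp only [bicond, eval]
  split_ifs with h
  · simp [h]
  · rw [eval_neg]; simp [h]

@[simp] theorem eval_size : size.eval W s v = W := by
  simp [size, eval]

theorem eval_count (d : Fin 4) (x : ℕ) (c : TExpr) : (count d x c).eval W s v =
    ((Finset.range (W ^ (d : ℕ))).filter fun i => c.eval W s (Function.update v x i) ≠ 0).card := by
  simp only [count, eval]
  rw [Finset.card_filter]

@[simp] theorem eval_count_ne_zero (d : Fin 4) (x : ℕ) (c : TExpr) : (count d x c).eval W s v ≠ 0 ↔
    ∃ i < W ^ (d : ℕ), c.eval W s (Function.update v x i) ≠ 0 := by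
  rw [eval_count, Finset.card_ne_zero]
  simp [Finset.Nonempty]

variable {W s}

theorem eval_sumBelow {j n : ℕ} (hj : s 0 j = n) (hn : n ≤ W) (x : ℕ) (e : TExpr) :
    (sumBelow j x e).eval W s v = ∑ i : Fin n, e.eval W s (Function.update v x i) := by
  simp only [sumBelow, eval, eval_less, Function.update_self, hj, Fin.val_one, pow_one]
  rw [← Finset.sum_filter, ← Finset.sum_range (fun i => e.eval W s (Function.update v x i))]
  refine Finset.sum_congr ?_ fun _ _ => rfl
  ext i
  simp only [Finset.mem_filter, Finset.mem_range]
  omega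

theorem eval_countBelow {j n : ℕ} (hj : s 0 j = n) (hn : n ≤ W) (x : ℕ) (c : TExpr) :
    (countBelow j x c).eval W s v =
      (Finset.univ.filter fun i : Fin n => c.eval W s (Function.update v x i) ≠ 0).card := by
  rw [countBelow, eval_sumBelow v hj hn, Finset.card_filter]
  rfl

theorem eval_countBelow_ne_zero {j n : ℕ} (hj : s 0 j = n) (hn : n ≤ W) (x : ℕ) (c : TExpr) :
    (countBelow j x c).eval W s v ≠ 0 ↔
      ∃ i : Fin n, c.eval W s (Function.update v x i) ≠ 0 := by
  rw [eval_countBelow v hj hn, Finset.card_ne_zero]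
  simp [Finset.Nonempty]

end Eval

end TExpr

namespace TCmd

variable {W : ℕ} {s : ℕ → ℕ → ℕ} {v : ℕ → ℕ}

theorem exec_tab_self {A x i : ℕ} {d : Fin 4} {e : TExpr} (hi : i < W ^ (d : ℕ)) :
    (tab A d x e).exec W v s A i = e.eval W s (Function.update v x i) := by
  simp only [exec, Function.update_self, if_pos hi]

theorem exec_tab_of_ne {A B x : ℕ} {d : Fin 4} {e : TExpr} (h : B ≠ A) :
    (tab A d x e).exec W v s B = s B := by
  simp only [exec, Function.update_of_ne h]

theorem exec_rep_induction {d : Fin 4} {x : ℕ} {c : TCmd} (P : ℕ → (ℕ → ℕ → ℕ) → Prop)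
    (h0 : P 0 s) (hs : ∀ t < W ^ (d : ℕ), ∀ s, P t s → P (t + 1) (c.exec W (Function.update v x t) s)) :
    P (W ^ (d : ℕ)) ((rep d x c).exec W v s) := by
  simp only [exec]
  have : ∀ j ≤ W ^ (d : ℕ), P j (Nat.rec s (fun i s' => c.exec W (Function.update v x i) s') j) := by
    intro j hj
    induction j with
    | zero => exact h0
    | succ j ih => exact hs j hj _ (ih (by omega))
  exact this _ le_rfl

theorem exec_rep_of_eq {B x : ℕ} {d : Fin 4} {c : TCmd} (h : ∀ v s, c.exec W v s B = s B) :
    (rep d x c).exec W v s B = s B :=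
  exec_rep_induction (P := fun _ s' => s' B = s B) rfl fun _ _ s' hs' => (h _ s').trans hs'

theorem exec_seq {c c' : TCmd} : (seq c c').exec W v s = c'.exec W v (c.exec W v s) := rfl

end TCmd

/-! ### The tables that the algorithm prepares -/

open TExpr TCmd

/-- The number of the tail of the arc `a`; the following expressions read the input likewise. -/
def srcE (a : TExpr) : TExpr := .rd 0 (.add (.lit 4) a)

def tgtE (a : TExpr) : TExpr := .rd 0 (.add (.add (.lit 4) (.rd 0 (.lit 1))) a)

def orgE (h : TExpr) : TExpr :=
  .rd 0 (.add (.add (.add (.lit 4) (.rd 0 (.lit 1))) (.rd 0 (.lit 1))) h)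

def snkE (h : TExpr) : TExpr :=
  .rd 0 (.add (.add (.add (.add (.lit 4) (.rd 0 (.lit 1))) (.rd 0 (.lit 1))) (.rd 0 (.lit 2))) h)

def reqE (h : TExpr) : TExpr :=
  .rd 0 (.add (.add (.add (.add (.add (.lit 4) (.rd 0 (.lit 1))) (.rd 0 (.lit 1))) (.rd 0 (.lit 2)))
    (.rd 0 (.lit 2))) h)

def rotE (d : TExpr) : TExpr :=
  .rd 0 (.add (.add (.add (.add (.add (.add (.lit 4) (.rd 0 (.lit 1))) (.rd 0 (.lit 1)))
    (.rd 0 (.lit 2))) (.rd 0 (.lit 2))) (.rd 0 (.lit 2))) d)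

/-- The entry in the row `a` and the column `b` of a square table. -/
def entry (A : ℕ) (a b : TExpr) : TExpr := .rd A (.add (.rd 1 a) b)

/-- The row of the index of an entry of a square table. -/
def rowE : TExpr := .rd 2 (.var 0)

/-- The column of the index of an entry of a square table. -/
def colE : TExpr := .rd 3 (.var 0)

/-- The number of the dart at the tail of `a`. -/
def outE (a : TExpr) : TExpr := .add a a

/-- The number of the dart at the head of `a`. -/
def inE (a : TExpr) : TExpr := .add (.add a a) (.lit 1)

/-- The digit `c` of the pair of demands `h`, `h'`. -/
def digE (c : ℕ) (h h' : TExpr) : TExpr :=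
  .rd 16 (.add (.add (.add (.add (.add (.rd 8 h) h') (.add (.rd 8 h) h')) (.add (.rd 8 h) h'))
    (.add (.rd 8 h) h')) (.lit c))

def inIntervalE (a b i : TExpr) : TExpr := bicond (less i a) (bicond (less i b) (less b a))

/-- The variable `1` is at least `1` and at most the digit of the number `i` whose index is the
variable `0`. -/
def digitCondE : TExpr :=
  conj (less (.lit 0) (.var 1)) (conj (less (.var 1) (.rd 13 (.lit 0)))
    (leq (.sum 1 2 (.ite (less (.var 2) (.var 1)) (.rd 14 (.var 0)) (.lit 0)))
      (.rd 15 (.add (.var 0) (.lit 1)))))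

/-- In each round, the row `0` becomes the table of the identity and every other row becomes the
preceding row followed by the rotation, so that after enough rounds the row `t` is that of
`rot ^ t`. -/
def rotPowCmd : TCmd :=
  .rep 1 9 (.tab 4 2 0 (.ite rowE (rotE (.rd 4 (.sub (.var 0) size))) colE))

/-- The distance from a dart to another one is the number of `t` such that none of the powers of
`rot` up to `t` maps the first to the second. -/
def distCmd : TCmd :=
  .tab 5 2 0 (count 1 1 (neg (count 1 2 (conj (leq (.var 2) (.var 1))
    (equ (entry 4 (.var 2) rowE) colE)))))

/-- Reachability, by paths with one more arc in each round. -/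
def reachCmd : TCmd :=
  .seq (.tab 6 2 0 (equ rowE colE)) (.rep 2 9 (.tab 6 2 0 (.ite (.rd 6 (.var 0)) (.lit 1)
    (countBelow 1 1 (conj (equ (srcE (.var 1)) rowE) (entry 6 (tgtE (.var 1)) colE))))))

/-- The topological order: the number of vertices from which a vertex can be reached, and then the
number of the vertex. -/
def ordCmd : TCmd := .tab 7 1 0 (.add (.rd 1 (countBelow 0 1 (entry 6 (.var 1) (.var 0)))) (.var 0))

/-- The demand at whose origin an arc leaves. -/
def demandCmd : TCmd :=
  .tab 10 1 0 (sumBelow 2 1 (.ite (equ (orgE (.var 1)) (srcE (.var 0))) (.var 1) (.lit 0)))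

/-- The position of an arc, counted from the least arc with the same tail. -/
def posCmd : TCmd :=
  .tab 12 1 0 (sumBelow 1 1 (.ite (conj (equ (srcE (.var 1)) (srcE (.var 0)))
    (neg (countBelow 1 2 (conj (less (.var 2) (.var 1)) (equ (srcE (.var 2)) (srcE (.var 0)))))))
    (entry 5 (outE (.var 1)) (outE (.var 0))) (.lit 0)))

/-- The powers of `R`. Multiplication by `R` is a sum of `R` equal terms. -/
def powCmd : TCmd :=
  .rep 2 9 (.tab 14 2 0 (.ite (.var 0) (.sum 1 1 (.ite (less (.var 1) (.rd 13 (.lit 0)))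
    (.rd 14 (.sub (.var 0) (.lit 1))) (.lit 0))) (.lit 1)))

/-- The remainders of `i` modulo the powers of `R`, from the highest power down: each one comes from
the preceding one by subtracting the leading digit times its weight. -/
def remCmd : TCmd :=
  .rep 2 9 (.tab 15 2 0 (.ite (less (.var 0) (.add (.add (.rd 8 (.rd 0 (.lit 2)))
      (.rd 8 (.rd 0 (.lit 2)))) (.add (.rd 8 (.rd 0 (.lit 2))) (.rd 8 (.rd 0 (.lit 2))))))
    (.sub (.rd 15 (.add (.var 0) (.lit 1))) (.sum 1 1 (.ite digitCondE (.rd 14 (.var 0)) (.lit 0))))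
    (.rd 0 (.lit 3))))

/-- Whether the paths of two start arcs are supposed to cross. -/
def crossCmd : TCmd :=
  .tab 17 2 0 (bicond
    (inIntervalE (digE 0 (.rd 10 rowE) (.rd 10 colE)) (digE 1 (.rd 10 rowE) (.rd 10 colE))
      (.rd 12 rowE))
    (neg (inIntervalE (digE 0 (.rd 10 colE) (.rd 10 rowE)) (digE 1 (.rd 10 colE) (.rd 10 rowE))
      (.rd 12 colE))))

/-- The command that computes a table of what does not depend on the solution. -/
def prepare : ℕ → TCmd
  | 1 => .tab 1 1 0 (.sum 1 1 (.var 0))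
  | 2 => .tab 2 2 0 (.sub (count 1 1 (leq (.rd 1 (.var 1)) (.var 0))) (.lit 1))
  | 3 => .tab 3 2 0 (.sub (.var 0) (.rd 1 rowE))
  | 4 => rotPowCmd
  | 5 => distCmd
  | 6 => reachCmd
  | 7 => ordCmd
  | 8 => .tab 8 1 0 (sumBelow 2 1 (.var 0))
  | 9 => .tab 9 1 0 (sumBelow 1 1 (.var 0))
  | 10 => demandCmd
  | 11 => .tab 11 1 0 (countBelow 2 1 (equ (orgE (.var 1)) (srcE (.var 0))))
  | 12 => posCmd
  | 13 => .tab 13 1 0 (.add (.lit 1) (count 1 1 (countBelow 2 2 (less (.var 1) (reqE (.var 2))))))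
  | 14 => powCmd
  | 15 => remCmd
  | 16 => .tab 16 2 0 (count 1 1 digitCondE)
  | 17 => crossCmd
  | A => .tab A 0 0 (.lit 0)

namespace Network

variable (N : Network)

/-- The global parameter `W`. It is at least the number of cells of the input and exceeds all
the numbers of vertices, demands and darts. -/
def par : ℕ := 4 * N.size + 4

open Classical in
/-- The topological order that the algorithm computes. -/
noncomputable def ord (v : Fin N.n) : ℕ :=
  N.par * (Finset.univ.filter fun u => Relation.ReflTransGen N.Adj u v).card + v

/-- The parameter `c` of the pair of demands `h`, `h'`: a digit of `i` in the base `R`. -/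
def digit (i c : ℕ) (h h' : Fin N.k) : ℕ := i / N.R ^ (4 * (N.k * h + h') + c) % N.R

/-- The contents of the tables that do not depend on the solution. The table `0` is the input; a table
with two indices `a`, `b` has its entries at `W a + b`, and the tables `1`, `2`, `3` serve to compute
with such indices. -/
def Spec (i : ℕ) : ℕ → (ℕ → ℕ) → Prop
  | 0, f => ((f 0 = N.n ∧ f 1 = N.m ∧ f 2 = N.k) ∧ f 3 = i) ∧ (∀ a : Fin N.m, f (4 + a) = N.src a) ∧
      (∀ a : Fin N.m, f (4 + N.m + a) = N.tgt a) ∧ (∀ h : Fin N.k, f (4 + N.m + N.m + h) = N.org h) ∧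
      (∀ h : Fin N.k, f (4 + N.m + N.m + N.k + h) = N.snk h) ∧
      (∀ h : Fin N.k, f (4 + N.m + N.m + N.k + N.k + h) = N.req h) ∧
      ∀ d, f (4 + N.m + N.m + N.k + N.k + N.k + N.dartCode d) = N.dartCode (N.rot d)
  | 1, f => ∀ a < N.par, f a = N.par * a
  | 2, f => ∀ a < N.par, ∀ b < N.par, f (N.par * a + b) = a
  | 3, f => ∀ a < N.par, ∀ b < N.par, f (N.par * a + b) = b
  | 4, f => ∀ t < N.par, ∀ d, f (N.par * t + N.dartCode d) = N.dartCode ((N.rot ^ t) d)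
  | 5, f => ∀ d e, N.vert d = N.vert e →
      f (N.par * N.dartCode d + N.dartCode e) = cdist N.rot d e
  | 6, f => ∀ u w : Fin N.n, f (N.par * u + w) ≠ 0 ↔ Relation.ReflTransGen N.Adj u w
  | 7, f => ∀ u : Fin N.n, f u = N.ord u
  | 8, f => ∀ a < N.par, f a = N.k * a
  | 9, f => ∀ a < N.par, f a = N.m * a
  | 10, f => ∀ (a : Fin N.m) h, N.src a = N.org h → f a = h
  | 11, f => ∀ a : Fin N.m, f a ≠ 0 ↔ ∃ h, N.src a = N.org h
  | 12, f => ∀ a : Fin N.m, f a = N.pos a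
  | 13, f => f 0 = N.R
  | 14, f => ∀ j < N.par ^ 2, f j = N.R ^ j
  | 15, f => ∀ j ≤ 4 * N.k ^ 2, f j = i % N.R ^ j
  | 16, f => ∀ j < 4 * N.k ^ 2, f j = i / N.R ^ j % N.R
  | 17, f => ∀ (p q : Fin N.m) h h', N.src p = N.org h → N.src q = N.org h' →
      (f (N.par * p + q) ≠ 0 ↔ (InInterval (N.digit i 0 h h') (N.digit i 1 h h') (N.pos p) ↔
        ¬ InInterval (N.digit i 0 h' h) (N.digit i 1 h' h) (N.pos q)))
  | _, _ => True

/-- The tables below `j` have the right contents. -/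
def Prepared (i j : ℕ) (s : ℕ → ℕ → ℕ) : Prop := ∀ A < j, N.Spec i A (s A)

variable {N} {i : ℕ} {s : ℕ → ℕ → ℕ} {v : ℕ → ℕ}

theorem m_lt_par : 2 * N.m < N.par := by unfold par size; omega

theorem n_lt_par : N.n < N.par := by unfold par size; omega

theorem k_lt_par : 4 * N.k < N.par := by unfold par size; omega

theorem dartCode_lt (d : Fin N.m × Bool) : N.dartCode d < 2 * N.m := by
  have := d.1.2
  have := Bool.toNat_le d.2
  unfold dartCode
  omega

theorem dartCode_inj {d e : Fin N.m × Bool} (h : N.dartCode d = N.dartCode e) : d = e := by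
  obtain ⟨a, b⟩ := d
  obtain ⟨a', b'⟩ := e
  unfold dartCode at h
  have ha : a = a' := Fin.ext (by cases b <;> cases b' <;> simp at h <;> omega)
  subst ha
  cases b <;> cases b' <;> simp at h ⊢

theorem index_lt {a b : ℕ} (ha : a < N.par) (hb : b < N.par) : N.par * a + b < N.par ^ 2 := by
  have := Nat.mul_le_mul_left N.par (show a + 1 ≤ N.par from ha)
  rw [Nat.mul_add, mul_one] at this
  rw [sq]
  omega

theorem Prepared.of_le {j j' : ℕ} (h : N.Prepared i j s) (hj : j' ≤ j) : N.Prepared i j' s :=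
  fun A hA => h A (by omega)

theorem Prepared.congr {j : ℕ} {s' : ℕ → ℕ → ℕ} (h : N.Prepared i j s)
    (hs : ∀ A < j, s' A = s A) : N.Prepared i j s' := fun A hA => hs A hA ▸ h A hA

theorem Prepared.step {j : ℕ} {c : TCmd} (h : N.Prepared i j s)
    (hc : ∀ B < j, c.exec N.par v s B = s B)
    (hP : N.Spec i j (c.exec N.par v s j)) : N.Prepared i (j + 1) (c.exec N.par v s) := by
  intro A hA
  rcases Nat.lt_succ_iff_lt_or_eq.1 hA with hlt | rfl
  · rw [hc A hlt]
    exact h A hlt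
  · exact hP

/-! The expressions that read the input have the right values. -/

section Input

variable (h : N.Spec i 0 (s 0)) {e : TExpr}
include h

theorem eval_srcE {a : Fin N.m} (he : e.eval N.par s v = a) : (srcE e).eval N.par s v = N.src a := by
  simp only [srcE, eval, he, h.2.1]

theorem eval_tgtE {a : Fin N.m} (he : e.eval N.par s v = a) : (tgtE e).eval N.par s v = N.tgt a := by
  simp only [tgtE, eval, he, h.1.1.2.1, h.2.2.1]

theorem eval_orgE {a : Fin N.k} (he : e.eval N.par s v = a) : (orgE e).eval N.par s v = N.org a := by
  simp only [orgE, eval, he, h.1.1.2.1, h.2.2.2.1]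

theorem eval_snkE {a : Fin N.k} (he : e.eval N.par s v = a) : (snkE e).eval N.par s v = N.snk a := by
  simp only [snkE, eval, he, h.1.1.2.1, h.1.1.2.2, h.2.2.2.2.1]

theorem eval_reqE {a : Fin N.k} (he : e.eval N.par s v = a) : (reqE e).eval N.par s v = N.req a := by
  simp only [reqE, eval, he, h.1.1.2.1, h.1.1.2.2, h.2.2.2.2.2.1]

theorem eval_rotE {d : Fin N.m × Bool} (he : e.eval N.par s v = N.dartCode d) :
    (rotE e).eval N.par s v = N.dartCode (N.rot d) := by
  simp only [rotE, eval, he, h.1.1.2.1, h.1.1.2.2, h.2.2.2.2.2.2]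

end Input

theorem eval_entry (h : N.Spec i 1 (s 1)) {A x : ℕ} {a b : TExpr} (ha : a.eval N.par s v = x)
    (hx : x < N.par) : (entry A a b).eval N.par s v = s A (N.par * x + b.eval N.par s v) := by
  simp only [entry, eval, ha, h x hx]

theorem eval_rowE (h : N.Spec i 2 (s 2)) {x y : ℕ} (hx : x < N.par) (hy : y < N.par)
    (hv : v 0 = N.par * x + y) : rowE.eval N.par s v = x := by
  simp only [rowE, eval, hv, h x hx y hy]

theorem eval_colE (h : N.Spec i 3 (s 3)) {x y : ℕ} (hx : x < N.par) (hy : y < N.par)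
    (hv : v 0 = N.par * x + y) : colE.eval N.par s v = y := by
  simp only [colE, eval, hv, h x hx y hy]

theorem eval_outE {e : TExpr} {a : Fin N.m} (he : e.eval N.par s v = a) :
    (outE e).eval N.par s v = N.dartCode (a, false) := by
  simp only [outE, eval, he, dartCode, Bool.toNat_false]
  omega

theorem eval_inE {e : TExpr} {a : Fin N.m} (he : e.eval N.par s v = a) :
    (inE e).eval N.par s v = N.dartCode (a, true) := by
  simp only [inE, eval, he, dartCode, Bool.toNat_true]
  omega

end Network

/-! ### Correctness of the tables -/

open TExpr TCmd

namespace Network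

variable {N : Network} {i : ℕ} {s : ℕ → ℕ → ℕ} {v : ℕ → ℕ}

theorem par_pos : 0 < N.par := by unfold par; omega

theorem Prepared.mul_par_table (h : N.Prepared i 1 s) : N.Prepared i 2 ((prepare 1).exec N.par v s) := by
  refine h.step (fun B hB => exec_tab_of_ne (by omega)) fun a ha => ?_
  rw [prepare, exec_tab_self (by simpa using ha)]
  simp [eval]

theorem Prepared.row_table (h : N.Prepared i 2 s) : N.Prepared i 3 ((prepare 2).exec N.par v s) := by
  refine h.step (fun B hB => exec_tab_of_ne (by omega)) fun a ha b hb => ?_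
  have h1 : N.Spec i 1 (s 1) := h 1 (by omega)
  rw [prepare, exec_tab_self (by simpa using index_lt ha hb)]
  have : (Finset.range (N.par ^ ((1 : Fin 4) : ℕ))).filter (fun y =>
      (leq (.rd 1 (.var 1)) (.var 0)).eval N.par s
        (Function.update (Function.update v 0 (N.par * a + b)) 1 y) ≠ 0) = Finset.range (a + 1) := by
    ext y
    simp only [Fin.val_one, pow_one, Finset.mem_filter, Finset.mem_range, eval_leq, eval,
      Function.update_self, Function.update_of_ne (show (0 : ℕ) ≠ 1 by decide)]
    constructor
    · rintro ⟨hy, hle⟩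
      rw [h1 y hy] at hle
      by_contra hlt
      have := Nat.mul_le_mul_left N.par (show a + 1 ≤ y by omega)
      rw [Nat.mul_add] at this
      omega
    · intro hy
      have hyW : y < N.par := by omega
      refine ⟨hyW, ?_⟩
      rw [h1 y hyW]
      have := Nat.mul_le_mul_left N.par (show y ≤ a by omega)
      omega
  rw [eval, eval_count, this]
  simp [eval]

theorem Prepared.col_table (h : N.Prepared i 3 s) : N.Prepared i 4 ((prepare 3).exec N.par v s) := by
  refine h.step (fun B hB => exec_tab_of_ne (by omega)) fun a ha b hb => ?_
  have h1 : N.Spec i 1 (s 1) := h 1 (by omega)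
  rw [prepare, exec_tab_self (by simpa using index_lt ha hb)]
  rw [eval, eval, eval, eval_rowE (h 2 (by omega)) ha hb (Function.update_self ..), h1 a ha,
    Function.update_self]
  omega

theorem Prepared.rotPow_table (h : N.Prepared i 4 s) : N.Prepared i 5 ((prepare 4).exec N.par v s) := by
  refine h.step (fun B hB => exec_rep_of_eq fun v s => exec_tab_of_ne (by omega)) ?_
  have key := exec_rep_induction (W := N.par) (s := s) (v := v) (d := 1) (x := 9)
    (c := .tab 4 2 0 (.ite rowE (rotE (.rd 4 (.sub (.var 0) TExpr.size))) colE))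
    (P := fun T s => N.Prepared i 4 s ∧ ∀ t < T, t < N.par → ∀ d,
      s 4 (N.par * t + N.dartCode d) = N.dartCode ((N.rot ^ t) d))
    ⟨h, fun t ht => absurd ht (by omega)⟩ ?_
  · intro t ht d
    exact key.2 t (by simpa using ht) ht d
  · rintro T - s ⟨hs, hT⟩
    refine ⟨hs.congr fun A hA => exec_tab_of_ne (by omega), fun t ht htW d => ?_⟩
    have hd : N.dartCode d < N.par := (dartCode_lt d).trans m_lt_par
    rw [exec_tab_self (by simpa using index_lt htW hd)]
    simp only [eval]
    rw [eval_rowE (hs 2 (by omega)) htW hd (Function.update_self ..),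
      eval_colE (hs 3 (by omega)) htW hd (Function.update_self ..)]
    rcases Nat.eq_zero_or_pos t with rfl | htp
    · simp
    · rw [if_pos (by omega), eval_rotE (hs 0 (by omega)) (d := (N.rot ^ (t - 1)) d)]
      · rw [← Equiv.Perm.mul_apply, ← pow_succ', Nat.sub_add_cancel htp]
      · have e : N.par * t + N.dartCode d - N.par = N.par * (t - 1) + N.dartCode d := by
          rw [Nat.mul_sub]
          have := Nat.mul_le_mul_left N.par (show 1 ≤ t from htp)
          omega
        simp only [eval, eval_size, Function.update_self, e]
        exact hT (t - 1) (by omega) (by omega) d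

theorem SphereEmbedding.cdist_lt (hE : N.SphereEmbedding) {d e : Fin N.m × Bool}
    (h : N.vert d = N.vert e) : cdist N.rot d e < N.par := by
  rw [← hE.card_seg h]
  refine (Finset.card_le_univ _).trans_lt ?_
  simp only [Fintype.card_prod, Fintype.card_fin, Fintype.card_bool]
  have := m_lt_par (N := N)
  omega

theorem Prepared.dist_table (hE : N.SphereEmbedding) (h : N.Prepared i 5 s) :
    N.Prepared i 6 ((prepare 5).exec N.par v s) := by
  refine h.step (fun B hB => exec_tab_of_ne (by omega)) fun d e hde => ?_
  have h4 : N.Spec i 4 (s 4) := h 4 (by omega)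
  have hd : N.dartCode d < N.par := (dartCode_lt d).trans m_lt_par
  have he : N.dartCode e < N.par := (dartCode_lt e).trans m_lt_par
  rw [prepare, distCmd, exec_tab_self (by simpa using index_lt hd he), eval_count]
  have : (Finset.range (N.par ^ ((1 : Fin 4) : ℕ))).filter (fun t =>
      (neg (count 1 2 (conj (leq (.var 2) (.var 1)) (equ (entry 4 (.var 2) rowE) colE)))).eval
        N.par s (Function.update (Function.update v 0 (N.par * N.dartCode d + N.dartCode e)) 1 t)
          ≠ 0) = Finset.range (cdist N.rot d e) := by
    ext t
    have hc := hE.cdist_lt hde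
    simp only [Fin.val_one, pow_one, Finset.mem_filter, Finset.mem_range, eval_neg,
      eval_count_ne_zero, eval_conj, eval_leq, eval_equ]
    have ev : ∀ t' < N.par, ∀ w : ℕ → ℕ, w 2 = t' → w 0 = N.par * N.dartCode d + N.dartCode e →
        ((entry 4 (.var 2) rowE).eval N.par s w = colE.eval N.par s w ↔ (N.rot ^ t') d = e) := by
      intro t' ht' w hw2 hw0
      rw [eval_entry (h 1 (by omega)) (x := t') (by simp only [eval, hw2]) ht',
        eval_rowE (h 2 (by omega)) hd he hw0, eval_colE (h 3 (by omega)) hd he hw0, h4 t' ht' d]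
      exact ⟨fun h => dartCode_inj h, fun h => by rw [h]⟩
    constructor
    · rintro ⟨htW, hno⟩
      by_contra hlt
      refine hno ⟨cdist N.rot d e, hc, ?_, ?_⟩
      · simp [eval]; omega
      · rw [ev _ hc _ (Function.update_self ..) (by simp)]
        exact pow_cdist (hE.sameCycle hde)
    · intro ht
      refine ⟨ht.trans hc, ?_⟩
      rintro ⟨t', ht', hle, heq⟩
      rw [ev t' ht' _ (Function.update_self ..) (by simp)] at heq
      have := cdist_le heq
      simp [eval] at hle
      omega
  rw [this, Finset.card_range]

theorem Prepared.reach_table (hA : N.Acyclic) (h : N.Prepared i 6 s) :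
    N.Prepared i 7 ((prepare 6).exec N.par v s) := by
  obtain ⟨o, ho, hon⟩ := exists_isTopological hA
  refine h.step (fun B hB => ?_) ?_
  · rw [prepare, reachCmd, exec_seq, exec_rep_of_eq fun v s => exec_tab_of_ne (by omega),
      exec_tab_of_ne (by omega)]
  rw [prepare, reachCmd, exec_seq]
  set s₀ := (TCmd.tab 6 2 0 (equ rowE colE)).exec N.par v s with hs₀
  have hidx : ∀ u w : Fin N.n, (u : ℕ) < N.par ∧ (w : ℕ) < N.par := fun u w =>
    ⟨u.2.trans n_lt_par, w.2.trans n_lt_par⟩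
  -- after `T` rounds, pairs of vertices at most `T` apart in a fixed topological order are correct
  have key := exec_rep_induction (W := N.par) (s := s₀) (v := v) (d := 2) (x := 9)
    (c := .tab 6 2 0 (.ite (.rd 6 (.var 0)) (.lit 1)
      (countBelow 1 1 (conj (equ (srcE (.var 1)) rowE) (entry 6 (tgtE (.var 1)) colE)))))
    (P := fun T s => N.Prepared i 6 s ∧ ∀ u w : Fin N.n,
      (s 6 (N.par * u + w) ≠ 0 → Relation.ReflTransGen N.Adj u w) ∧
      (Relation.ReflTransGen N.Adj u w → o w ≤ o u + T → s 6 (N.par * u + w) ≠ 0))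
    ⟨h.congr fun A hA => exec_tab_of_ne (by omega), fun u w => ?_⟩ ?_
  · intro u w
    refine ⟨(key.2 u w).1, fun hr => (key.2 u w).2 hr ?_⟩
    have h1 := hon w
    have h2 := Nat.mul_le_mul (n_lt_par (N := N)).le (n_lt_par (N := N)).le
    simp only [Fin.val_two, sq]
    omega
  · have e : s₀ 6 (N.par * u + w) ≠ 0 ↔ (u : ℕ) = w := by
      rw [hs₀, exec_tab_self (by simpa using index_lt (hidx u w).1 (hidx u w).2), eval_equ,
        eval_rowE (h 2 (by omega)) (hidx u w).1 (hidx u w).2 (Function.update_self ..),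
        eval_colE (h 3 (by omega)) (hidx u w).1 (hidx u w).2 (Function.update_self ..)]
    rw [e]
    refine ⟨fun he => Fin.ext he ▸ Relation.ReflTransGen.refl, fun hr hle => ?_⟩
    exact congrArg _ (ho.1 (le_antisymm (ho.le_of_reach hr) hle))
  · rintro T - s ⟨hs, hT⟩
    refine ⟨hs.congr fun A hA => exec_tab_of_ne (by omega), fun u w => ?_⟩
    rw [exec_tab_self (by simpa using index_lt (hidx u w).1 (hidx u w).2)]
    have hin : N.Spec i 0 (s 0) := hs 0 (by omega)
    have e : ((TExpr.rd 6 (.var 0)).ite (.lit 1) (countBelow 1 1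
        (conj (equ (srcE (.var 1)) rowE) (entry 6 (tgtE (.var 1)) colE)))).eval N.par s
          (Function.update (Function.update v 9 T) 0 (N.par * u + w)) ≠ 0 ↔
        s 6 (N.par * u + w) ≠ 0 ∨ ∃ a : Fin N.m, N.src a = u ∧
          s 6 (N.par * N.tgt a + w) ≠ 0 := by
      rw [eval]
      simp only [eval, Function.update_self]
      by_cases h6 : s 6 (N.par * u + w) ≠ 0
      · simp [h6]
      · rw [if_neg h6, eval_countBelow_ne_zero _ hin.1.1.2.1 (by have := m_lt_par (N := N); omega)]
        simp only [h6, false_or]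
        refine exists_congr fun a => ?_
        rw [eval_conj, eval_equ, eval_srcE hin (a := a) (by simp [eval]),
          eval_rowE (hs 2 (by omega)) (hidx u w).1 (hidx u w).2 (by simp),
          eval_entry (hs 1 (by omega)) (eval_tgtE hin (a := a) (by simp [eval]))
            (hidx (N.tgt a) w).1, eval_colE (hs 3 (by omega)) (hidx u w).1 (hidx u w).2 (by simp)]
        rw [Fin.val_inj]
    rw [e]
    constructor
    · rintro (h6 | ⟨a, rfl, ha⟩)
      · exact (hT u w).1 h6
      · exact Relation.ReflTransGen.head ⟨a, rfl, rfl⟩ ((hT _ w).1 ha)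
    · intro hr hle
      rcases Relation.ReflTransGen.cases_head hr with rfl | ⟨_, ⟨a, rfl, rfl⟩, hr'⟩
      · exact Or.inl ((hT u u).2 hr (by omega))
      · have := ho.2 a
        exact Or.inr ⟨a, rfl, (hT _ w).2 hr' (by omega)⟩

theorem Prepared.ord_table (h : N.Prepared i 7 s) : N.Prepared i 8 ((prepare 7).exec N.par v s) := by
  refine h.step (fun B hB => exec_tab_of_ne (by omega)) fun u => ?_
  have h1 : N.Spec i 1 (s 1) := h 1 (by omega)
  have h6 : N.Spec i 6 (s 6) := h 6 (by omega)
  have hin : N.Spec i 0 (s 0) := h 0 (by omega)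
  have hu : (u : ℕ) < N.par := u.2.trans n_lt_par
  rw [prepare, ordCmd, exec_tab_self (by simpa using hu), eval, eval, eval, Function.update_self,
    eval_countBelow _ hin.1.1.1 n_lt_par.le, h1, ord]
  · congr 3
    ext w
    simp only [Finset.mem_filter, Finset.mem_univ, true_and]
    rw [eval_entry h1 (x := w) (by simp [eval]) (w.2.trans n_lt_par), ← h6 w u]
    simp [eval]
  · refine lt_of_le_of_lt (Finset.card_le_univ _) ?_
    simpa using n_lt_par

theorem Prepared.mul_demands_table (h : N.Prepared i 8 s) : N.Prepared i 9 ((prepare 8).exec N.par v s) := by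
  refine h.step (fun B hB => exec_tab_of_ne (by omega)) fun a ha => ?_
  have hin : N.Spec i 0 (s 0) := h 0 (by omega)
  rw [prepare, exec_tab_self (by simpa using ha), eval_sumBelow _ hin.1.1.2.2
    (by have := k_lt_par (N := N); omega)]
  simp [eval]

theorem Prepared.mul_arcs_table (h : N.Prepared i 9 s) : N.Prepared i 10 ((prepare 9).exec N.par v s) := by
  refine h.step (fun B hB => exec_tab_of_ne (by omega)) fun a ha => ?_
  have hin : N.Spec i 0 (s 0) := h 0 (by omega)
  rw [prepare, exec_tab_self (by simpa using ha), eval_sumBelow _ hin.1.1.2.1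
    (by have := m_lt_par (N := N); omega)]
  simp [eval]

theorem arc_lt_par (a : Fin N.m) : (a : ℕ) < N.par := by
  have := a.2
  have := m_lt_par (N := N)
  omega

theorem Prepared.demand_table (hN : N.Normalized) (h : N.Prepared i 10 s) :
    N.Prepared i 11 ((prepare 10).exec N.par v s) := by
  refine h.step (fun B hB => exec_tab_of_ne (by omega)) fun a j hj => ?_
  have hin : N.Spec i 0 (s 0) := h 0 (by omega)
  rw [prepare, demandCmd, exec_tab_self (by simpa using arc_lt_par a),
    eval_sumBelow _ hin.1.1.2.2 (by have := k_lt_par (N := N); omega), Finset.sum_eq_single j]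
  · rw [eval, if_pos]
    · simp [eval]
    · rw [eval_equ, eval_orgE hin (a := j) (by simp [eval]),
        eval_srcE hin (a := a) (by simp [eval]), hj]
  · intro j' _ hne
    rw [eval, if_neg]
    · simp [eval]
    · rw [eval_equ, eval_orgE hin (a := j') (by simp [eval]),
        eval_srcE hin (a := a) (by simp [eval]), Fin.val_inj, hj]
      exact fun he => hne (hN.1 he)
  · intro hj
    exact absurd (Finset.mem_univ _) hj

theorem Prepared.isStart_table (h : N.Prepared i 11 s) :
    N.Prepared i 12 ((prepare 11).exec N.par v s) := by
  refine h.step (fun B hB => exec_tab_of_ne (by omega)) fun a => ?_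
  have hin : N.Spec i 0 (s 0) := h 0 (by omega)
  rw [prepare, exec_tab_self (by simpa using arc_lt_par a),
    eval_countBelow_ne_zero _ hin.1.1.2.2 (by have := k_lt_par (N := N); omega)]
  refine exists_congr fun j => ?_
  rw [eval_equ, eval_orgE hin (a := j) (by simp [eval]), eval_srcE hin (a := a) (by simp [eval]),
    Fin.val_inj, eq_comm]

theorem Prepared.pos_table (h : N.Prepared i 12 s) :
    N.Prepared i 13 ((prepare 12).exec N.par v s) := by
  refine h.step (fun B hB => exec_tab_of_ne (by omega)) fun a => ?_
  have hin : N.Spec i 0 (s 0) := h 0 (by omega)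
  have h5 : N.Spec i 5 (s 5) := h 5 (by omega)
  have hm : N.m ≤ N.par := by have := m_lt_par (N := N); omega
  rw [prepare, posCmd, exec_tab_self (by simpa using arc_lt_par a),
    eval_sumBelow _ hin.1.1.2.1 hm, Finset.sum_eq_single (N.base a)]
  · rw [eval, if_pos]
    · rw [eval_entry (h 1 (by omega)) (eval_outE (a := N.base a) (by simp [eval]))
        ((dartCode_lt _).trans m_lt_par), eval_outE (a := a) (by simp [eval]), h5 (N.base a, false) (a, false) (src_base a), pos]
    · rw [eval_conj, eval_equ, eval_srcE hin (a := N.base a) (by simp [eval]),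
        eval_srcE hin (a := a) (by simp [eval]), src_base, eval_neg,
        eval_countBelow_ne_zero _ hin.1.1.2.1 hm]
      refine ⟨rfl, ?_⟩
      rintro ⟨c, hc⟩
      rw [eval_conj, eval_equ, eval_srcE hin (a := c) (by simp [eval]),
        eval_srcE hin (a := a) (by simp [eval]), Fin.val_inj] at hc
      have := base_le hc.2
      have h1 := hc.1
      simp [eval] at h1
      exact absurd h1 (not_lt.2 this)
  · intro b _ hne
    rw [eval, if_neg, eval]
    rw [eval_conj, eval_equ, eval_srcE hin (a := b) (by simp [eval]),
      eval_srcE hin (a := a) (by simp [eval]), eval_neg,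
      eval_countBelow_ne_zero _ hin.1.1.2.1 hm, Fin.val_inj]
    rintro ⟨hb, hno⟩
    refine hno ⟨N.base a, ?_⟩
    rw [eval_conj, eval_equ, eval_srcE hin (a := N.base a) (by simp [eval]),
        eval_srcE hin (a := a) (by simp [eval]), src_base]
    refine ⟨?_, rfl⟩
    simp [eval]
    exact lt_of_le_of_ne (base_le hb) hne.symm
  · intro hb
    exact absurd (Finset.mem_univ _) hb

/-- In an Eulerian network the requests are bounded by the degrees, so that multiplication by `R` is a
repeated addition of polynomial length. -/
theorem req_lt_par (hEu : N.Eulerian) (hN : N.Normalized) (j : Fin N.k) : N.req j < N.par := by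
  rw [← card_out_org hEu hN j]
  refine (Finset.card_le_univ _).trans_lt ?_
  rw [Fintype.card_fin]
  have := m_lt_par (N := N)
  omega

theorem R_le_par (hEu : N.Eulerian) (hN : N.Normalized) : N.R ≤ N.par :=
  (Finset.sup_lt_iff par_pos).2 fun j _ => req_lt_par hEu hN j

theorem Prepared.base_table (hEu : N.Eulerian) (hN : N.Normalized) (h : N.Prepared i 13 s) :
    N.Prepared i 14 ((prepare 13).exec N.par v s) := by
  refine h.step (fun B hB => exec_tab_of_ne (by omega)) ?_
  have hin : N.Spec i 0 (s 0) := h 0 (by omega)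
  change _ = N.R
  rw [prepare, exec_tab_self (by simpa using par_pos), eval, eval_count, eval, R, add_comm]
  congr 1
  have : (Finset.range (N.par ^ ((1 : Fin 4) : ℕ))).filter (fun y =>
      (countBelow 2 2 (less (.var 1) (reqE (.var 2)))).eval N.par s
        (Function.update (Function.update v 0 0) 1 y) ≠ 0) =
      Finset.range (Finset.univ.sup N.req) := by
    ext y
    simp only [Fin.val_one, pow_one, Finset.mem_filter, Finset.mem_range]
    rw [eval_countBelow_ne_zero _ hin.1.1.2.2 (by have := k_lt_par (N := N); omega),
      Finset.lt_sup_iff]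
    have e : ∀ j : Fin N.k, (less (.var 1) (reqE (.var 2))).eval N.par s
        (Function.update (Function.update (Function.update v 0 0) 1 y) 2 j) ≠ 0 ↔ y < N.req j := by
      intro j
      rw [eval_less, eval_reqE hin (a := j) (by simp [eval])]
      simp [eval]
    simp only [e, Finset.mem_univ, true_and]
    constructor
    · exact fun h => h.2
    · rintro ⟨j, hj⟩
      exact ⟨hj.trans (req_lt_par hEu hN j), j, hj⟩
  rw [this, Finset.card_range]

theorem card_range_lt {a b : ℕ} (h : a ≤ b) (P : ℕ → Prop) [DecidablePred P]
    (hP : ∀ y < b, P y ↔ y < a) : ((Finset.range b).filter P).card = a := by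
  have : (Finset.range b).filter P = Finset.range a := by
    ext y
    simp only [Finset.mem_filter, Finset.mem_range]
    constructor
    · rintro ⟨h1, h2⟩
      exact (hP y h1).1 h2
    · intro hy
      exact ⟨by omega, (hP y (by omega)).2 hy⟩
  rw [this, Finset.card_range]

theorem sum_range_lt {a b c : ℕ} (h : a ≤ b) (P : ℕ → Prop) [DecidablePred P]
    (hP : ∀ y < b, P y ↔ y < a) : ∑ y ∈ Finset.range b, (if P y then c else 0) = a * c := by
  rw [← Finset.sum_filter, Finset.sum_const, card_range_lt h P hP, smul_eq_mul]

theorem Prepared.pow_table (hEu : N.Eulerian) (hN : N.Normalized) (h : N.Prepared i 14 s) :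
    N.Prepared i 15 ((prepare 14).exec N.par v s) := by
  refine h.step (fun B hB => exec_rep_of_eq fun v s => exec_tab_of_ne (by omega)) ?_
  -- after `T` rounds, the powers below `T` are correct
  have key := exec_rep_induction (W := N.par) (s := s) (v := v) (d := 2) (x := 9)
    (c := .tab 14 2 0 (.ite (.var 0) (.sum 1 1 (.ite (less (.var 1) (.rd 13 (.lit 0)))
      (.rd 14 (.sub (.var 0) (.lit 1))) (.lit 0))) (.lit 1)))
    (P := fun T s => N.Prepared i 14 s ∧ ∀ j < T, j < N.par ^ 2 → s 14 j = N.R ^ j)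
    ⟨h, fun t ht => absurd ht (by omega)⟩ ?_
  · intro j hj
    exact key.2 j hj hj
  · rintro T - s ⟨hs, hT⟩
    refine ⟨hs.congr fun A hA => exec_tab_of_ne (by omega), fun j hj hjW => ?_⟩
    have h13 : s 13 0 = N.R := hs 13 (by omega)
    rw [exec_tab_self (by simpa using hjW)]
    simp only [eval, eval_less, Function.update_self, h13, Fin.val_one, pow_one,
      Function.update_of_ne (show (0 : ℕ) ≠ 1 by decide)]
    rw [sum_range_lt (R_le_par hEu hN) (fun y => y < N.R) fun y _ => Iff.rfl]
    split_ifs with h0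
    · rw [hT (j - 1) (by omega) (by omega), ← pow_succ', Nat.sub_add_cancel (by omega)]
    · rw [show j = 0 by omega, pow_zero]

/-- The table of the digits has room for all of them. -/
theorem digits_lt_par : 4 * N.k ^ 2 < N.par ^ 2 := by
  have := Nat.mul_lt_mul'' (k_lt_par (N := N)) (k_lt_par (N := N))
  rw [sq, sq]
  nlinarith

/-- The condition on a number `c` to be between `1` and a digit. -/
theorem eval_digitCondE (hEu : N.Eulerian) (hN : N.Normalized)
    (h : N.Prepared i 15 s) {j : ℕ} (hj : j < N.par ^ 2)
    (h15 : s 15 (j + 1) = i % N.R ^ (j + 1)) (hv : v 0 = j) :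
    (fun c => digitCondE.eval N.par s (Function.update v 1 c) ≠ 0) =
      fun c => 0 < c ∧ c < N.R ∧ c ≤ i / N.R ^ j % N.R := by
  funext c
  have h13 : s 13 0 = N.R := h 13 (by omega)
  have h14 : s 14 j = N.R ^ j := h 14 (by omega) j hj
  have hR : 0 < N.R ^ j := pow_pos (Nat.succ_pos _) _
  simp only [digitCondE, eval_conj, eval_less, eval_leq, eval, Function.update_self,
    Function.update_of_ne (show (0 : ℕ) ≠ 1 by decide),
    Function.update_of_ne (show (0 : ℕ) ≠ 2 by decide),
    Function.update_of_ne (show (1 : ℕ) ≠ 2 by decide), h13, h14, hv, h15, Fin.val_one, pow_one,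
    eq_iff_iff]
  refine and_congr_right fun _ => and_congr_right fun hc => ?_
  rw [sum_range_lt (hc.le.trans (R_le_par hEu hN)) (fun y => y < c) fun y _ => Iff.rfl,
    ← Nat.le_div_iff_mul_le hR, pow_succ, Nat.mod_mul_right_div_self]

theorem Prepared.rem_table (hEu : N.Eulerian) (hN : N.Normalized) (hi : i < N.R ^ (4 * N.k ^ 2))
    (h : N.Prepared i 15 s) : N.Prepared i 16 ((prepare 15).exec N.par v s) := by
  refine h.step (fun B hB => exec_rep_of_eq fun v s => exec_tab_of_ne (by omega)) ?_
  -- after `T` rounds, the last `T` remainders are correct, starting from `i < R ^ (4 k²)`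
  have key := exec_rep_induction (W := N.par) (s := s) (v := v) (d := 2) (x := 9)
    (c := .tab 15 2 0 (.ite (less (.var 0) (.add (.add (.rd 8 (.rd 0 (.lit 2)))
      (.rd 8 (.rd 0 (.lit 2)))) (.add (.rd 8 (.rd 0 (.lit 2))) (.rd 8 (.rd 0 (.lit 2))))))
      (.sub (.rd 15 (.add (.var 0) (.lit 1)))
        (.sum 1 1 (.ite digitCondE (.rd 14 (.var 0)) (.lit 0))))
      (.rd 0 (.lit 3))))
    (P := fun T s => N.Prepared i 15 s ∧ ∀ j ≤ 4 * N.k ^ 2, 4 * N.k ^ 2 < j + T →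
      s 15 j = i % N.R ^ j)
    ⟨h, fun t ht ht' => absurd ht' (by omega)⟩ ?_
  · intro j hj
    refine key.2 j hj ?_
    have := digits_lt_par (N := N)
    simp only [Fin.val_two]
    omega
  · rintro T - s ⟨hs, hT⟩
    refine ⟨hs.congr fun A hA => exec_tab_of_ne (by omega), fun j hj hjT => ?_⟩
    have hin : N.Spec i 0 (s 0) := hs 0 (by omega)
    have hjW : j < N.par ^ 2 := hj.trans_lt digits_lt_par
    have h8 : s 8 N.k = N.k * N.k := hs 8 (by omega) N.k (by have := k_lt_par (N := N); omega)
    rw [exec_tab_self (by simpa using hjW)]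
    simp only [eval, eval_less, Function.update_self, hin.1.1.2.2, hin.1.2, h8]
    have e4 : N.k * N.k + N.k * N.k + (N.k * N.k + N.k * N.k) = 4 * N.k ^ 2 := by ring
    rw [e4]
    split_ifs with hlt
    · have h15 := hT (j + 1) (by omega) (by omega)
      have hc := congrFun (eval_digitCondE (v := Function.update (Function.update v 9 T) 0 j) hEu hN
        hs hjW h15 (Function.update_self ..))
      have h14 : s 14 j = N.R ^ j := hs 14 (by omega) j hjW
      simp only [Fin.val_one, pow_one, Function.update_of_ne (show (0 : ℕ) ≠ 1 by decide),
        Function.update_self, h14]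
      have hdR : i / N.R ^ j % N.R < N.R := Nat.mod_lt _ (Nat.succ_pos _)
      have hRW := R_le_par hEu hN
      have hsum : ∑ c ∈ Finset.range N.par, (if digitCondE.eval N.par s (Function.update
          (Function.update (Function.update v 9 T) 0 j) 1 c) ≠ 0 then N.R ^ j else 0) =
          i / N.R ^ j % N.R * N.R ^ j := by
        rw [← Finset.sum_filter, Finset.sum_const, smul_eq_mul]
        congr 1
        have : (Finset.range N.par).filter (fun c => digitCondE.eval N.par s (Function.update
            (Function.update (Function.update v 9 T) 0 j) 1 c) ≠ 0) =
            Finset.Ioc 0 (i / N.R ^ j % N.R) := by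
          ext c
          rw [Finset.mem_filter, Finset.mem_range, Finset.mem_Ioc, hc]
          omega
        rw [this, Nat.card_Ioc, Nat.sub_zero]
      rw [hsum, h15, Nat.mod_pow_succ, mul_comm (N.R ^ j), Nat.add_sub_cancel]
    · have : j = 4 * N.k ^ 2 := by omega
      rw [this, Nat.mod_eq_of_lt hi]

theorem Prepared.digits_table (hEu : N.Eulerian) (hN : N.Normalized) (h : N.Prepared i 16 s) :
    N.Prepared i 17 ((prepare 16).exec N.par v s) := by
  refine h.step (fun B hB => exec_tab_of_ne (by omega)) fun j hj => ?_
  have hjW : j < N.par ^ 2 := hj.trans digits_lt_par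
  have h15 : s 15 (j + 1) = i % N.R ^ (j + 1) := h 15 (by omega) (j + 1) (by omega)
  have hc := congrFun (eval_digitCondE (v := Function.update v 0 j) hEu hN
        (h.of_le (by omega)) hjW h15 (Function.update_self ..))
  have hdR : i / N.R ^ j % N.R < N.R := Nat.mod_lt _ (Nat.succ_pos _)
  have hRW := R_le_par hEu hN
  rw [prepare, exec_tab_self (by simpa using hjW), eval_count]
  have : (Finset.range (N.par ^ ((1 : Fin 4) : ℕ))).filter (fun c => digitCondE.eval N.par s
      (Function.update (Function.update v 0 j) 1 c) ≠ 0) = Finset.Ioc 0 (i / N.R ^ j % N.R) := by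
    ext c
    rw [Finset.mem_filter, Finset.mem_range, Finset.mem_Ioc, hc, Fin.val_one, pow_one]
    omega
  rw [this, Nat.card_Ioc, Nat.sub_zero]

theorem digit_index_lt {h h' : Fin N.k} {c : ℕ} (hc : c < 4) :
    4 * (N.k * h + h') + c < 4 * N.k ^ 2 := by
  have h1 := h'.2
  have h2 := Nat.mul_le_mul_left N.k (show (h : ℕ) + 1 ≤ N.k from h.2)
  rw [Nat.mul_add, mul_one] at h2
  rw [sq]
  omega

theorem eval_digE (h : N.Prepared i 17 s) {a b : TExpr} {j j' : Fin N.k}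
    (ha : a.eval N.par s v = j) (hb : b.eval N.par s v = j') {c : ℕ} (hc : c < 4) :
    (digE c a b).eval N.par s v = N.digit i c j j' := by
  have h8 : s 8 j = N.k * j := h 8 (by omega) j (by
    have := k_lt_par (N := N)
    have := j.2
    omega)
  simp only [digE, eval, ha, hb, h8]
  rw [show N.k * (j : ℕ) + j' + (N.k * j + j') + (N.k * j + j') + (N.k * j + j') + c =
    4 * (N.k * j + j') + c by ring]
  exact h 16 (by omega) _ (digit_index_lt hc)

theorem eval_inIntervalE {a b c : TExpr} : (inIntervalE a b c).eval N.par s v ≠ 0 ↔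
    InInterval (a.eval N.par s v) (b.eval N.par s v) (c.eval N.par s v) := by
  simp only [inIntervalE, eval_bicond, eval_less, InInterval]

theorem Prepared.cross_table (h : N.Prepared i 17 s) :
    N.Prepared i 18 ((prepare 17).exec N.par v s) := by
  refine h.step (fun B hB => exec_tab_of_ne (by omega)) fun p q j j' hp hq => ?_
  have h10 : N.Spec i 10 (s 10) := h 10 (by omega)
  have h12 : N.Spec i 12 (s 12) := h 12 (by omega)
  rw [prepare, crossCmd, exec_tab_self (by simpa using index_lt (arc_lt_par p) (arc_lt_par q))]
  have e1 := eval_rowE (h 2 (by omega)) (arc_lt_par p) (arc_lt_par q)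
    (Function.update_self 0 (N.par * p + q) v)
  have e2 := eval_colE (h 3 (by omega)) (arc_lt_par p) (arc_lt_par q)
    (Function.update_self 0 (N.par * p + q) v)
  have d1 : (TExpr.rd 10 rowE).eval N.par s (Function.update v 0 (N.par * p + q)) = j := by
    rw [eval, e1, h10 p j hp]
  have d2 : (TExpr.rd 10 colE).eval N.par s (Function.update v 0 (N.par * p + q)) = j' := by
    rw [eval, e2, h10 q j' hq]
  rw [eval_bicond, eval_neg, eval_inIntervalE, eval_inIntervalE, eval_digE h d1 d2 (by omega),
    eval_digE h d1 d2 (by omega), eval_digE h d2 d1 (by omega), eval_digE h d2 d1 (by omega), eval,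
    eval, e1, e2, h12 p, h12 q]

end Network

/-! ### The simulation of a solution -/

open TExpr TCmd

/-- The number of the path of an arc that has already been reached. -/
def labE (a : TExpr) : TExpr := .sub (.rd 18 a) (.lit 1)

/-- The arc with the number `z` leads from the head of the arc of the row to the sink of its path. -/
def leadsE (z : TExpr) : TExpr :=
  conj (equ (srcE z) (tgtE rowE)) (entry 6 (tgtE z) (snkE (.rd 10 (labE rowE))))

/-- Whether an arc to the sink comes before the column when turning from the row. -/
def beforeE : TExpr := countBelow 1 1 (conj (leadsE (.var 1))
  (less (entry 5 (inE rowE) (outE (.var 1))) (entry 5 (inE rowE) (inE colE))))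

/-- Whether an arc to the sink comes after the column when turning from the row. -/
def afterE : TExpr := countBelow 1 1 (conj (leadsE (.var 1))
  (less (entry 5 (inE rowE) (inE colE)) (entry 5 (inE rowE) (outE (.var 1)))))

/-- The rank of the row among the arcs of its demand, counted from the column. -/
def rankE : TExpr := countBelow 1 1 (conj (equ (tgtE (.var 1)) (tgtE rowE))
  (conj (equ (srcE (labE (.var 1))) (srcE (labE rowE)))
    (leq (entry 5 (inE colE) (inE (.var 1))) (entry 5 (inE colE) (inE rowE)))))

/-- Compute the behaviour of the path of the row relative to the path of the column. -/
def codeCmd : TCmd :=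
  .tab 20 2 0 (.ite (conj (neg (equ (srcE (labE rowE)) (srcE (labE colE))))
      (conj (neg (entry 19 (labE rowE) (labE colE))) (entry 17 (labE rowE) (labE colE))))
    (.lit 1)
    (.ite (.ite beforeE (conj afterE (leq rankE (digE 2 (.rd 10 (labE rowE)) (.rd 10 (labE colE)))))
      (.lit 1)) (.lit 2) (.lit 3)))

/-- The number of arcs with the same head as the arc with the variable `1` as its number, relative
to which the path of this arc has the behaviour `c`. -/
def behaviourCountE (c : ℕ) : TExpr := countBelow 1 2 (conj (equ (tgtE (.var 2)) (tgtE (.var 1)))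
  (conj (neg (equ (.var 2) (.var 1))) (equ (entry 20 (.var 1) (.var 2)) (.lit c))))

/-- Continue the paths through the vertex with the number `var 9` in the topological order. -/
def labCmd : TCmd :=
  .tab 18 1 0 (.ite (.rd 18 (.var 0)) (.rd 18 (.var 0))
    (.ite (equ (.rd 7 (srcE (.var 0))) (.var 9))
      (sumBelow 1 1 (.ite (conj (equ (tgtE (.var 1)) (srcE (.var 0)))
        (equ (entry 5 (inE (.var 1)) (outE (.var 0)))
          (.add (.add (.lit 1) (.add (behaviourCountE 2) (behaviourCountE 2))) (behaviourCountE 1))))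
        (.rd 18 (.var 1)) (.lit 0)))
      (.lit 0)))

/-- Record the behaviours of the paths that meet for the first time at this vertex. -/
def outCmd : TCmd :=
  .tab 19 2 0 (.ite (.rd 19 (.var 0)) (.rd 19 (.var 0))
    (sumBelow 1 1 (sumBelow 1 2 (.ite (conj (equ (tgtE (.var 1)) (tgtE (.var 2)))
      (conj (equ (.rd 7 (tgtE (.var 1))) (.var 9))
        (conj (equ (.rd 18 (.var 1)) (.add rowE (.lit 1)))
          (conj (equ (.rd 18 (.var 2)) (.add colE (.lit 1)))
            (neg (equ (srcE rowE) (srcE colE)))))))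
      (entry 20 (.var 1) (.var 2)) (.lit 0)))))

namespace Network

variable {N : Network} {i : ℕ} {s : ℕ → ℕ → ℕ} {v : ℕ → ℕ} {r : N.Routing}

open Routing

/-- The digits of `i` are the parameters of the routing `r`. -/
structure Encodes (r : N.Routing) (i : ℕ) : Prop where
  cross : ∀ h h' p q, h ≠ h' → N.src p = N.org h → N.src q = N.org h' →
    (r.Crosses p q ↔ (InInterval (N.digit i 0 h h') (N.digit i 1 h h') (N.pos p) ↔
      ¬ InInterval (N.digit i 0 h' h) (N.digit i 1 h' h) (N.pos q)))
  left : ∀ h h' x y, Meet x y → Mixed h x y → N.src (r.lab x) = N.org h →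
    N.src (r.lab y) = N.org h' → (r.Inside x (y, true) ↔ r.rank x y ≤ N.digit i 2 h h')

theorem m_le_par : N.m ≤ N.par := by
  have := m_lt_par (N := N)
  omega

theorem dart_lt_par (d : Fin N.m × Bool) : N.dartCode d < N.par := (dartCode_lt d).trans m_lt_par

theorem eval_labE {e : TExpr} {x p : Fin N.m} (he : e.eval N.par s v = x)
    (hs : s 18 x = (p : ℕ) + 1) : (labE e).eval N.par s v = p := by
  simp only [labE, eval, he, hs, Nat.add_sub_cancel]

theorem eval_dist (h : N.Prepared i 18 s) {a b : TExpr} {d e : Fin N.m × Bool}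
    (ha : a.eval N.par s v = N.dartCode d) (hb : b.eval N.par s v = N.dartCode e)
    (hde : N.vert d = N.vert e) : (entry 5 a b).eval N.par s v = cdist N.rot d e := by
  rw [eval_entry (h 1 (by omega)) ha (dart_lt_par d), hb]
  exact h 5 (by omega) d e hde

theorem codeCmd_spec (hE : N.SphereEmbedding) (hN : N.Normalized) (ho : N.IsTopological N.ord)
    (hr : r.IsUncrossed N.ord) (hi : N.Encodes r i) (h : N.Prepared i 18 s) {x y : Fin N.m}
    (hm : Meet x y) (hxy : x ≠ y) (hlab : ∀ x', N.tgt x' = N.tgt x → s 18 x' = (r.lab x' : ℕ) + 1)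
    (hout : N.src (r.lab x) ≠ N.src (r.lab y) →
      (s 19 (N.par * r.lab x + r.lab y) ≠ 0 ↔ r.MetBefore N.ord x y)) :
    codeCmd.exec N.par v s 20 (N.par * x + y) = r.code x y := by
  have hin : N.Spec i 0 (s 0) := h 0 (by omega)
  have h6 : N.Spec i 6 (s 6) := h 6 (by omega)
  have h10 : N.Spec i 10 (s 10) := h 10 (by omega)
  have h17 : N.Spec i 17 (s 17) := h 17 (by omega)
  obtain ⟨j, hj⟩ := r.src_lab x
  obtain ⟨j', hj'⟩ := r.src_lab y
  rw [codeCmd, exec_tab_self (by simpa using index_lt (arc_lt_par x) (arc_lt_par y))]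
  have row : ∀ w : ℕ → ℕ, w 0 = N.par * x + y → rowE.eval N.par s w = x := fun w hw =>
    eval_rowE (h 2 (by omega)) (arc_lt_par x) (arc_lt_par y) hw
  have col : ∀ w : ℕ → ℕ, w 0 = N.par * x + y → colE.eval N.par s w = y := fun w hw =>
    eval_colE (h 3 (by omega)) (arc_lt_par x) (arc_lt_par y) hw
  have lrow : ∀ w : ℕ → ℕ, w 0 = N.par * x + y → (labE rowE).eval N.par s w = r.lab x :=
    fun w hw => eval_labE (row w hw) (hlab x rfl)
  have lcol : ∀ w : ℕ → ℕ, w 0 = N.par * x + y → (labE colE).eval N.par s w = r.lab y :=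
    fun w hw => eval_labE (col w hw) (hlab y hm.1.symm)
  have drow : ∀ w : ℕ → ℕ, w 0 = N.par * x + y → (TExpr.rd 10 (labE rowE)).eval N.par s w = j :=
    fun w hw => by rw [eval, lrow w hw, h10 _ j hj]
  have dcol : ∀ w : ℕ → ℕ, w 0 = N.par * x + y → (TExpr.rd 10 (labE colE)).eval N.par s w = j' :=
    fun w hw => by rw [eval, lcol w hw, h10 _ j' hj']
  have dist : ∀ w : ℕ → ℕ, w 0 = N.par * x + y →
      (entry 5 (inE rowE) (inE colE)).eval N.par s w = cdist N.rot (x, true) (y, true) := fun w hw =>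
    eval_dist h (eval_inE (row w hw)) (eval_inE (col w hw)) hm.1
  set w := Function.update v 0 (N.par * (x : ℕ) + y) with hw
  have hw0 : w 0 = N.par * x + y := Function.update_self ..
  have hz0 : ∀ z : ℕ, (Function.update w 1 z) 0 = N.par * x + y := fun z => by
    rw [Function.update_of_ne (by decide), hw0]
  have hz1 : ∀ z : ℕ, (TExpr.var 1).eval N.par s (Function.update w 1 z) = z := fun z => by
    rw [eval, Function.update_self]
  have leads : ∀ z : Fin N.m, (leadsE (.var 1)).eval N.par s (Function.update w 1 z) ≠ 0 ↔
      Leads x j z := by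
    intro z
    rw [leadsE, eval_conj, eval_equ, eval_srcE hin (hz1 z), eval_tgtE hin (row _ (hz0 z)),
      Fin.val_inj, eval_entry (h 1 (by omega)) (eval_tgtE hin (hz1 z))
        ((N.tgt z).2.trans n_lt_par), eval_snkE hin (drow _ (hz0 z)), h6, Leads]
  have before : beforeE.eval N.par s w ≠ 0 ↔ ∃ z, Leads x j z ∧
      cdist N.rot (x, true) (z, false) < cdist N.rot (x, true) (y, true) := by
    rw [beforeE, eval_countBelow_ne_zero _ hin.1.1.2.1 m_le_par]
    refine exists_congr fun z => ?_
    rw [eval_conj, leads z]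
    refine and_congr_right fun hz => ?_
    rw [eval_less, dist _ (hz0 z), eval_dist h (eval_inE (row _ (hz0 z))) (eval_outE (hz1 z))
      hz.1.symm]
  have after : afterE.eval N.par s w ≠ 0 ↔ ∃ z, Leads x j z ∧
      cdist N.rot (x, true) (y, true) < cdist N.rot (x, true) (z, false) := by
    rw [afterE, eval_countBelow_ne_zero _ hin.1.1.2.1 m_le_par]
    refine exists_congr fun z => ?_
    rw [eval_conj, leads z]
    refine and_congr_right fun hz => ?_
    rw [eval_less, dist _ (hz0 z), eval_dist h (eval_inE (row _ (hz0 z))) (eval_outE (hz1 z))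
      hz.1.symm]
  have hrank : rankE.eval N.par s w = r.rank x y := by
    rw [rankE, eval_countBelow _ hin.1.1.2.1 m_le_par, rank]
    congr 1
    ext x'
    simp only [Finset.mem_filter, Finset.mem_univ, true_and]
    rw [eval_conj, eval_equ, eval_tgtE hin (hz1 x'), eval_tgtE hin (row _ (hz0 x')), Fin.val_inj]
    refine and_congr_right fun hx' => ?_
    rw [eval_conj, eval_equ, eval_srcE hin (eval_labE (hz1 x') (hlab x' hx')),
      eval_srcE hin (lrow _ (hz0 x')), Fin.val_inj, eval_leq,
      eval_dist h (eval_inE (col _ (hz0 x'))) (eval_inE (hz1 x')) (hm.1.symm.trans hx'.symm),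
      eval_dist h (eval_inE (col _ (hz0 x'))) (eval_inE (row _ (hz0 x'))) hm.1.symm]
  have cross : (conj (neg (equ (srcE (labE rowE)) (srcE (labE colE))))
      (conj (neg (entry 19 (labE rowE) (labE colE))) (entry 17 (labE rowE) (labE colE)))).eval
        N.par s w ≠ 0 ↔ r.Cross x y := by
    rw [cross_iff ho hr hm hxy, eval_conj, eval_conj, eval_neg, eval_neg, eval_equ,
      eval_srcE hin (lrow w hw0), eval_srcE hin (lcol w hw0), Fin.val_inj,
      eval_entry (h 1 (by omega)) (lrow w hw0) (arc_lt_par _), lcol w hw0,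
      eval_entry (h 1 (by omega)) (lrow w hw0) (arc_lt_par _), lcol w hw0]
    refine and_congr_right fun hne => ?_
    rw [hout hne, h17 _ _ j j' hj hj', ← hi.cross j j' _ _ ?_ hj hj']
    rintro rfl
    exact hne (hj.trans hj'.symm)
  have left : (TExpr.ite beforeE (conj afterE (leq rankE (digE 2 (.rd 10 (labE rowE))
      (.rd 10 (labE colE))))) (.lit 1)).eval N.par s w ≠ 0 ↔ r.Inside x (y, true) := by
    rw [inside_iff hN ho hi.left hm hj hj' hE, ← before, ← after]
    have hc : (conj afterE (leq rankE (digE 2 (.rd 10 (labE rowE))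
        (.rd 10 (labE colE))))).eval N.par s w ≠ 0 ↔
        (afterE.eval N.par s w ≠ 0 ∧ r.rank x y ≤ N.digit i 2 j j') := by
      rw [eval_conj, eval_leq, hrank, eval_digE (h.of_le (by omega)) (drow w hw0) (dcol w hw0)
        (by omega)]
    rw [← hc, eval]
    by_cases hb : beforeE.eval N.par s w ≠ 0
    · rw [if_pos hb]
      exact ⟨Or.inr, fun h => h.resolve_left fun h' => h' hb⟩
    · rw [if_neg hb]
      exact iff_of_true one_ne_zero (Or.inl hb)
  rw [code, eval]
  by_cases c1 : r.Cross x y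
  · rw [if_pos (cross.2 c1), if_pos c1]
    rfl
  · rw [if_neg (mt cross.1 c1), if_neg c1, eval]
    by_cases c2 : r.Inside x (y, true)
    · rw [if_pos (left.2 c2), if_pos c2]
      rfl
    · rw [if_neg (mt left.1 c2), if_neg c2]
      rfl

theorem code_ne_zero (x y : Fin N.m) : r.code x y ≠ 0 := by
  unfold code
  split_ifs <;> decide

theorem Routing.MetBefore.exists_firstMeet {o : Fin N.n → ℕ} {x y : Fin N.m} (h : r.MetBefore o x y)
    (hne : N.src (r.lab x) ≠ N.src (r.lab y)) : ∃ x' y', r.lab x' = r.lab x ∧ r.lab y' = r.lab y ∧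
      r.FirstMeet o x' y' ∧ o (N.tgt x') < o (N.tgt x) := by
  induction hn : o (N.tgt x) using Nat.strong_induction_on generalizing x y with
  | _ n ih =>
  obtain ⟨x', y', hx, hy, ht, hlt⟩ := h
  have hne' : N.src (r.lab x') ≠ N.src (r.lab y') := by rwa [hx, hy]
  by_cases hb : r.MetBefore o x' y'
  · obtain ⟨x'', y'', hx', hy', hf, hlt'⟩ := ih _ (hn ▸ hlt) hb hne' rfl
    exact ⟨x'', y'', hx'.trans hx, hy'.trans hy, hf, by omega⟩
  · exact ⟨x', y', hx, hy, ⟨ht, hne', hb⟩, hn ▸ hlt⟩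

theorem code_eq_one {x y : Fin N.m} : r.code x y = 1 ↔ r.Cross x y := by
  unfold Routing.code
  split_ifs with c1 c2 <;> simp [c1]

theorem code_eq_two {x y : Fin N.m} : r.code x y = 2 ↔ ¬ r.Cross x y ∧ r.Left x y := by
  unfold Routing.code
  split_ifs with c1 c2
  · simp [c1]
  · simp only [c1, not_false_eq_true, true_and, true_iff]
    exact ⟨c2, by_contra fun c3 => c1 ⟨fun _ => c3, fun _ => c2⟩⟩
  · simp only [c1, not_false_eq_true, true_and]
    exact ⟨fun h => by omega, fun h => absurd h.1 c2⟩

/-- The state of the simulation when the vertices before `t` have been treated. -/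
structure Simulates (r : N.Routing) (i t : ℕ) (s : ℕ → ℕ → ℕ) : Prop where
  prepared : N.Prepared i 18 s
  reached : ∀ a : Fin N.m, (∃ h, N.src a = N.org h) ∨ N.ord (N.src a) < t →
    s 18 a = (r.lab a : ℕ) + 1
  not_reached : ∀ a : Fin N.m, ¬ ((∃ h, N.src a = N.org h) ∨ N.ord (N.src a) < t) → s 18 a = 0
  met : ∀ x y, r.FirstMeet N.ord x y → N.ord (N.tgt x) < t →
    s 19 (N.par * r.lab x + r.lab y) = r.code x y
  not_met : ∀ p q : Fin N.m, (∀ x y, r.lab x = p → r.lab y = q → r.FirstMeet N.ord x y →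
    ¬ N.ord (N.tgt x) < t) → s 19 (N.par * p + q) = 0

theorem Simulates.code (hE : N.SphereEmbedding) (hN : N.Normalized) (ho : N.IsTopological N.ord)
    (hr : r.IsUncrossed N.ord) (hi : N.Encodes r i) {t : ℕ} (h : N.Simulates r i t s) {x y : Fin N.m}
    (hm : Meet x y) (hxy : x ≠ y) (ht : N.ord (N.tgt x) = t) :
    codeCmd.exec N.par v s 20 (N.par * x + y) = r.code x y := by
  refine codeCmd_spec hE hN ho hr hi h.prepared hm hxy (fun x' hx' => h.reached x' (Or.inr ?_))
    fun hne => ?_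
  · rw [← ht, ← hx']
    exact ho.2 x'
  · constructor
    · intro h0
      by_contra hb
      refine h0 (h.not_met _ _ fun x' y' hx' hy' hf hlt => hb ⟨x', y', hx', hy', hf.1, ?_⟩)
      rwa [ht]
    · intro hb
      obtain ⟨x', y', hx', hy', hf, hlt⟩ := MetBefore.exists_firstMeet hb hne
      rw [← hx', ← hy', h.met x' y' hf (ht ▸ hlt)]
      exact code_ne_zero x' y'

/-- The command for one arc `x`: the number of darts between `x` and the next arc on its path. -/
theorem eval_next (hE : N.SphereEmbedding) (hN : N.Normalized) (h : N.Prepared i 18 s) {x : Fin N.m}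
    (hx : ∀ h, N.tgt x ≠ N.snk h)
    (hcode : ∀ y, Meet x y → x ≠ y → s 20 (N.par * x + y) = r.code x y) {w : ℕ → ℕ}
    (hw : w 1 = x) :
    (TExpr.add (.add (.lit 1) (.add (behaviourCountE 2) (behaviourCountE 2)))
      (behaviourCountE 1)).eval N.par s w = cdist N.rot (x, true) (r.nxt x, false) := by
  classical
  have hin : N.Spec i 0 (s 0) := h 0 (by omega)
  have key : ∀ c, (behaviourCountE c).eval N.par s w =
      (Finset.univ.filter fun y => N.tgt y = N.tgt x ∧ y ≠ x ∧ r.code x y = c).card := by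
    intro c
    rw [behaviourCountE, eval_countBelow _ hin.1.1.2.1 m_le_par]
    congr 1
    ext y
    simp only [Finset.mem_filter, Finset.mem_univ, true_and]
    have h1 : (TExpr.var 1).eval N.par s (Function.update w 2 y) = x := by simp [eval, hw]
    have h2 : (TExpr.var 2).eval N.par s (Function.update w 2 y) = y := by simp [eval]
    rw [eval_conj, eval_conj, eval_equ, eval_neg, eval_equ, eval_equ, eval_tgtE hin h1,
      eval_tgtE hin h2, h1, h2, Fin.val_inj, Fin.val_inj,
      eval_entry (h 1 (by omega)) h1 (arc_lt_par x), h2]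
    refine and_congr_right fun hy => and_congr_right fun hne => ?_
    rw [hcode y ⟨hy.symm, hx⟩ (Ne.symm hne), eval]
  simp only [eval, key, code_eq_one, code_eq_two]
  rw [r.cdist_nxt hE hN hx, two_mul]

end Network

/-! ### The algorithm and one round of it -/

open TExpr TCmd

/-- Treat the vertex with the number `var 9` in the topological order. -/
def roundCmd : TCmd := .seq (.seq codeCmd labCmd) outCmd

/-- Compute all tables that do not depend on the solution. -/
def prepareCmd : TCmd :=
  ([2, 3, 4, 5, 6, 7, 8, 9, 10, 11, 12, 13, 14, 15, 16, 17].map prepare).foldl .seq (prepare 1)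

/-- At first, exactly the start arcs are reached and no two paths have met. -/
def initCmd : TCmd :=
  .seq (.tab 18 1 0 (.ite (.rd 11 (.var 0)) (.add (.var 0) (.lit 1)) (.lit 0)))
    (.tab 19 2 0 (.lit 0))

/-- Arrange the behaviours in a table with rows of the right length. -/
def arrangeCmd : TCmd :=
  .tab 21 2 0 (sumBelow 1 1 (sumBelow 1 2
    (.ite (equ (.add (.rd 9 (.var 1)) (.var 2)) (.var 0)) (entry 19 (.var 1) (.var 2)) (.lit 0))))

/-- Reduce an index modulo the square of the global parameter, if it is less than twice this
square. -/
def wrapE : TExpr :=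
  .ite (less (.var 0) (.sum 2 1 (.lit 1))) (.var 0) (.sub (.var 0) (.sum 2 1 (.lit 1)))

/-- Write two copies of the result, with an arbitrary value in place of the numbers that are not
codes of values of a routing scheme. -/
def resultCmd : TCmd :=
  .tab 22 3 0 (.ite (less (.rd 21 wrapE) (.lit 4)) (.rd 21 wrapE) (.lit 0))

/-- The algorithm that computes the routing scheme with the number `i`. -/
def algorithm : TCmd :=
  .seq (.seq (.seq (.seq prepareCmd initCmd) (.rep 2 9 roundCmd)) arrangeCmd) resultCmd

namespace Network

variable {N : Network} {i : ℕ} {s : ℕ → ℕ → ℕ} {v : ℕ → ℕ} {r : N.Routing}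

open Routing

theorem ord_lt (u : Fin N.n) : N.ord u < N.par ^ 2 := by
  classical
  refine index_lt (lt_of_le_of_lt (Finset.card_le_univ _) ?_) (u.2.trans n_lt_par)
  rw [Fintype.card_fin]
  exact n_lt_par

theorem isTopological_ord (hA : N.Acyclic) : N.IsTopological N.ord := by
  classical
  constructor
  · intro u w h
    have h1 := congrArg (· % N.par) h
    simp only [ord, Nat.mul_add_mod] at h1
    rw [Nat.mod_eq_of_lt (u.2.trans n_lt_par), Nat.mod_eq_of_lt (w.2.trans n_lt_par)] at h1
    exact Fin.ext h1
  · intro a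
    have hlt : (Finset.univ.filter fun u => Relation.ReflTransGen N.Adj u (N.src a)).card <
        (Finset.univ.filter fun u => Relation.ReflTransGen N.Adj u (N.tgt a)).card := by
      refine Finset.card_lt_card ⟨fun u hu => ?_, fun h => ?_⟩
      · exact Finset.mem_filter.2 ⟨Finset.mem_univ u,
          (Finset.mem_filter.1 hu).2.tail ⟨a, rfl, rfl⟩⟩
      · have := (Finset.mem_filter.1 (h (Finset.mem_filter.2
          ⟨Finset.mem_univ (N.tgt a), Relation.ReflTransGen.refl⟩))).2
        exact hA _ (Relation.TransGen.head' ⟨a, rfl, rfl⟩ this)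
    have h1 := Nat.mul_le_mul_left N.par (Nat.succ_le_of_lt hlt)
    have h2 := (N.src a).2.trans n_lt_par
    rw [Nat.succ_eq_add_one, Nat.mul_add, mul_one] at h1
    unfold ord
    omega

theorem Simulates.congr {t : ℕ} {s' : ℕ → ℕ → ℕ} (h : N.Simulates r i t s)
    (hs : ∀ A < 20, s' A = s A) : N.Simulates r i t s' where
  prepared := h.prepared.congr fun A hA => hs A (by omega)
  reached := hs 18 (by omega) ▸ h.reached
  not_reached := hs 18 (by omega) ▸ h.not_reached
  met := hs 19 (by omega) ▸ h.met
  not_met := hs 19 (by omega) ▸ h.not_met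

/-- The arc `x` that precedes `a` on a path is recognized by the distance to its successor. -/
theorem labCmd_spec (hE : N.SphereEmbedding) (hN : N.Normalized) (ho : N.IsTopological N.ord)
    {t : ℕ} (h : N.Simulates r i t s) (hv : v 9 = t)
    (hcode : ∀ x y, Meet x y → x ≠ y → N.ord (N.tgt x) = t → s 20 (N.par * x + y) = r.code x y)
    (a : Fin N.m) :
    (((∃ h, N.src a = N.org h) ∨ N.ord (N.src a) < t + 1) →
      labCmd.exec N.par v s 18 a = (r.lab a : ℕ) + 1) ∧
    (¬ ((∃ h, N.src a = N.org h) ∨ N.ord (N.src a) < t + 1) →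
      labCmd.exec N.par v s 18 a = 0) := by
  have hin : N.Spec i 0 (s 0) := h.prepared 0 (by omega)
  have h7 : N.Spec i 7 (s 7) := h.prepared 7 (by omega)
  rw [labCmd, exec_tab_self (by simpa using arc_lt_par a)]
  set w := Function.update v 0 (a : ℕ) with hw
  have hw0 : (TExpr.var 0).eval N.par s w = a := by simp [eval, hw]
  rw [eval]
  have e0 : (TExpr.rd 18 (.var 0)).eval N.par s w = s 18 a := by rw [eval, hw0]
  rw [e0]
  by_cases hold : (∃ h, N.src a = N.org h) ∨ N.ord (N.src a) < t
  · rw [h.reached a hold, if_pos (Nat.succ_ne_zero _)]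
    exact ⟨fun _ => rfl, fun hn => absurd (hold.imp_right fun h => by omega) hn⟩
  rw [h.not_reached a hold, if_neg (by omega), eval]
  have hcond : (equ (.rd 7 (srcE (.var 0))) (.var 9)).eval N.par s w ≠ 0 ↔
      N.ord (N.src a) = t := by
    have k1 : (TExpr.rd 7 (srcE (.var 0))).eval N.par s w = N.ord (N.src a) := by
      rw [eval, eval_srcE hin hw0, h7]
    have k2 : (TExpr.var 9).eval N.par s w = t := by simp [eval, hw, hv]
    rw [eval_equ, k1, k2]
  by_cases ht : N.ord (N.src a) = t
  swap
  · rw [if_neg (mt hcond.1 ht)]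
    exact ⟨fun hn => absurd (hn.imp_right fun h => by omega) hold, fun _ => rfl⟩
  rw [if_pos (hcond.2 ht)]
  refine ⟨fun _ => ?_, fun hn => absurd (Or.inr (by omega)) hn⟩
  -- the sum has a single nonzero term, that of the arc `x` which precedes `a`
  obtain ⟨x, hx, hxa⟩ := r.exists_nxt a fun j hj => hold (Or.inl ⟨j, hj⟩)
  have hterm : ∀ x' : Fin N.m, (conj (equ (tgtE (.var 1)) (srcE (.var 0)))
      (equ (entry 5 (inE (.var 1)) (outE (.var 0)))
        (.add (.add (.lit 1) (.add (behaviourCountE 2) (behaviourCountE 2)))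
          (behaviourCountE 1)))).eval N.par s (Function.update w 1 x') ≠ 0 ↔ x' = x := by
    intro x'
    have h1 : (TExpr.var 1).eval N.par s (Function.update w 1 x') = x' := by simp [eval]
    have h0 : (TExpr.var 0).eval N.par s (Function.update w 1 x') = a := by simp [eval, hw]
    rw [eval_conj, eval_equ, eval_tgtE hin h1, eval_srcE hin h0, Fin.val_inj]
    have hd : N.tgt x' = N.src a → ((equ (entry 5 (inE (.var 1)) (outE (.var 0)))
        (.add (.add (.lit 1) (.add (behaviourCountE 2) (behaviourCountE 2)))
          (behaviourCountE 1))).eval N.par s (Function.update w 1 x') ≠ 0 ↔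
        cdist N.rot (x', true) (a, false) = cdist N.rot (x', true) (r.nxt x', false)) := by
      intro hx'
      rw [eval_equ, eval_dist h.prepared (eval_inE h1) (eval_outE h0) hx',
        eval_next hE hN h.prepared (x := x') (fun j hj => hN.2.2.2.2 j a (hx'.symm.trans hj))
          (fun y hm hy => hcode x' y hm hy (hx' ▸ ht)) (by simp)]
    constructor
    · rintro ⟨hx', he⟩
      have hxs : ∀ j, N.tgt x' ≠ N.snk j := fun j hj => hN.2.2.2.2 j a (hx'.symm.trans hj)
      have := cdist_inj (hE.sameCycle (d := (x', true)) (e := (a, false)) hx')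
        (hE.sameCycle (d := (x', true)) (e := (r.nxt x', false)) (r.src_nxt x' hxs).symm)
        ((hd hx').1 he)
      refine r.nxt_inj hxs (hx'.trans hxa.symm) ?_
      rw [hx]
      exact (congrArg Prod.fst this).symm
    · rintro rfl
      exact ⟨hxa, (hd hxa).2 (by rw [hx])⟩
  rw [eval_sumBelow _ hin.1.1.2.1 m_le_par, Finset.sum_eq_single x]
  · rw [eval, if_pos ((hterm x).2 rfl), eval, eval, Function.update_self, h.reached x (Or.inr ?_),
      ← hx, r.lab_nxt x fun j hj => hN.2.2.2.2 j a (hxa.symm.trans hj)]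
    have := ho.2 x
    rw [hxa] at this
    omega
  · intro x' _ hx'
    rw [eval, if_neg (mt (hterm x').1 hx'), eval]
  · exact fun hn => absurd (Finset.mem_univ x) hn

/-- The entries that are already set are kept; the others become a sum of at most one behaviour. -/
theorem outCmd_eval (hin : N.Spec i 0 (s 0)) (h1 : N.Spec i 1 (s 1)) (h2 : N.Spec i 2 (s 2))
    (h3 : N.Spec i 3 (s 3)) (h7 : N.Spec i 7 (s 7))
    {t : ℕ} (hv : v 9 = t) (hlab : ∀ a, N.ord (N.tgt a) = t → s 18 a = (r.lab a : ℕ) + 1)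
    (p q : Fin N.m) : outCmd.exec N.par v s 19 (N.par * p + q) =
      if s 19 (N.par * p + q) ≠ 0 then s 19 (N.par * p + q) else
        open Classical in ∑ x : Fin N.m, ∑ y : Fin N.m,
          if N.tgt x = N.tgt y ∧ N.ord (N.tgt x) = t ∧ r.lab x = p ∧ r.lab y = q ∧
            N.src p ≠ N.src q then s 20 (N.par * x + y) else 0 := by
  classical
  rw [outCmd, exec_tab_self (by simpa using index_lt (arc_lt_par p) (arc_lt_par q))]
  set w := Function.update v 0 (N.par * (p : ℕ) + q) with hw
  have hw0 : w 0 = N.par * p + q := Function.update_self ..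
  have e0 : (TExpr.rd 19 (.var 0)).eval N.par s w = s 19 (N.par * p + q) := by rw [eval, eval, hw0]
  rw [eval, e0]
  congr 1
  rw [eval_sumBelow _ hin.1.1.2.1 m_le_par]
  refine Finset.sum_congr rfl fun x _ => ?_
  rw [eval_sumBelow _ hin.1.1.2.1 m_le_par]
  refine Finset.sum_congr rfl fun y _ => ?_
  set w' := Function.update (Function.update w 1 (x : ℕ)) 2 (y : ℕ) with hw'
  have g0 : w' 0 = N.par * p + q := by simp [hw', hw0]
  have g1 : (TExpr.var 1).eval N.par s w' = x := by simp [eval, hw']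
  have g2 : (TExpr.var 2).eval N.par s w' = y := by simp [eval, hw']
  have g9 : (TExpr.var 9).eval N.par s w' = t := by simp [eval, hw', hw, hv]
  have row := eval_rowE h2 (arc_lt_par p) (arc_lt_par q) g0
  have col := eval_colE h3 (arc_lt_par p) (arc_lt_par q) g0
  have hc : (conj (equ (tgtE (.var 1)) (tgtE (.var 2)))
      (conj (equ (.rd 7 (tgtE (.var 1))) (.var 9))
        (conj (equ (.rd 18 (.var 1)) (.add rowE (.lit 1)))
          (conj (equ (.rd 18 (.var 2)) (.add colE (.lit 1)))
            (neg (equ (srcE rowE) (srcE colE))))))).eval N.par s w' ≠ 0 ↔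
      N.tgt x = N.tgt y ∧ N.ord (N.tgt x) = t ∧ r.lab x = p ∧ r.lab y = q ∧
        N.src p ≠ N.src q := by
    have k1 : (TExpr.rd 7 (tgtE (.var 1))).eval N.par s w' = N.ord (N.tgt x) := by
      rw [eval, eval_tgtE hin g1, h7]
    have k2 : (TExpr.add rowE (.lit 1)).eval N.par s w' = (p : ℕ) + 1 := by rw [eval, row, eval]
    have k3 : (TExpr.add colE (.lit 1)).eval N.par s w' = (q : ℕ) + 1 := by rw [eval, col, eval]
    have k4 : (TExpr.rd 18 (.var 1)).eval N.par s w' = s 18 x := by rw [eval, g1]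
    have k5 : (TExpr.rd 18 (.var 2)).eval N.par s w' = s 18 y := by rw [eval, g2]
    rw [eval_conj, eval_conj, eval_conj, eval_conj, eval_neg, eval_equ, eval_equ, eval_equ,
      eval_equ, eval_equ, eval_tgtE hin g1, eval_tgtE hin g2, Fin.val_inj, k1, g9, k2, k3, k4, k5,
      eval_srcE hin row, eval_srcE hin col, Fin.val_inj]
    refine and_congr_right fun ht => and_congr_right fun hxt => ?_
    rw [hlab x hxt, hlab y (ht ▸ hxt), Nat.add_right_cancel_iff, Nat.add_right_cancel_iff,
      Fin.val_inj, Fin.val_inj]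
  rw [eval]
  by_cases hcc : N.tgt x = N.tgt y ∧ N.ord (N.tgt x) = t ∧ r.lab x = p ∧ r.lab y = q ∧
      N.src p ≠ N.src q
  · rw [if_pos (hc.2 hcc), if_pos hcc, eval_entry h1 g1 (arc_lt_par x), g2]
  · rw [if_neg (mt hc.1 hcc), if_neg hcc, eval]

theorem Simulates.step (hE : N.SphereEmbedding) (hN : N.Normalized) (ho : N.IsTopological N.ord)
    (hr : r.IsUncrossed N.ord) (hi : N.Encodes r i) {t : ℕ} (hv : v 9 = t)
    (h : N.Simulates r i t s) : N.Simulates r i (t + 1) (roundCmd.exec N.par v s) := by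
  classical
  -- `s₁`, `s₂`, `s₃` are the tables after the three commands of the round
  have g : N.Simulates r i t (codeCmd.exec N.par v s) :=
    h.congr fun A hA => exec_tab_of_ne (by omega)
  have gcode : ∀ x y, Meet x y → x ≠ y → N.ord (N.tgt x) = t →
      codeCmd.exec N.par v s 20 (N.par * x + y) = r.code x y :=
    fun x y hm hxy ht => h.code hE hN ho hr hi hm hxy ht
  rw [roundCmd, exec_seq, exec_seq]
  generalize codeCmd.exec N.par v s = s₁ at g gcode
  have hl := labCmd_spec hE hN ho g hv gcode
  have hl' : ∀ A, A ≠ 18 → labCmd.exec N.par v s₁ A = s₁ A := fun A hA => exec_tab_of_ne hA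
  generalize labCmd.exec N.par v s₁ = s₂ at hl hl'
  have p2 : N.Prepared i 18 s₂ := g.prepared.congr fun A hA => hl' A (by omega)
  have hout := outCmd_eval (r := r) (p2 0 (by omega)) (p2 1 (by omega)) (p2 2 (by omega))
    (p2 3 (by omega)) (p2 7 (by omega)) hv
    (fun a ha => (hl a).1 (Or.inr (by have := ho.2 a; omega)))
  have hout' : ∀ A, A ≠ 19 → outCmd.exec N.par v s₂ A = s₂ A := fun A hA => exec_tab_of_ne hA
  generalize outCmd.exec N.par v s₂ = s₃ at hout hout'
  rw [hl' 19 (by omega), hl' 20 (by omega)] at hout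
  refine ⟨p2.congr fun A hA => hout' A (by omega), ?_, ?_, ?_, ?_⟩
  · rw [hout' 18 (by omega)]
    exact fun a => (hl a).1
  · rw [hout' 18 (by omega)]
    exact fun a => (hl a).2
  · intro x y hf hlt
    rw [hout]
    rcases Nat.lt_succ_iff_lt_or_eq.1 hlt with hlt | ht
    · have := g.met x y hf hlt
      rw [this, if_pos (code_ne_zero x y)]
    · have h0 := g.not_met (r.lab x) (r.lab y) fun x' y' hx' hy' hf' hlt' => by
        rw [(hf.unique ho hf' hx' hy').1] at hlt'
        omega
      rw [h0, if_neg (by omega), Finset.sum_eq_single x, Finset.sum_eq_single y,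
        if_pos ⟨hf.1, ht, rfl, rfl, hf.2.1⟩]
      · exact gcode x y (meet_of_ne hf.1 hf.2.1) (fun he => hf.2.1 (by rw [he])) ht
      · exact fun y' _ hy' => if_neg fun hc =>
          hy' (r.in_inj y' y (hc.1.symm.trans hf.1) hc.2.2.2.1)
      · exact fun hn => absurd (Finset.mem_univ y) hn
      · exact fun x' _ hx' => Finset.sum_eq_zero fun y' _ => if_neg fun hc =>
          hx' (r.in_inj x' x (ho.1 (hc.2.1.trans ht.symm)) hc.2.2.1)
      · exact fun hn => absurd (Finset.mem_univ x) hn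
  · intro p q hpq
    rw [hout, g.not_met p q fun x y hx hy hf hlt => hpq x y hx hy hf (by omega),
      if_neg (by omega)]
    refine Finset.sum_eq_zero fun x _ => Finset.sum_eq_zero fun y _ => if_neg ?_
    rintro ⟨ht, hxt, rfl, rfl, hne⟩
    -- the paths of `x` and `y` would have met first here or before
    by_cases hb : r.MetBefore N.ord x y
    · obtain ⟨x', y', hx', hy', hf, hlt⟩ := MetBefore.exists_firstMeet hb hne
      exact hpq x' y' hx' hy' hf (by omega)
    · exact hpq x y rfl rfl ⟨ht, hne, hb⟩ (by omega)

end Network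

open TExpr TCmd

namespace Network

variable {N : Network} {i : ℕ} {s : ℕ → ℕ → ℕ} {v : ℕ → ℕ} {r : N.Routing}

open Routing

/-! ### The result of the algorithm -/

theorem prepared_prepareCmd (hE : N.SphereEmbedding) (hA : N.Acyclic) (hEu : N.Eulerian)
    (hN : N.Normalized) (hi : i < N.R ^ (4 * N.k ^ 2)) (h : N.Spec i 0 (s 0)) :
    N.Prepared i 18 (prepareCmd.exec N.par v s) := by
  have h1 : N.Prepared i 1 s := fun A hA => by
    obtain rfl : A = 0 := by omega
    exact h
  simp only [prepareCmd, List.map_cons, List.map_nil, List.foldl_cons, List.foldl_nil, exec_seq]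
  exact ((((((((((((((((h1.mul_par_table (v := v)).row_table).col_table).rotPow_table).dist_table
    hE).reach_table hA).ord_table).mul_demands_table).mul_arcs_table).demand_table
    hN).isStart_table).pos_table).base_table hEu hN).pow_table hEu hN).rem_table hEu hN
    hi).digits_table hEu hN).cross_table

theorem simulates_initCmd (h : N.Prepared i 18 s) : N.Simulates r i 0 (initCmd.exec N.par v s) := by
  have h11 : N.Spec i 11 (s 11) := h 11 (by omega)
  have e19 : ∀ p q : Fin N.m, initCmd.exec N.par v s 19 (N.par * p + q) = 0 := fun p q => by
    rw [initCmd, exec_seq, exec_tab_self (by simpa using index_lt (arc_lt_par p) (arc_lt_par q)),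
      eval]
  have e18 : ∀ a : Fin N.m, initCmd.exec N.par v s 18 a = if s 11 a ≠ 0 then (a : ℕ) + 1 else 0 := by
    intro a
    rw [initCmd, exec_seq, exec_tab_of_ne (by omega), exec_tab_self (by simpa using arc_lt_par a)]
    simp only [eval, Function.update_self]
  refine ⟨h.congr fun A hA => ?_, fun a ha => ?_, fun a ha => ?_, fun x y hf ht => ?_,
    fun p q _ => e19 p q⟩
  · rw [initCmd, exec_seq, exec_tab_of_ne (by omega), exec_tab_of_ne (by omega)]
  · obtain ⟨j, hj⟩ := ha.resolve_right (by omega)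
    rw [e18, if_pos ((h11 a).2 ⟨j, hj⟩), r.lab_start a j hj]
  · rw [e18, if_neg (mt (h11 a).1 fun hj => ha (Or.inl hj))]
  · omega

theorem arrangeCmd_spec (h : N.Prepared i 18 s) (a b : Fin N.m) :
    arrangeCmd.exec N.par v s 21 (a * N.m + b) = s 19 (N.par * a + b) := by
  have hin : N.Spec i 0 (s 0) := h 0 (by omega)
  have h9 : N.Spec i 9 (s 9) := h 9 (by omega)
  have hlt : (a : ℕ) * N.m + b < N.par ^ 2 := by
    refine lt_of_le_of_lt ?_ (index_lt (arc_lt_par a) (arc_lt_par b))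
    rw [mul_comm]
    exact Nat.add_le_add_right (Nat.mul_le_mul_right _ m_le_par) _
  rw [arrangeCmd, exec_tab_self (by simpa using hlt), eval_sumBelow _ hin.1.1.2.1 m_le_par]
  have hterm : ∀ x y : Fin N.m, (TExpr.ite (equ (.add (.rd 9 (.var 1)) (.var 2)) (.var 0))
      (entry 19 (.var 1) (.var 2)) (.lit 0)).eval N.par s (Function.update (Function.update
        (Function.update v 0 ((a : ℕ) * N.m + b)) 1 (x : ℕ)) 2 (y : ℕ)) =
      if x = a ∧ y = b then s 19 (N.par * x + y) else 0 := by
    intro x y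
    set w := Function.update (Function.update
        (Function.update v 0 ((a : ℕ) * N.m + b)) 1 (x : ℕ)) 2 (y : ℕ) with hw
    have g1 : (TExpr.var 1).eval N.par s w = x := by simp [eval, hw]
    have g2 : (TExpr.var 2).eval N.par s w = y := by simp [eval, hw]
    have hc : (equ (.add (.rd 9 (.var 1)) (.var 2)) (.var 0)).eval N.par s w ≠ 0 ↔
        x = a ∧ y = b := by
      have k1 : (TExpr.add (.rd 9 (.var 1)) (.var 2)).eval N.par s w = N.m * x + y := by
        rw [eval, g2, eval, g1, h9 x (arc_lt_par x)]
      have k2 : (TExpr.var 0).eval N.par s w = N.m * a + b := by simp [eval, hw, mul_comm]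
      rw [eval_equ, k1, k2]
      constructor
      · intro he
        have hm : 0 < N.m := a.pos
        have d := congrArg (· / N.m) he
        have e := congrArg (· % N.m) he
        simp only [Nat.mul_add_div hm, Nat.div_eq_of_lt y.2,
          Nat.div_eq_of_lt b.2, Nat.mul_add_mod, Nat.mod_eq_of_lt y.2, Nat.mod_eq_of_lt b.2,
          add_zero] at d e
        exact ⟨Fin.ext d, Fin.ext e⟩
      · rintro ⟨rfl, rfl⟩
        rfl
    rw [eval]
    by_cases hxy : x = a ∧ y = b
    · rw [if_pos (hc.2 hxy), if_pos hxy, eval_entry (h 1 (by omega)) g1 (arc_lt_par x), g2]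
    · rw [if_neg (mt hc.1 hxy), if_neg hxy, eval]
  rw [Finset.sum_eq_single a]
  · rw [eval_sumBelow _ hin.1.1.2.1 m_le_par, Finset.sum_eq_single b, hterm, if_pos ⟨rfl, rfl⟩]
    · exact fun y _ hy => (hterm a y).trans (if_neg fun h => hy h.2)
    · exact fun hn => absurd (Finset.mem_univ b) hn
  · intro x _ hx
    rw [eval_sumBelow _ hin.1.1.2.1 m_le_par]
    exact Finset.sum_eq_zero fun y _ => (hterm x y).trans (if_neg fun h => hx h.1)
  · exact fun hn => absurd (Finset.mem_univ a) hn

theorem resultCmd_spec {W j : ℕ} (hW : 2 ≤ W) (hj : j < W ^ 2) (B : ℕ) :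
    resultCmd.exec W v s 22 (if j < B then W ^ 2 + j else j) =
      if s 21 j < 4 then s 21 j else 0 := by
  have hlt : (if j < B then W ^ 2 + j else j) < W ^ 3 := by
    have := Nat.mul_le_mul_left (W ^ 2) hW
    have h3 : W ^ 3 = W ^ 2 * W := pow_succ W 2
    split_ifs <;> omega
  rw [resultCmd, exec_tab_self (by simpa using hlt)]
  generalize hw : Function.update v 0 (if j < B then W ^ 2 + j else j) = w
  have h0 : (TExpr.var 0).eval W s w = if j < B then W ^ 2 + j else j := by
    rw [eval, ← hw, Function.update_self]
  have hwrap : wrapE.eval W s w = j := by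
    have h2 : (TExpr.sum 2 1 (.lit 1)).eval W s w = W ^ 2 := by simp [eval]
    rw [wrapE, eval]
    by_cases hB : j < B
    · rw [if_pos hB] at h0
      rw [if_neg fun h => by rw [eval_less, h0, h2] at h; omega, eval, h0, h2, Nat.add_sub_cancel_left]
    · rw [if_neg hB] at h0
      rw [if_pos (by rw [eval_less, h0, h2]; exact hj), h0]
  have h21 : (TExpr.rd 21 wrapE).eval W s w = s 21 j := by rw [eval, hwrap]
  rw [eval]
  by_cases h4 : s 21 j < 4
  · rw [if_pos (by rw [eval_less, h21]; exact h4), if_pos h4, h21]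
  · rw [if_neg (by rw [eval_less, h21]; exact h4), if_neg h4, eval]

/-- The output always consists of codes of values, even if the index does not describe a solution. -/
theorem algorithm_lt_four {W j : ℕ} (hW : 2 ≤ W) (hj : j < W ^ 2) (B : ℕ) :
    algorithm.exec W v s 22 (if j < B then W ^ 2 + j else j) < 4 := by
  rw [algorithm, exec_seq, resultCmd_spec hW hj]
  split_ifs <;> omega

/-- The algorithm computes the routing scheme of the solution whose parameters are the digits
of `i`. -/
theorem algorithm_spec (hE : N.SphereEmbedding) (hA : N.Acyclic) (hEu : N.Eulerian)
    (hN : N.Normalized) (hi : i < N.R ^ (4 * N.k ^ 2)) (h : N.Spec i 0 (s 0))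
    (hr : r.IsUncrossed N.ord) (hri : N.Encodes r i) {S : Finset (List (Fin N.m))}
    (hS : N.Traces S r) {ρ : N.RoutingScheme} (hρ : N.Respects S ρ) (a b : N.StartArc) (B : ℕ) :
    algorithm.exec N.par v s 22 (if (a.1 : ℕ) * N.m + b.1 < B then
      N.par ^ 2 + ((a.1 : ℕ) * N.m + b.1) else (a.1 : ℕ) * N.m + b.1) = valueCode (ρ a b) := by
  have ho := isTopological_ord hA
  have sim := exec_rep_induction (W := N.par) (v := v) (d := 2) (x := 9) (c := roundCmd)
    (P := fun t s' => N.Simulates r i t s')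
    (simulates_initCmd (r := r) (v := v) (prepared_prepareCmd (v := v) hE hA hEu hN hi h))
    (fun t _ s' hs' => hs'.step hE hN ho hr hri (Function.update_self ..))
  have hlt : (a.1 : ℕ) * N.m + b.1 < N.par ^ 2 := by
    refine lt_of_le_of_lt ?_ (index_lt (arc_lt_par a.1) (arc_lt_par b.1))
    rw [mul_comm]
    exact Nat.add_le_add_right (Nat.mul_le_mul_right _ m_le_par) _
  rw [algorithm, exec_seq, resultCmd_spec (by unfold par; omega) hlt, exec_seq, exec_seq, exec_seq,
    arrangeCmd_spec sim.prepared]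
  have key : ∀ c, c < 4 → valueCode (ρ a b) = c → ∀ d, d = c →
      (if d < 4 then d else 0) = valueCode (ρ a b) := by
    rintro c hc he d rfl
    rw [if_pos hc, he]
  have hv4 : valueCode (ρ a b) < 4 := by
    rcases ρ a b with _ | _ | _ | _ <;> decide
  refine key _ hv4 rfl _ ?_
  obtain ⟨v1, v2⟩ := hS.valueCode_eq hE hN ho hρ a b
  by_cases hf : ∃ x y, r.lab x = a.1 ∧ r.lab y = b.1 ∧ r.FirstMeet N.ord x y
  · obtain ⟨x, y, hx, hy, hf⟩ := hf
    rw [v1 x y hx hy hf, ← hx, ← hy]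
    exact sim.met x y hf (ord_lt _)
  · rw [v2 hf]
    exact sim.not_met _ _ fun x y hx hy h => absurd ⟨x, y, hx, hy, h⟩ hf

end Network

open TExpr TCmd

namespace Network

variable {N : Network} {i : ℕ} {s : ℕ → ℕ → ℕ} {r : N.Routing} {o : Fin N.n → ℕ}

open Routing

/-! ### Reading the input and the digits of the index -/

theorem _root_.List.getD_flatMap_pair {α : Type} (f : α → Bool → ℕ) (l : List α) {j : ℕ}
    (hj : j < l.length) (b : Bool) :
    (l.flatMap fun a => [f a false, f a true]).getD (2 * j + b.toNat) 0 = f l[j] b := by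
  induction l generalizing j with
  | nil => exact absurd hj (Nat.not_lt_zero j)
  | cons a l ih =>
    cases j with
    | zero => cases b <;> rfl
    | succ j =>
      rw [show 2 * (j + 1) + b.toNat = 2 * j + b.toNat + 2 by ring]
      exact ih (Nat.lt_of_succ_lt_succ hj)

theorem spec_input {f : ℕ → ℕ} (hf : ∀ x < N.par, f x = N.input i x) : N.Spec i 0 f := by
  have hpar : N.par = 4 * (N.n + N.m + N.k) + 4 := rfl
  have hd : ∀ d : Fin N.m × Bool, N.dartCode d < 2 * N.m := dartCode_lt
  have get : ∀ (l l' : List ℕ) (x y : ℕ), x = l.length + y → (l ++ l').getD x 0 = l'.getD y 0 := by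
    rintro l l' x y rfl
    rw [List.getD_append_right _ _ _ _ (Nat.le_add_right _ _), Nat.add_sub_cancel_left]
  have ofFn : ∀ {c : ℕ} (g : Fin c → ℕ) (a : Fin c), (List.ofFn g).getD a 0 = g a := by
    intro c g a
    rw [List.getD_eq_getElem _ _ (by simp)]
    simp
  have hlt : ∀ x < 4 + N.m + N.m + N.k + N.k + N.k + 2 * N.m, f x = N.input i x :=
    fun x hx => hf x (by omega)
  refine ⟨⟨⟨?_, ?_, ?_⟩, ?_⟩, fun a => ?_, fun a => ?_, fun a => ?_, fun a => ?_, fun a => ?_,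
    fun d => ?_⟩
  · rw [hlt _ (by omega)]; rfl
  · rw [hlt _ (by omega)]; rfl
  · rw [hlt _ (by omega)]; rfl
  · rw [hlt _ (by omega)]; rfl
  · rw [hlt _ (by omega), input, List.getD_append _ _ _ _ (by simp; omega),
      List.getD_append _ _ _ _ (by simp; omega), List.getD_append _ _ _ _ (by simp; omega),
      List.getD_append _ _ _ _ (by simp; omega), List.getD_append _ _ _ _ (by simp; omega),
      get _ _ _ a (by simp), ofFn]
  · rw [hlt _ (by omega), input, List.getD_append _ _ _ _ (by simp; omega),
      List.getD_append _ _ _ _ (by simp; omega), List.getD_append _ _ _ _ (by simp; omega),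
      List.getD_append _ _ _ _ (by simp; omega), get _ _ _ a (by simp; omega), ofFn]
  · rw [hlt _ (by omega), input, List.getD_append _ _ _ _ (by simp; omega),
      List.getD_append _ _ _ _ (by simp; omega), List.getD_append _ _ _ _ (by simp; omega),
      get _ _ _ a (by simp; omega), ofFn]
  · rw [hlt _ (by omega), input, List.getD_append _ _ _ _ (by simp; omega),
      List.getD_append _ _ _ _ (by simp; omega), get _ _ _ a (by simp; omega), ofFn]
  · rw [hlt _ (by omega), input, List.getD_append _ _ _ _ (by simp; omega),
      get _ _ _ a (by simp; omega), ofFn]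
  · rw [hlt _ (by have := hd d; omega), input, get _ _ _ (N.dartCode d) (by simp; omega), dartCode,
      List.getD_flatMap_pair (fun a b => N.dartCode (N.rot (a, b))) _ (by simp) d.2]
    simp

theorem exists_digits {R : ℕ} (K : ℕ) (g : ℕ → ℕ) (hg : ∀ j < K, g j < R) :
    ∃ i < R ^ K, ∀ j < K, i / R ^ j % R = g j := by
  induction K generalizing g with
  | zero => exact ⟨0, by simp, fun j hj => absurd hj (Nat.not_lt_zero j)⟩
  | succ K ih =>
    obtain ⟨i, hi, hd⟩ := ih (fun j => g (j + 1)) fun j hj => hg (j + 1) (by omega)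
    have h0 := hg 0 (by omega)
    refine ⟨g 0 + R * i, ?_, fun j hj => ?_⟩
    · have := Nat.mul_le_mul_left R (Nat.succ_le_of_lt hi)
      rw [Nat.succ_eq_add_one, Nat.mul_add, mul_one] at this
      rw [pow_succ, mul_comm (R ^ K)]
      omega
    · cases j with
      | zero => rw [pow_zero, Nat.div_one, Nat.add_mul_mod_self_left, Nat.mod_eq_of_lt h0]
      | succ j =>
        rw [pow_succ', ← Nat.div_div_eq_div_mul, Nat.add_mul_div_left _ _ (by omega),
          Nat.div_eq_of_lt h0, zero_add]
        exact hd j (by omega)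

theorem exists_digit_eq (g : ℕ → Fin N.k → Fin N.k → ℕ) (hg : ∀ c h h', g c h h' < N.R) :
    ∃ i < N.R ^ (4 * N.k ^ 2), ∀ c < 4, ∀ h h', N.digit i c h h' = g c h h' := by
  obtain ⟨i, hi, hd⟩ := exists_digits (R := N.R) (4 * N.k ^ 2)
    (fun j => if hq : j / 4 / N.k < N.k ∧ j / 4 % N.k < N.k then
      g (j % 4) ⟨j / 4 / N.k, hq.1⟩ ⟨j / 4 % N.k, hq.2⟩ else 0) fun j _ => by
        split_ifs
        · exact hg _ _ _
        · exact Nat.succ_pos _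
  refine ⟨i, hi, fun c hc h h' => (hd _ (digit_index_lt hc)).trans ?_⟩
  have hk : 0 < N.k := h.pos
  have e1 : (4 * (N.k * (h : ℕ) + h') + c) / 4 = N.k * h + h' := by omega
  have e2 : (4 * (N.k * (h : ℕ) + h') + c) % 4 = c := by omega
  have e3 : (N.k * (h : ℕ) + h') / N.k = h := by
    rw [Nat.mul_add_div hk, Nat.div_eq_of_lt h'.2, add_zero]
  have e4 : (N.k * (h : ℕ) + h') % N.k = h' := by
    rw [Nat.mul_add_mod, Nat.mod_eq_of_lt h'.2]
  simp only [e1, e2, e3, e4, Fin.eta, Fin.is_lt, and_self, dite_true]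

theorem req_lt_R (h : Fin N.k) : N.req h < N.R :=
  Nat.lt_succ_of_le (Finset.le_sup (Finset.mem_univ h))

/-- Every uncrossed solution is described by an index below `R ^ (4 k²)`. -/
theorem exists_encodes (hE : N.SphereEmbedding) (hEu : N.Eulerian) (hN : N.Normalized)
    (ho : N.IsTopological N.ord) (hr : r.IsUncrossed N.ord) :
    ∃ i < N.R ^ (4 * N.k ^ 2), N.Encodes r i := by
  obtain ⟨A, B, hAB, hX⟩ := exists_intervals hE hEu hN ho hr
  obtain ⟨τ, hτ, hT⟩ := exists_threshold hE hEu hN ho hr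
  obtain ⟨i, hi, hd⟩ := exists_digit_eq
    (fun c h h' => if c = 0 then A h h' else if c = 1 then B h h' else τ h h') fun c h h' => by
      have := hAB h h'
      have := hτ h h'
      have := req_lt_R h
      split_ifs <;> omega
  have d0 : ∀ h h', N.digit i 0 h h' = A h h' := fun h h' => hd 0 (by omega) h h'
  have d1 : ∀ h h', N.digit i 1 h h' = B h h' := fun h h' => hd 1 (by omega) h h'
  have d2 : ∀ h h', N.digit i 2 h h' = τ h h' := fun h h' => hd 2 (by omega) h h'
  refine ⟨i, hi, fun h h' p q hne hp hq => ?_, fun h h' x y hm hx hp hq => ?_⟩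
  · rw [d0, d1, d0, d1]
    exact hX h h' p q hne hp hq
  · rw [d2]
    exact hT h h' x y hm hx hp hq

/-- The value of a routing scheme with a given number. -/
def valueOfCode : ℕ → Option Behaviour
  | 1 => some .cross
  | 2 => some .left
  | 3 => some .right
  | _ => none

theorem valueOfCode_valueCode (β : Option Behaviour) : valueOfCode (valueCode β) = β := by
  rcases β with _ | _ | _ | _ <;> rfl

theorem valueCode_valueOfCode {c : ℕ} (hc : c < 4) : valueCode (valueOfCode c) = c := by
  interval_cases c <;> rfl

end Network

theorem mainTheorem2 :
    ∃ (prog : RAMProgram) (T : Polynomial ℕ), ∀ N : Network,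
      N.SphereEmbedding → N.Acyclic → N.Eulerian → N.Normalized →
      ∃ F : Set N.RoutingScheme,
        F.Finite ∧ F.ncard ≤ N.R ^ (4 * N.k ^ 2) ∧
        (∀ ρ : N.RoutingScheme, N.Feasible ρ → ρ ∈ F) ∧
        ∃ e : Fin (N.R ^ (4 * N.k ^ 2)) → N.RoutingScheme,
          Set.range e = F ∧
          ∀ i : Fin (N.R ^ (4 * N.k ^ 2)), ∃ (μ : ℕ → ℕ) (t : ℕ),
            RAMRun prog (N.input i.val) μ t ∧ t ≤ T.eval N.size ∧ N.Holds μ (e i) := by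
  obtain ⟨prog, T, hT⟩ := TCmd.exists_program algorithm 22
  refine ⟨prog, T, fun N hE hA hEu hN => ?_⟩
  have ho := Network.isTopological_ord hA
  have hrun : ∀ i, ∃ μ t, RAMRun prog (N.input i) μ t ∧ t ≤ T.eval N.size ∧
      (0 < N.size → ∃ (s : ℕ → ℕ → ℕ) (v : ℕ → ℕ), (∀ x < N.par, s 0 x = N.input i x) ∧
        ∃ B, ∀ j < N.par ^ 2, μ j =
          algorithm.exec N.par v s 22 (if j < B then N.par ^ 2 + j else j)) :=
    fun i => hT N.n N.m N.k (N.input i) rfl rfl rfl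
  choose μ t hrun ht hμ using hrun
  have hsize : ∀ a : N.StartArc, 0 < N.size := fun a => by
    have := a.1.pos
    unfold Network.size
    omega
  have hlt : ∀ a b : N.StartArc, (a.1 : ℕ) * N.m + b.1 < N.par ^ 2 := fun a b => by
    refine lt_of_le_of_lt ?_ (Network.index_lt (Network.arc_lt_par a.1) (Network.arc_lt_par b.1))
    rw [mul_comm]
    exact Nat.add_le_add_right (Nat.mul_le_mul_right _ Network.m_le_par) _
  -- `e i` is the routing scheme that the program writes into the memory
  let e : Fin (N.R ^ (4 * N.k ^ 2)) → N.RoutingScheme := fun i a b =>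
    Network.valueOfCode (μ i ((a.1 : ℕ) * N.m + b.1))
  refine ⟨Set.range e, Set.finite_range e, ?_, fun ρ hρ => ?_, e, rfl, fun i =>
    ⟨μ i, t i, hrun i, ht i, fun a b => ?_⟩⟩
  · rw [← Set.image_univ]
    refine (Set.ncard_image_le).trans ?_
    rw [Set.ncard_univ, Nat.card_eq_fintype_card, Fintype.card_fin]
  · obtain ⟨S, hS, hU, hR⟩ := hρ
    obtain ⟨r, hr⟩ := hS.exists_traces ho hEu hN
    have hrU := hr.isUncrossed hE hN ho hU
    obtain ⟨i, hi, henc⟩ := Network.exists_encodes hE hEu hN ho hrU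
    refine ⟨⟨i, hi⟩, funext fun a => funext fun b => ?_⟩
    obtain ⟨s, v, hs, B, hB⟩ := hμ i (hsize a)
    simp only [e]
    rw [hB _ (hlt a b), Network.algorithm_spec hE hA hEu hN hi (Network.spec_input hs) hrU henc hr hR,
      Network.valueOfCode_valueCode]
  · obtain ⟨s, v, -, B, hB⟩ := hμ i (hsize a)
    simp only [e]
    rw [hB _ (hlt a b)]
    exact (Network.valueCode_valueOfCode (Network.algorithm_lt_four (by unfold Network.par; omega)
      (hlt a b) B)).symm
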